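/- Let $g\ge 1$ and $n\ge 1$ be integers. Let $\Sigma_g$ be the closed orientable surface of genus $g$, obtained from a $4g$-gon by gluing its sides according to the word $a_1b_1a_1^{-1}b_1^{-1}\cdots a_gb_ga_g^{-1}b_g^{-1}$; all vertices become one point $*$, and the sides give loops $a_i,b_i$ at $*$. A closed surface of genus $g$ is a space homeomorphic to $\Sigma_g$. A standard generating system (basis) of a group $\pi$ consists of elements $\tilde x_1,\dots,\tilde x_g,\tilde y_1,\dots,\tilde y_g$ that generate $\pi$, satisfy $\prod_{i=1}^g[\tilde x_i,\tilde y_i]=e$, and whose relations are all consequences of this one. (1) Let $S$ be a closed surface of genus $g$, $\pi=\pi_1(S,s)$ and $p:\pi\to\mathbb Z/n\mathbb Z$ an epimorphism. Then $\pi$ has a standard generating system $\tilde x_1,\dots,\tilde x_g,\tilde y_1,\dots,\tilde y_g$ such that $p(\tilde x_1)$ generates $\mathbb Z/n\mathbb Z$ and $p(\tilde x_2)=\dots=p(\tilde x_g)=p(\tilde y_1)=\dots=p(\tilde y_g)=0$. (2) A standard cyclic covering of degree $n$ is a connected covering $q_0:E_0\to\Sigma_g$ such that, for some point $e_0$ over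 $*$, the image of $\pi_1(E_0,e_0)$ in $\pi_1(\Sigma_g,*)$ is the kernel of a homomorphism $\pi_1(\Sigma_g,*)\to\mathbb Z/n\mathbb Z$ that sends $a_1$ to a generator and $b_1,a_2,b_2,\dots,a_g,b_g$ to $0$. Such a covering exists, and it is normal with deck transformation group isomorphic to $\mathbb Z/n\mathbb Z$. Let $q:E\to S$ be any connected normal covering of a closed surface $S$ of genus $g$, with deck transformation group isomorphic to $\mathbb Z/n\mathbb Z$. Then $q$ is equivalent to every standard cyclic covering $q_0:E_0\to\Sigma_g$ of degree $n$: there are homeomorphisms $\Phi:E\to E_0$ and $\varphi:S\to\Sigma_g$ with $q_0\circ\Phi=\varphi\circ q$. -/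

import Mathlib

universe u v w

/-! ### The closed orientable surface of genus `g` as a `4g`-gon with identified sides -/

/-- The polygon: the closed unit disk in `ℂ`, whose boundary circle is divided into `4g` sides. -/
abbrev PolygonDisk : Type := Metric.closedBall (0 : ℂ) 1

/-- The boundary point of the polygon with parameter `θ`, where `θ` runs over `[0, 4g]`; the `k`-th
side is `θ ∈ [k, k + 1]`, and its end points are vertices. -/
noncomputable def boundaryPoint (g : ℕ) (θ : ℝ) : PolygonDisk :=
  ⟨Complex.exp ((2 * Real.pi * θ / (4 * g) : ℝ) * Complex.I), by
    rw [mem_closedBall_zero_iff, Complex.norm_exp_ofReal_mul_I]⟩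

theorem continuous_boundaryPoint (g : ℕ) : Continuous (boundaryPoint g) := by
  unfold boundaryPoint
  fun_prop

/-- The side identifications of the boundary word `a₀ b₀ a₀⁻¹ b₀⁻¹ ⋯ a_{g-1} b_{g-1} a_{g-1}⁻¹
b_{g-1}⁻¹`: the sides `4i` and `4i + 2` are glued with reversed direction, and so are the sides
`4i + 1` and `4i + 3`. -/
inductive SideGluing (g : ℕ) : PolygonDisk → PolygonDisk → Prop
  | a (i : Fin g) (t : ℝ) (ht : t ∈ Set.Icc (0 : ℝ) 1) :
      SideGluing g (boundaryPoint g (4 * (i : ℕ) + t)) (boundaryPoint g (4 * (i : ℕ) + 3 - t))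
  | b (i : Fin g) (t : ℝ) (ht : t ∈ Set.Icc (0 : ℝ) 1) :
      SideGluing g (boundaryPoint g (4 * (i : ℕ) + 1 + t)) (boundaryPoint g (4 * (i : ℕ) + 4 - t))

/-- The standard closed orientable surface of genus `g ≥ 1`, with the quotient topology (`Quot`
divides by the equivalence relation generated by the side identifications). -/
abbrev StandardSurface (g : ℕ) : Type := Quot (SideGluing g)

/-- `S` is a closed orientable (topological) surface of genus `g ≥ 1`. -/
def IsClosedSurface (g : ℕ) [NeZero g] (S : Type u) [TopologicalSpace S] : Prop :=
  Nonempty (S ≃ₜ StandardSurface g)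

namespace StandardSurface

/-- The image in the surface of the boundary point with parameter `θ`. -/
noncomputable def edgePoint (g : ℕ) (θ : ℝ) : StandardSurface g := Quot.mk _ (boundaryPoint g θ)

theorem continuous_edgePoint (g : ℕ) : Continuous (edgePoint g) :=
  continuous_quot_mk.comp (continuous_boundaryPoint g)

/-- The base point: the common image of all vertices of the polygon. -/
noncomputable def base (g : ℕ) : StandardSurface g := edgePoint g 0

theorem edgePoint_a (g : ℕ) (i : Fin g) (t : ℝ) (ht : t ∈ Set.Icc (0 : ℝ) 1) :
    edgePoint g (4 * (i : ℕ) + t) = edgePoint g (4 * (i : ℕ) + 3 - t) :=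
  Quot.sound (SideGluing.a i t ht)

theorem edgePoint_b (g : ℕ) (i : Fin g) (t : ℝ) (ht : t ∈ Set.Icc (0 : ℝ) 1) :
    edgePoint g (4 * (i : ℕ) + 1 + t) = edgePoint g (4 * (i : ℕ) + 4 - t) :=
  Quot.sound (SideGluing.b i t ht)

theorem vertex_three (g : ℕ) (i : Fin g) :
    edgePoint g (4 * (i : ℕ) + 3) = edgePoint g (4 * (i : ℕ)) := by
  have h := edgePoint_a g i 0 (by simp)
  rw [add_zero, sub_zero] at h
  exact h.symm

theorem vertex_two (g : ℕ) (i : Fin g) :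
    edgePoint g (4 * (i : ℕ) + 2) = edgePoint g (4 * (i : ℕ)) := by
  have h := edgePoint_b g i 1 (by simp)
  rw [show (4 * (i : ℕ) + 1 + 1 : ℝ) = 4 * (i : ℕ) + 2 by ring,
    show (4 * (i : ℕ) + 4 - 1 : ℝ) = 4 * (i : ℕ) + 3 by ring] at h
  rw [h, vertex_three]

theorem vertex_one (g : ℕ) (i : Fin g) :
    edgePoint g (4 * (i : ℕ) + 1) = edgePoint g (4 * (i : ℕ)) := by
  have h := edgePoint_a g i 1 (by simp)
  rw [show (4 * (i : ℕ) + 3 - 1 : ℝ) = 4 * (i : ℕ) + 2 by ring] at h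
  rw [h, vertex_two]

theorem vertex_four (g : ℕ) (i : Fin g) :
    edgePoint g (4 * (i : ℕ) + 4) = edgePoint g (4 * (i : ℕ)) := by
  have h := edgePoint_b g i 0 (by simp)
  rw [add_zero, sub_zero] at h
  rw [← h, vertex_one]

theorem vertex_zero (g : ℕ) (k : ℕ) (hk : k < g) : edgePoint g (4 * (k : ℝ)) = base g := by
  induction k with
  | zero => simp [base]
  | succ k ih =>
    have h := vertex_four g ⟨k, by omega⟩
    rw [← ih (by omega), ← h]
    congr 1
    push_cast
    ring

/-- The loop `a_i`, traversing the side `4i`. -/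
noncomputable def loopA (g : ℕ) (i : Fin g) : Path (base g) (base g) where
  toFun t := edgePoint g (4 * (i : ℕ) + t)
  continuous_toFun := (continuous_edgePoint g).comp (by fun_prop)
  source' := by simpa using vertex_zero g i i.2
  target' := by simpa using (vertex_one g i).trans (vertex_zero g i i.2)

/-- The loop `b_i`, traversing the side `4i + 1`. -/
noncomputable def loopB (g : ℕ) (i : Fin g) : Path (base g) (base g) where
  toFun t := edgePoint g (4 * (i : ℕ) + 1 + t)
  continuous_toFun := (continuous_edgePoint g).comp (by fun_prop)
  source' := by simpa using (vertex_one g i).trans (vertex_zero g i i.2)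
  target' := by
    have h := (vertex_two g i).trans (vertex_zero g i i.2)
    rw [← h, Set.Icc.coe_one]
    congr 1
    ring

/-- The class of `a_i` in the fundamental group. -/
noncomputable def genA (g : ℕ) (i : Fin g) : FundamentalGroup (StandardSurface g) (base g) :=
  FundamentalGroup.fromPath (Path.Homotopic.Quotient.mk (loopA g i))

/-- The class of `b_i` in the fundamental group. -/
noncomputable def genB (g : ℕ) (i : Fin g) : FundamentalGroup (StandardSurface g) (base g) :=
  FundamentalGroup.fromPath (Path.Homotopic.Quotient.mk (loopB g i))

end StandardSurface

/-! ### Standard generating systems -/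

open scoped commutatorElement

/-- The ordered product of commutators `[x₀, y₀] [x₁, y₁] ⋯ [x_{g-1}, y_{g-1}]`. -/
def commutatorProduct {G : Type u} [Group G] {g : ℕ} (x y : Fin g → G) : G :=
  (List.ofFn fun i => ⁅x i, y i⁆).prod

/-- `x`, `y` is a standard generating system ("basis") of the surface group `G`: these elements
generate `G`, the product of their commutators is trivial, and all relations between them are
consequences of this one; that is, `G = ⟨x, y ∣ ∏ [x_i, y_i] = 1⟩`. -/
structure IsStandardGeneratingSystem {G : Type u} [Group G] {g : ℕ} (x y : Fin g → G) : Prop where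
  generates : Subgroup.closure (Set.range x ∪ Set.range y) = ⊤
  relation : commutatorProduct x y = 1
  defining : (FreeGroup.lift (Sum.elim x y)).ker =
    Subgroup.normalClosure {commutatorProduct (fun i : Fin g => FreeGroup.of (Sum.inl i))
      (fun i : Fin g => FreeGroup.of (Sum.inr i))}

/-- The homomorphism `p` to `ℤ/n` sends `x₀` to a generator and `x₁, …, x_{g-1}, y₀, …, y_{g-1}`
to the neutral element. -/
structure IsStandardOn {G : Type u} [Group G] {g n : ℕ} [NeZero g]
    (p : G →* Multiplicative (ZMod n)) (x y : Fin g → G) : Prop where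
  generator : Subgroup.zpowers (p (x 0)) = ⊤
  trivial_x : ∀ i, i ≠ 0 → p (x i) = 1
  trivial_y : ∀ i, p (y i) = 1

/-! ### Coverings -/

/-- The group of deck transformations of `q : E → S`. -/
def deckGroup {E : Type u} {S : Type v} [TopologicalSpace E] (q : E → S) :
    Subgroup (E ≃ₜ E) where
  carrier := {f | ∀ e, q (f e) = q e}
  one_mem' _ := rfl
  mul_mem' {f h} hf hh e := (hf (h e)).trans (hh e)
  inv_mem' {f} hf e := by
    have h := hf (f.symm e)
    rw [f.apply_symm_apply] at h
    exact h.symm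

/-- `q : E → S` is a connected normal covering whose deck transformation group is cyclic of
order `n`. -/
structure IsCyclicNormalCovering (n : ℕ) {E : Type u} {S : Type v} [TopologicalSpace E]
    [TopologicalSpace S] (q : E → S) : Prop where
  isCoveringMap : IsCoveringMap q
  connected : ConnectedSpace E
  normal : ∀ e e' : E, q e = q e' → ∃ f ∈ deckGroup q, f e = e'
  deck : Nonempty (deckGroup q ≃* Multiplicative (ZMod n))

/-- `q : E → Σ_g` is a standard cyclic covering of degree `n`: it is the connected covering that
corresponds to the epimorphism `ρ : π₁(Σ_g) → ℤ/n` sending `a₀` to a generator and all other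
`a_i`, `b_i` to `0`, which means that the image of the fundamental group of `E` is `ker ρ`. -/
structure IsStandardCyclicCovering (g n : ℕ) [NeZero g] {E : Type u} [TopologicalSpace E]
    (q : C(E, StandardSurface g)) : Prop where
  isCoveringMap : IsCoveringMap q
  connected : ConnectedSpace E
  corresponds : ∃ (e : E) (he : q e = StandardSurface.base g)
    (ρ : FundamentalGroup (StandardSurface g) (StandardSurface.base g) →*
      Multiplicative (ZMod n)),
    IsStandardOn ρ (StandardSurface.genA g) (StandardSurface.genB g) ∧
      (FundamentalGroup.mapOfEq q he).range = ρ.ker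

/-- Two coverings are equivalent: there are homeomorphisms of the total spaces and of the bases
that form a commutative square with the covering maps. -/
def CoveringsEquivalent {E : Type u} {S : Type v} {E' : Type w} {S' : Type*} [TopologicalSpace E]
    [TopologicalSpace S] [TopologicalSpace E'] [TopologicalSpace S'] (q : E → S) (q' : E' → S') :
    Prop :=
  ∃ (Φ : E ≃ₜ E') (φ : S ≃ₜ S'), ∀ e, q' (Φ e) = φ (q e)

/-! A homomorphism from the surface group to ℤ/n is determined by its values α_i, β_i at the sides
a_i, b_i. Homeomorphisms of the surface change these 2g numbers, and a few explicit Dehn twists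
suffice to run the Euclidean algorithm on them until only α_0 is left. Hence for every epimorphism p
there is a homeomorphism φ fixing the base point such that p ∘ φ_* is standard on the sides
(`StandardSurface.exists_isStandardOn`). Both assertions follow from this.

The presentation of the group by the sides has three ingredients. The relation holds because the
boundary circle bounds the disk (`commutatorProduct_gen`). The sides generate because the surface is
covered by open sets that contract to the center, to the base point or to midpoints of sides, and a
subdivided loop can be rerouted piece by piece (`sideSubgroup_eq_top`). There are no further
relations because any elements x, y of a group G with ∏ [x_i, y_i] = 1 define a covering, glued from
copies of the polygon indexed by G, whose holonomy takes the sides to the inverses of x_i, y_i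
(`SurfaceCover.holonomy`). Taking G to be the abstractly presented group bounds the kernel. Products
of loops are performed from right to left here, so the basis consists of the inverses of the sides.

The twists live on annuli made of bands of chords of the polygon. A band between two sides glued to
each other changes one handle; two bands crossing b_0 and a_j link handle 0 with handle j. Their
images of the sides are read off in the simply connected disk, where a path may be replaced by any
other with the same ends. On the values they give α_i + β_i, β_i - α_i, and the addition of β_j -
α_0 to α_j and β_0. The Euclidean algorithm (`TwistMove.exists_reach_standard`) then clears
everything except α_0.

For (1), the inverse sides are transported by φ_* and by a homeomorphism to S. For (2), the covering
built from G = ℤ/n exists and is standard. A cyclic normal covering is the kernel covering of an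
epimorphism p; after composition with φ⁻¹ its subgroup becomes ker (p ∘ φ_*). This is the kernel of
any standard homomorphism, since two of these differ by a power map, and the lifting criterion gives
the homeomorphism of total spaces. -/

/-! ### Path classes through simply connected spaces -/

section Through

variable {X Y Z : Type*} [TopologicalSpace X] [TopologicalSpace Y] [TopologicalSpace Z]

/-- The class of the image under `K` of any path from `y` to `y'` in the simply connected
space `Y`, as a path class between `x = K y` and `x' = K y'`. -/
noncomputable def through [SimplyConnectedSpace Y] (K : C(Y, X)) (y y' : Y) {x x' : X}
    (hx : x = K y) (hx' : x' = K y') : Path.Homotopic.Quotient x x' :=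
  (Path.Homotopic.Quotient.mk ((PathConnectedSpace.somePath y y').map K.continuous)).cast hx hx'

/-- Paths with the same ends in a simply connected space are homotopic, so the arbitrary choice in
`through` may be replaced by any convenient path. From here on, homotopies reduce to comparing end
points. -/
theorem through_eq_mk [SimplyConnectedSpace Y] (K : C(Y, X)) {y y' : Y} {x x' : X}
    (hx : x = K y) (hx' : x' = K y') (δ : Path y y') (γ : Path x x') (h : ∀ t, γ t = K (δ t)) :
    through K y y' hx hx' = Path.Homotopic.Quotient.mk γ := by
  subst hx hx'
  have : γ = δ.map K.continuous := by ext t; exact h t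
  rw [this, through, Path.Homotopic.Quotient.cast_rfl_rfl, Path.Homotopic.Quotient.eq]
  exact (SimplyConnectedSpace.paths_homotopic _ _).map K

theorem through_trans [SimplyConnectedSpace Y] (K : C(Y, X)) (y y' y'' : Y) {x x' x'' : X}
    (hx : x = K y) (hx' : x' = K y') (hx'' : x'' = K y'') :
    (through K y y' hx hx').trans (through K y' y'' hx' hx'') = through K y y'' hx hx'' := by
  subst hx hx' hx''
  simp only [through, Path.Homotopic.Quotient.cast_rfl_rfl]
  rw [← Path.Homotopic.Quotient.mk_trans, ← Path.map_trans, Path.Homotopic.Quotient.eq]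
  exact (SimplyConnectedSpace.paths_homotopic _ _).map K

theorem through_refl [SimplyConnectedSpace Y] (K : C(Y, X)) (y : Y) {x : X} (hx : x = K y) :
    through K y y hx hx = Path.Homotopic.Quotient.refl x :=
  through_eq_mk K hx hx (Path.refl y) (Path.refl x) fun _ => hx

theorem through_symm [SimplyConnectedSpace Y] (K : C(Y, X)) (y y' : Y) {x x' : X}
    (hx : x = K y) (hx' : x' = K y') :
    (through K y y' hx hx').symm = through K y' y hx' hx := by
  have h := through_trans K y' y y' hx' hx hx'
  rw [through_refl] at h
  calc (through K y y' hx hx').symm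
      = ((through K y' y hx' hx).trans (through K y y' hx hx')).trans
          (through K y y' hx hx').symm := by rw [h, Path.Homotopic.Quotient.refl_trans]
    _ = _ := by simp

/-- Both classes are represented by the same path in `X`. This is how gluings enter: two different
paths of the polygon with the same image define one class. -/
theorem through_congr [SimplyConnectedSpace Y] [SimplyConnectedSpace Z] (K : C(Y, X))
    (K' : C(Z, X)) {y y' : Y} {z z' : Z} {x x' : X} (hx : x = K y) (hx' : x' = K y')
    (hz : x = K' z) (hz' : x' = K' z') (δ : Path y y') (δ' : Path z z')
    (h : ∀ t, K (δ t) = K' (δ' t)) : through K y y' hx hx' = through K' z z' hz hz' := by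
  have e1 := through_eq_mk K hx hx' δ ((δ.map K.continuous).cast hx hx') fun _ => rfl
  have e2 := through_eq_mk K' hz hz' δ' ((δ.map K.continuous).cast hx hx') h
  rw [e1, e2]

theorem through_comp [SimplyConnectedSpace Y] [SimplyConnectedSpace Z] (K : C(Y, X))
    (κ : C(Z, Y)) {z z' : Z} {y y' : Y} {x x' : X} (hx : x = K y) (hx' : x' = K y')
    (hz : x = K (κ z)) (hz' : x' = K (κ z')) (hy : y = κ z) (hy' : y' = κ z') :
    through K y y' hx hx' = through (K.comp κ) z z' hz hz' := by
  subst hy hy'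
  exact through_congr K (K.comp κ) hx hx' hz hz'
    ((PathConnectedSpace.somePath z z').map κ.continuous) (PathConnectedSpace.somePath z z')
    fun _ => rfl

end Through

instance : SimplyConnectedSpace PolygonDisk :=
  have : ContractibleSpace PolygonDisk :=
    (convex_closedBall (0 : ℂ) 1).contractibleSpace ⟨0, by simp⟩
  inferInstance

instance : LocallyPathConnectedSpace PolygonDisk :=
  (convex_closedBall (0 : ℂ) 1).locallyPathConnectedSpace

/-! ### Arcs of the boundary circle as elements of the fundamental group. -/

namespace StandardSurface

/-- The projection of the polygon to the surface. -/
def proj (g : ℕ) : C(PolygonDisk, StandardSurface g) := ⟨Quot.mk _, continuous_quot_mk⟩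

/-- `edgePoint` as a continuous map. -/
noncomputable def edgeMap (g : ℕ) : C(ℝ, StandardSurface g) := ⟨edgePoint g, continuous_edgePoint g⟩

theorem boundaryPoint_add_period (g : ℕ) [NeZero g] (θ : ℝ) :
    boundaryPoint g (θ + 4 * g) = boundaryPoint g θ := by
  have hg : (g : ℝ) ≠ 0 := Nat.cast_ne_zero.2 (NeZero.ne g)
  apply Subtype.ext
  simp only [boundaryPoint]
  rw [Complex.exp_eq_exp_iff_exists_int]
  refine ⟨1, ?_⟩
  push_cast
  have : (g : ℂ) ≠ 0 := Nat.cast_ne_zero.2 (NeZero.ne g)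
  field_simp

theorem base_eq_zero (g : ℕ) (i : Fin g) : base g = edgePoint g (4 * (i : ℕ)) :=
  (vertex_zero g i i.2).symm

theorem base_eq_one (g : ℕ) (i : Fin g) : base g = edgePoint g (4 * (i : ℕ) + 1) :=
  (base_eq_zero g i).trans (vertex_one g i).symm

theorem base_eq_two (g : ℕ) (i : Fin g) : base g = edgePoint g (4 * (i : ℕ) + 2) :=
  (base_eq_zero g i).trans (vertex_two g i).symm

theorem base_eq_three (g : ℕ) (i : Fin g) : base g = edgePoint g (4 * (i : ℕ) + 3) :=
  (base_eq_zero g i).trans (vertex_three g i).symm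

theorem base_eq_four (g : ℕ) (i : Fin g) : base g = edgePoint g (4 * (i : ℕ) + 4) :=
  (base_eq_zero g i).trans (vertex_four g i).symm

theorem base_eq_mul (g : ℕ) [NeZero g] (k : ℕ) (hk : k ≤ g) :
    base g = edgePoint g (4 * (k : ℝ)) := by
  rcases hk.lt_or_eq with h | rfl
  · exact base_eq_zero g ⟨k, h⟩
  · have := boundaryPoint_add_period k 0
    rw [zero_add] at this
    rw [edgePoint, this]
    rfl

/-- The class of the part of the boundary path with parameters from `θ` to `θ'`. -/
noncomputable abbrev arc (g : ℕ) (θ θ' : ℝ) {x x' : StandardSurface g} (hx : x = edgePoint g θ)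
    (hx' : x' = edgePoint g θ') : Path.Homotopic.Quotient x x' :=
  through (edgeMap g) θ θ' hx hx'

/-- The class of the image of any path from `z` to `z'` in the polygon. -/
noncomputable abbrev diskClass (g : ℕ) (z z' : PolygonDisk) {x x' : StandardSurface g}
    (hx : x = proj g z) (hx' : x' = proj g z') : Path.Homotopic.Quotient x x' :=
  through (proj g) z z' hx hx'

theorem edgePoint_eq (g : ℕ) (θ : ℝ) : edgePoint g θ = proj g (boundaryPoint g θ) := rfl

/-- The parametrized boundary factors through the simply connected disk, so a path through the
interior may be pushed onto the boundary. The 2-cell is used in this form throughout. -/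
theorem diskClass_boundary (g : ℕ) (θ θ' : ℝ) {x x' : StandardSurface g}
    (hx : x = proj g (boundaryPoint g θ)) (hx' : x' = proj g (boundaryPoint g θ')) :
    diskClass g (boundaryPoint g θ) (boundaryPoint g θ') hx hx' =
      arc g θ θ' (hx.trans (edgePoint_eq g θ).symm) (hx'.trans (edgePoint_eq g θ').symm) :=
  through_comp (proj g) ⟨boundaryPoint g, continuous_boundaryPoint g⟩ hx hx' hx hx' rfl rfl

/-- The affine path in `ℝ`. -/
noncomputable def linePath (a b : ℝ) : Path a b where
  toFun t := a + t * (b - a)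
  continuous_toFun := by fun_prop
  source' := by simp
  target' := by simp

theorem linePath_mem {a b s t : ℝ} (hs : s ∈ Set.Icc a b) (ht : t ∈ Set.Icc a b)
    (r : unitInterval) : linePath s t r ∈ Set.Icc a b := by
  have := (convex_Icc a b) hs ht (sub_nonneg.2 r.2.2) r.2.1 (by ring)
  convert! this using 1
  simp only [linePath, smul_eq_mul]
  change s + r * (t - s) = _
  ring

/-- The two arcs are glued point by point. The parameter on the partner side decreases, which is why
the third side of a handle contributes an inverse. -/
theorem arc_a (g : ℕ) (i : Fin g) {s t : ℝ} (hs : s ∈ Set.Icc (0 : ℝ) 1)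
    (ht : t ∈ Set.Icc (0 : ℝ) 1) {x x' : StandardSurface g}
    (hx : x = edgePoint g (4 * (i : ℕ) + s)) (hx' : x' = edgePoint g (4 * (i : ℕ) + t)) :
    arc g (4 * (i : ℕ) + s) (4 * (i : ℕ) + t) hx hx' =
      arc g (4 * (i : ℕ) + 3 - s) (4 * (i : ℕ) + 3 - t) (hx.trans (edgePoint_a g i s hs))
        (hx'.trans (edgePoint_a g i t ht)) := by
  refine through_congr _ _ _ _ _ _ ((linePath s t).map (f := fun r => 4 * (i : ℕ) + r)
    (by fun_prop)) ((linePath s t).map (f := fun r => 4 * (i : ℕ) + 3 - r) (by fun_prop)) ?_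
  exact fun r => edgePoint_a g i _ (linePath_mem hs ht r)

theorem arc_b (g : ℕ) (i : Fin g) {s t : ℝ} (hs : s ∈ Set.Icc (0 : ℝ) 1)
    (ht : t ∈ Set.Icc (0 : ℝ) 1) {x x' : StandardSurface g}
    (hx : x = edgePoint g (4 * (i : ℕ) + 1 + s)) (hx' : x' = edgePoint g (4 * (i : ℕ) + 1 + t)) :
    arc g (4 * (i : ℕ) + 1 + s) (4 * (i : ℕ) + 1 + t) hx hx' =
      arc g (4 * (i : ℕ) + 4 - s) (4 * (i : ℕ) + 4 - t) (hx.trans (edgePoint_b g i s hs))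
        (hx'.trans (edgePoint_b g i t ht)) := by
  refine through_congr _ _ _ _ _ _ ((linePath s t).map (f := fun r => 4 * (i : ℕ) + 1 + r)
    (by fun_prop)) ((linePath s t).map (f := fun r => 4 * (i : ℕ) + 4 - r) (by fun_prop)) ?_
  exact fun r => edgePoint_b g i _ (linePath_mem hs ht r)

theorem arc_congr (g : ℕ) {θ θ' η η' : ℝ} {x x' : StandardSurface g} (hx : x = edgePoint g θ)
    (hx' : x' = edgePoint g θ') (h : θ = η) (h' : θ' = η') :
    arc g θ θ' hx hx' = arc g η η' (h ▸ hx) (h' ▸ hx') := by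
  subst h h'; rfl

theorem arc_trans (g : ℕ) {θ θ' θ'' : ℝ} {x x' x'' : StandardSurface g} (hx : x = edgePoint g θ)
    (hx' : x' = edgePoint g θ') (hx'' : x'' = edgePoint g θ'') :
    (arc g θ θ' hx hx').trans (arc g θ' θ'' hx' hx'') = arc g θ θ'' hx hx'' :=
  through_trans _ _ _ _ _ _ _

/-- The class of an arc of the boundary between two vertices, in the fundamental group. -/
noncomputable def arcLoop (g : ℕ) (θ θ' : ℝ) (h : base g = edgePoint g θ)
    (h' : base g = edgePoint g θ') : FundamentalGroup (StandardSurface g) (base g) :=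
  FundamentalGroup.fromPath (arc g θ θ' h h')

theorem arcLoop_congr (g : ℕ) {θ θ' η η' : ℝ} (h : base g = edgePoint g θ)
    (h' : base g = edgePoint g θ') (e : θ = η) (e' : θ' = η') :
    arcLoop g θ θ' h h' = arcLoop g η η' (e ▸ h) (e' ▸ h') := by
  subst e e'; rfl

/-- Multiplication in `FundamentalGroup` runs the right factor first, so consecutive arcs multiply
from right to left. All later orders of factors, and the passage to inverse generators, come from
this convention. -/
theorem arcLoop_mul (g : ℕ) {θ θ' θ'' : ℝ} (h : base g = edgePoint g θ)
    (h' : base g = edgePoint g θ') (h'' : base g = edgePoint g θ'') :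
    arcLoop g θ' θ'' h' h'' * arcLoop g θ θ' h h' = arcLoop g θ θ'' h h'' :=
  arc_trans g h h' h''

theorem arcLoop_self (g : ℕ) {θ : ℝ} (h h' : base g = edgePoint g θ) :
    arcLoop g θ θ h h' = 1 :=
  through_refl _ _ _

theorem arcLoop_inv (g : ℕ) {θ θ' : ℝ} (h : base g = edgePoint g θ)
    (h' : base g = edgePoint g θ') : (arcLoop g θ θ' h h')⁻¹ = arcLoop g θ' θ h' h :=
  through_symm _ _ _ _ _

theorem arcLoop_one (g : ℕ) (i : Fin g) :
    arcLoop g (4 * (i : ℕ)) (4 * (i : ℕ) + 1) (base_eq_zero g i) (base_eq_one g i) =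
      genA g i := by
  rw [arcLoop_congr g (η := 4 * (i : ℕ) + 0) (η' := 4 * (i : ℕ) + 1) _ _ (by ring) rfl]
  exact through_eq_mk _ _ _ ((linePath 0 1).map (f := fun r => 4 * (i : ℕ) + r) (by fun_prop))
    (loopA g i) fun t => congrArg (edgePoint g) (by simp [linePath])

theorem arcLoop_two (g : ℕ) (i : Fin g) :
    arcLoop g (4 * (i : ℕ) + 1) (4 * (i : ℕ) + 2) (base_eq_one g i) (base_eq_two g i) =
      genB g i := by
  rw [arcLoop_congr g (η := 4 * (i : ℕ) + 1 + 0) (η' := 4 * (i : ℕ) + 1 + 1) _ _ (by ring)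
    (by ring)]
  exact through_eq_mk _ _ _ ((linePath 0 1).map (f := fun r => 4 * (i : ℕ) + 1 + r) (by fun_prop))
    (loopB g i) fun t => congrArg (edgePoint g) (by simp [linePath])

theorem arcLoop_three (g : ℕ) (i : Fin g) :
    arcLoop g (4 * (i : ℕ) + 2) (4 * (i : ℕ) + 3) (base_eq_two g i) (base_eq_three g i) =
      (genA g i)⁻¹ := by
  rw [← arcLoop_one, arcLoop_inv,
    arcLoop_congr g (θ := 4 * (i : ℕ) + 1) (η := 4 * (i : ℕ) + 1) (η' := 4 * (i : ℕ) + 0) _ _ rfl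
      (by ring)]
  refine Eq.trans ?_ (arc_a g i (s := 1) (t := 0) (by simp) (by simp) _ _).symm
  exact arc_congr _ _ _ (by ring) (by ring)

theorem arcLoop_four (g : ℕ) (i : Fin g) :
    arcLoop g (4 * (i : ℕ) + 3) (4 * (i : ℕ) + 4) (base_eq_three g i) (base_eq_four g i) =
      (genB g i)⁻¹ := by
  rw [← arcLoop_two, arcLoop_inv,
    arcLoop_congr g (θ := 4 * (i : ℕ) + 2) (η := 4 * (i : ℕ) + 1 + 1)
      (η' := 4 * (i : ℕ) + 1 + 0) _ _ (by ring) (by ring)]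
  refine Eq.trans ?_ (arc_b g i (s := 1) (t := 0) (by simp) (by simp) _ _).symm
  exact arc_congr _ _ _ (by ring) (by ring)

theorem base_eq (g : ℕ) : base g = edgePoint g 0 := rfl

theorem base_eq_proj (g : ℕ) : base g = proj g (boundaryPoint g 0) := rfl

/-- The loop along the boundary from the vertex `0` to the vertex `4k`. -/
noncomputable def vertexLoop (g : ℕ) [NeZero g] (k : ℕ) (hk : k ≤ g) :
    FundamentalGroup (StandardSurface g) (base g) :=
  arcLoop g 0 (4 * k) (base_eq g) (base_eq_mul g k hk)

end StandardSurface

/-! ### Partial products of commutators -/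

section PrefixProduct

variable {G : Type*} [Group G] {g : ℕ}

/-- The product of the first `k` commutators. -/
def commutatorPrefix (x y : Fin g → G) (k : ℕ) : G :=
  ((List.ofFn fun i => ⁅x i, y i⁆).take k).prod

@[simp] theorem commutatorPrefix_zero (x y : Fin g → G) : commutatorPrefix x y 0 = 1 := by
  simp [commutatorPrefix]

theorem commutatorPrefix_succ (x y : Fin g → G) (i : Fin g) :
    commutatorPrefix x y (i + 1) = commutatorPrefix x y i * ⁅x i, y i⁆ := by
  rw [commutatorPrefix, List.prod_take_succ _ _ (by simp)]
  simp [commutatorPrefix]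

theorem commutatorPrefix_last {G : Type u} [Group G] (x y : Fin g → G) :
    commutatorPrefix x y g = commutatorProduct x y := by
  rw [commutatorPrefix, commutatorProduct, List.take_of_length_le (by simp)]

end PrefixProduct

/-! ### The boundary word and the surface relation. -/

namespace StandardSurface

variable (g : ℕ) [NeZero g]

theorem vertexLoop_zero : vertexLoop g 0 (Nat.zero_le g) = 1 := by
  rw [vertexLoop, arcLoop_congr g (η := 0) (η' := 0) _ _ rfl (by simp), arcLoop_self]

/-- The full boundary circle begins and ends at the same point of the disk, hence is null-homotopic
there. -/
theorem vertexLoop_last : vertexLoop g g le_rfl = 1 := by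
  have h : boundaryPoint g (4 * g) = boundaryPoint g 0 := by
    simpa using boundaryPoint_add_period g 0
  have : ∀ z (hz : z = boundaryPoint g 0) (hx : base g = proj g z),
      diskClass g (boundaryPoint g 0) z (base_eq g) hx = Path.Homotopic.Quotient.refl _ := by
    rintro _ rfl hx
    exact through_refl _ _ _
  exact (diskClass_boundary g _ _ _ _).symm.trans (this _ h (base_eq_mul g g le_rfl))

theorem arcLoop_zero_one (i : Fin g) :
    arcLoop g 0 (4 * (i : ℕ) + 1) (base_eq g) (base_eq_one g i) =
      genA g i * vertexLoop g i i.2.le := by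
  rw [← arcLoop_one, vertexLoop, arcLoop_mul]

theorem arcLoop_zero_two (i : Fin g) :
    arcLoop g 0 (4 * (i : ℕ) + 2) (base_eq g) (base_eq_two g i) =
      genB g i * genA g i * vertexLoop g i i.2.le := by
  rw [mul_assoc, ← arcLoop_zero_one, ← arcLoop_two, arcLoop_mul]

theorem arcLoop_zero_three (i : Fin g) :
    arcLoop g 0 (4 * (i : ℕ) + 3) (base_eq g) (base_eq_three g i) =
      (genA g i)⁻¹ * genB g i * genA g i * vertexLoop g i i.2.le := by
  rw [mul_assoc, mul_assoc, ← mul_assoc (genB g i), ← arcLoop_zero_two, ← arcLoop_three,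
    arcLoop_mul]

theorem vertexLoop_succ (i : Fin g) :
    vertexLoop g (i + 1) i.2 =
      (genB g i)⁻¹ * ((genA g i)⁻¹ * genB g i * genA g i * vertexLoop g i i.2.le) := by
  rw [← arcLoop_zero_three, ← arcLoop_four, arcLoop_mul, vertexLoop]
  exact arcLoop_congr _ _ _ rfl (by push_cast; ring)

/-- The boundary path multiplies from right to left; inversion restores the left-to-right order and
turns the four sides of a handle into the commutator of the inverse sides. -/
theorem vertexLoop_inv (k : ℕ) (hk : k ≤ g) : (vertexLoop g k hk)⁻¹ =
    commutatorPrefix (fun i => (genA g i)⁻¹) (fun i => (genB g i)⁻¹) k := by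
  induction k with
  | zero => rw [vertexLoop_zero, commutatorPrefix_zero, inv_one]
  | succ k ih =>
    have := commutatorPrefix_succ (fun i => (genA g i)⁻¹) (fun i => (genB g i)⁻¹) ⟨k, hk⟩
    rw [this, ← ih (by omega), vertexLoop_succ g ⟨k, hk⟩, commutatorElement_def]
    group

theorem commutatorProduct_gen :
    commutatorProduct (fun i => (genA g i)⁻¹) (fun i => (genB g i)⁻¹) = 1 := by
  rw [← commutatorPrefix_last, ← vertexLoop_inv g g le_rfl, vertexLoop_last, inv_one]

end StandardSurface

/-! ### Polar coordinates on the polygon -/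

namespace StandardSurface

open ComplexConjugate

/-- The point of the polygon with radius `r` (truncated to `[0, 1]`) and angular parameter `θ`. -/
noncomputable def polar (g : ℕ) (r θ : ℝ) : PolygonDisk :=
  ⟨((Set.projIcc (0 : ℝ) 1 zero_le_one r : ℝ) : ℂ) * (boundaryPoint g θ : ℂ), by
    have h := (Set.projIcc (0 : ℝ) 1 zero_le_one r).2
    have h' : ‖(boundaryPoint g θ : ℂ)‖ = 1 := Complex.norm_exp_ofReal_mul_I _
    rw [mem_closedBall_zero_iff, norm_mul, h', mul_one, Complex.norm_real, Real.norm_eq_abs,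
      abs_of_nonneg h.1]
    exact h.2⟩

theorem norm_boundaryPoint (g : ℕ) (θ : ℝ) : ‖(boundaryPoint g θ : ℂ)‖ = 1 :=
  Complex.norm_exp_ofReal_mul_I _

theorem polar_coe (g : ℕ) {r : ℝ} (θ : ℝ) (hr : r ∈ Set.Icc (0 : ℝ) 1) :
    (polar g r θ : ℂ) = r * (boundaryPoint g θ : ℂ) := by
  simp only [polar, Set.projIcc_of_mem zero_le_one hr]

theorem continuous_polar (g : ℕ) : Continuous fun p : ℝ × ℝ => polar g p.1 p.2 := by
  refine Continuous.subtype_mk (Continuous.mul ?_ ?_) _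
  · exact Complex.continuous_ofReal.comp
      (continuous_subtype_val.comp (continuous_projIcc.comp continuous_fst))
  · exact continuous_subtype_val.comp ((continuous_boundaryPoint g).comp continuous_snd)

theorem polar_one (g : ℕ) (θ : ℝ) : polar g 1 θ = boundaryPoint g θ :=
  Subtype.ext (by rw [polar_coe g θ (by simp)]; simp)

theorem norm_polar (g : ℕ) {r : ℝ} (θ : ℝ) (hr : r ∈ Set.Icc (0 : ℝ) 1) :
    ‖(polar g r θ : ℂ)‖ = r := by
  rw [polar_coe g θ hr, norm_mul, norm_boundaryPoint, mul_one, Complex.norm_real,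
    Real.norm_eq_abs, abs_of_nonneg hr.1]

theorem norm_mem (z : PolygonDisk) : ‖(z : ℂ)‖ ∈ Set.Icc (0 : ℝ) 1 :=
  ⟨norm_nonneg _, mem_closedBall_zero_iff.1 z.2⟩

variable (g : ℕ) [NeZero g]

theorem four_mul_pos : (0 : ℝ) < 4 * g :=
  mul_pos four_pos (Nat.cast_pos.2 (NeZero.pos g))

theorem four_le_four_mul : (4 : ℝ) ≤ 4 * g := by
  have : (1 : ℝ) ≤ g := by exact_mod_cast NeZero.one_le
  linarith

omit [NeZero g] in
theorem boundaryPoint_mul_conj (θ κ : ℝ) : (boundaryPoint g θ : ℂ) * conj (boundaryPoint g κ : ℂ) =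
    Complex.exp ((2 * Real.pi * (θ - κ) / (4 * g) : ℝ) * Complex.I) := by
  simp only [boundaryPoint]
  rw [← Complex.exp_conj, ← Complex.exp_add, map_mul, Complex.conj_ofReal, Complex.conj_I]
  congr 1
  push_cast
  ring

omit [NeZero g] in
theorem boundaryPoint_mul_conj_self (κ : ℝ) :
    (boundaryPoint g κ : ℂ) * conj (boundaryPoint g κ : ℂ) = 1 := by
  rw [boundaryPoint_mul_conj]; simp

theorem boundaryPoint_add_int (θ : ℝ) (m : ℤ) :
    boundaryPoint g (θ + 4 * g * m) = boundaryPoint g θ := by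
  apply Subtype.ext
  simp only [boundaryPoint]
  rw [Complex.exp_eq_exp_iff_exists_int]
  refine ⟨m, ?_⟩
  push_cast
  have : (g : ℂ) ≠ 0 := Nat.cast_ne_zero.2 (NeZero.ne g)
  field_simp

theorem boundaryPoint_eq_iff (θ θ' : ℝ) :
    boundaryPoint g θ = boundaryPoint g θ' ↔ ∃ m : ℤ, θ = θ' + 4 * g * m := by
  refine ⟨fun h => ?_, ?_⟩
  · have h' := congrArg Subtype.val h
    simp only [boundaryPoint] at h'
    rw [Complex.exp_eq_exp_iff_exists_int] at h'
    obtain ⟨m, hm⟩ := h'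
    refine ⟨m, ?_⟩
    have hg := (four_mul_pos g).ne'
    have h2 : ((2 * Real.pi * θ / (4 * g) : ℝ) : ℂ) =
        ((2 * Real.pi * θ' / (4 * g) + m * (2 * Real.pi) : ℝ) : ℂ) := by
      apply mul_right_cancel₀ Complex.I_ne_zero
      rw [hm]; push_cast; ring
    have h3 := Complex.ofReal_injective h2
    have hpi := Real.pi_pos.ne'
    field_simp at h3
    have hg' : (g : ℝ) ≠ 0 := Nat.cast_ne_zero.2 (NeZero.ne g)
    field_simp at h3
    linarith
  · rintro ⟨m, rfl⟩
    exact boundaryPoint_add_int g _ m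

/-- The angular coordinate relative to the ray with parameter `κ`. -/
noncomputable def relAngle (κ : ℝ) (z : PolygonDisk) : ℝ :=
  Complex.arg ((z : ℂ) * conj (boundaryPoint g κ : ℂ)) * (4 * g) / (2 * Real.pi)

/-- The open sector of half width `1 / 2` around the ray with parameter `κ`. -/
def sector (κ : ℝ) : Set PolygonDisk :=
  {z | (z : ℂ) * conj (boundaryPoint g κ : ℂ) ∈ Complex.slitPlane ∧ |relAngle g κ z| < 1 / 2}

omit [NeZero g] in
theorem continuousOn_relAngle (κ : ℝ) : ContinuousOn (relAngle g κ)
    {z | (z : ℂ) * conj (boundaryPoint g κ : ℂ) ∈ Complex.slitPlane} := by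
  intro z hz
  refine ContinuousAt.continuousWithinAt ?_
  have h : ContinuousAt (fun z : PolygonDisk => (z : ℂ) * conj (boundaryPoint g κ : ℂ)) z := by
    fun_prop
  exact ((ContinuousAt.comp (f := fun z : PolygonDisk => (z : ℂ) * conj (boundaryPoint g κ : ℂ))
    (Complex.continuousAt_arg hz) h).mul_const _).div_const _

omit [NeZero g] in
theorem isOpen_sector (κ : ℝ) : IsOpen (sector g κ) := by
  have ho : IsOpen {z : PolygonDisk | (z : ℂ) * conj (boundaryPoint g κ : ℂ) ∈
      Complex.slitPlane} :=
    Complex.isOpen_slitPlane.preimage (by fun_prop)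
  exact ((continuousOn_relAngle g κ).abs).isOpen_inter_preimage ho isOpen_Iio

theorem relAngle_polar {r θ κ : ℝ} (hr : 0 < r) (hr' : r ≤ 1) (h : |θ - κ| < 1 / 2) :
    polar g r θ ∈ sector g κ ∧ relAngle g κ (polar g r θ) = θ - κ := by
  have hg := four_le_four_mul g
  have hpi := Real.pi_pos
  have h1 := abs_lt.1 h
  set φ := 2 * Real.pi * (θ - κ) / (4 * g) with hφ
  -- Since 4g ≥ 4, half a side subtends an angle of at most π/4, safely inside the range where `arg`
  -- recovers the angle.
  have hφ2 : |φ| < Real.pi / 2 := by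
    rw [hφ, abs_div, abs_mul, abs_of_pos (by positivity : 0 < 2 * Real.pi),
      abs_of_pos (by linarith : (0 : ℝ) < 4 * g), div_lt_iff₀ (by linarith)]
    nlinarith [mul_lt_mul_of_pos_left h hpi, mul_le_mul_of_nonneg_left hg hpi.le]
  have hw : (polar g r θ : ℂ) * conj (boundaryPoint g κ : ℂ) =
      r * (Complex.cos φ + Complex.sin φ * Complex.I) := by
    rw [polar_coe g θ ⟨hr.le, hr'⟩, mul_assoc, boundaryPoint_mul_conj, Complex.exp_mul_I]
  have hmem : φ ∈ Set.Ioc (-Real.pi) Real.pi := by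
    have := abs_lt.1 hφ2
    constructor <;> linarith
  have harg : Complex.arg ((polar g r θ : ℂ) * conj (boundaryPoint g κ : ℂ)) = φ := by
    rw [hw, Complex.arg_mul_cos_add_sin_mul_I hr hmem]
  have hrel : relAngle g κ (polar g r θ) = θ - κ := by
    rw [relAngle, harg, hφ]
    have : (g : ℝ) ≠ 0 := Nat.cast_ne_zero.2 (NeZero.ne g)
    field_simp
  refine ⟨⟨?_, by rw [hrel]; exact h⟩, hrel⟩
  rw [Complex.mem_slitPlane_iff_arg, harg]
  refine ⟨by have := abs_lt.1 hφ2; linarith, ?_⟩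
  intro h0
  have h1 := norm_polar g θ ⟨hr.le, hr'⟩
  have h2 := norm_boundaryPoint g κ
  have h3 := congrArg norm h0
  rw [norm_mul, RCLike.norm_conj, h1, h2, norm_zero] at h3
  linarith

theorem boundaryPoint_mem_sector {θ κ : ℝ} (h : |θ - κ| < 1 / 2) :
    boundaryPoint g θ ∈ sector g κ := by
  rw [← polar_one]; exact (relAngle_polar g one_pos le_rfl h).1

theorem relAngle_boundaryPoint {θ κ : ℝ} (h : |θ - κ| < 1 / 2) :
    relAngle g κ (boundaryPoint g θ) = θ - κ := by
  rw [← polar_one]; exact (relAngle_polar g one_pos le_rfl h).2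

theorem polar_relAngle (κ : ℝ) (z : PolygonDisk) :
    polar g ‖(z : ℂ)‖ (κ + relAngle g κ z) = z := by
  apply Subtype.ext
  rw [polar_coe g _ (norm_mem z)]
  set w := (z : ℂ) * conj (boundaryPoint g κ : ℂ) with hw
  have h1 : (boundaryPoint g (κ + relAngle g κ z) : ℂ) * conj (boundaryPoint g κ : ℂ) =
      Complex.exp (Complex.arg w * Complex.I) := by
    rw [boundaryPoint_mul_conj]
    congr 3
    have hpi := Real.pi_pos.ne'
    have : (g : ℝ) ≠ 0 := Nat.cast_ne_zero.2 (NeZero.ne g)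
    simp only [relAngle, ← hw]
    field_simp
    ring
  have h2 : ‖w‖ = ‖(z : ℂ)‖ := by
    rw [hw, norm_mul, RCLike.norm_conj, norm_boundaryPoint, mul_one]
  have h3 : conj (boundaryPoint g κ : ℂ) ≠ 0 := by
    intro h
    have := boundaryPoint_mul_conj_self g κ
    rw [h, mul_zero] at this
    exact zero_ne_one this
  apply mul_right_cancel₀ h3
  rw [mul_assoc, h1, ← h2, Complex.norm_mul_exp_arg_mul_I]

omit [NeZero g] in
theorem norm_pos_of_mem_sector {κ : ℝ} {z : PolygonDisk} (h : z ∈ sector g κ) :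
    0 < ‖(z : ℂ)‖ := by
  rw [norm_pos_iff]
  intro h0
  have := h.1
  rw [h0, zero_mul] at this
  exact Complex.zero_notMem_slitPlane this

theorem polar_eq {r θ θ' : ℝ} (hr : 0 < r) (hr' : r ≤ 1) (h : polar g r θ = polar g r θ') :
    ∃ m : ℤ, θ = θ' + 4 * g * m := by
  rw [← boundaryPoint_eq_iff]
  apply Subtype.ext
  have h1 := congrArg Subtype.val h
  change (polar g r θ : ℂ) = (polar g r θ' : ℂ) at h1
  rw [polar_coe g _ ⟨hr.le, hr'⟩, polar_coe g _ ⟨hr.le, hr'⟩] at h1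
  exact mul_left_cancel₀ (by exact_mod_cast hr.ne') h1

/-- Away from the center of the disk the angular parameter is unique modulo 4g, and each center is
within 1/2 of it. -/
theorem dist_of_mem_sector {κ κ' : ℝ} {z : PolygonDisk} (h : z ∈ sector g κ)
    (h' : z ∈ sector g κ') : ∃ m : ℤ, |κ - (κ' + 4 * g * m)| < 1 := by
  obtain ⟨m, hm⟩ := polar_eq g (norm_pos_of_mem_sector g h) (norm_mem z).2
    ((polar_relAngle g κ z).trans (polar_relAngle g κ' z).symm)
  refine ⟨m, ?_⟩
  have h1 := abs_lt.1 h.2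
  have h2 := abs_lt.1 h'.2
  rw [abs_lt]
  constructor <;> linarith

theorem dist_of_boundaryPoint_mem_sector {κ θ : ℝ} (h : boundaryPoint g θ ∈ sector g κ) :
    ∃ m : ℤ, |θ - (κ + 4 * g * m)| < 1 / 2 := by
  have e := polar_relAngle g κ (boundaryPoint g θ)
  rw [norm_boundaryPoint, polar_one, boundaryPoint_eq_iff] at e
  obtain ⟨m, hm⟩ := e
  have h1 := abs_lt.1 h.2
  refine ⟨-m, ?_⟩
  rw [abs_lt]
  push_cast
  constructor <;> linarith

theorem relAngle_add_int (κ : ℝ) (m : ℤ) (z : PolygonDisk) :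
    relAngle g (κ + 4 * g * m) z = relAngle g κ z := by
  simp only [relAngle, boundaryPoint_add_int]

/-! ### Sets of centers of sectors that are compatible with the side identifications -/

/-- A set of centers of disjoint sectors whose union is compatible with the side
identifications. -/
structure IsCenterSet (K : Set ℝ) : Prop where
  period : ∀ κ ∈ K, ∀ m : ℤ, κ + 4 * g * m ∈ K
  sep : ∀ κ ∈ K, ∀ κ' ∈ K, |κ - κ'| < 1 → κ = κ'
  -- The open interval holds the centers within 1/2 of side 4i, and θ ↦ 8i + 3 - θ is the gluing of
  -- the sides 4i and 4i + 2. The center must lie on the closed side itself, so that pushing towards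
  -- it never leaves the side.
  side_a : ∀ i : Fin g, ∀ κ ∈ K, κ ∈ Set.Ioo (4 * (i : ℕ) - 1 / 2 : ℝ) (4 * (i : ℕ) + 3 / 2) →
    κ ∈ Set.Icc (4 * (i : ℕ) : ℝ) (4 * (i : ℕ) + 1) ∧ 8 * (i : ℕ) + 3 - κ ∈ K
  side_a' : ∀ i : Fin g, ∀ κ ∈ K,
    κ ∈ Set.Ioo (4 * (i : ℕ) + 3 / 2 : ℝ) (4 * (i : ℕ) + 7 / 2) → 8 * (i : ℕ) + 3 - κ ∈ K
  -- The same condition for the sides 4i + 1 and 4i + 3, glued by θ ↦ 8i + 5 - θ.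
  side_b : ∀ i : Fin g, ∀ κ ∈ K,
    κ ∈ Set.Ioo (4 * (i : ℕ) + 1 / 2 : ℝ) (4 * (i : ℕ) + 5 / 2) →
    κ ∈ Set.Icc (4 * (i : ℕ) + 1 : ℝ) (4 * (i : ℕ) + 2) ∧ 8 * (i : ℕ) + 5 - κ ∈ K
  side_b' : ∀ i : Fin g, ∀ κ ∈ K,
    κ ∈ Set.Ioo (4 * (i : ℕ) + 5 / 2 : ℝ) (4 * (i : ℕ) + 9 / 2) → 8 * (i : ℕ) + 5 - κ ∈ K

/-- The union of the sectors with centers in `K`. -/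
def sectors (K : Set ℝ) : Set PolygonDisk := {z | ∃ κ ∈ K, z ∈ sector g κ}

omit [NeZero g] in
theorem isOpen_sectors (K : Set ℝ) : IsOpen (sectors g K) := by
  have : sectors g K = ⋃ κ ∈ K, sector g κ := by ext; simp [sectors]
  rw [this]
  exact isOpen_biUnion fun κ _ => isOpen_sector g κ

variable {g} {K : Set ℝ}

namespace IsCenterSet

theorem boundaryPoint_mem_iff (hK : IsCenterSet g K) {θ : ℝ} :
    boundaryPoint g θ ∈ sectors g K ↔ ∃ κ ∈ K, |θ - κ| < 1 / 2 := by
  constructor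
  · rintro ⟨κ, hκ, h⟩
    obtain ⟨m, hm⟩ := dist_of_boundaryPoint_mem_sector g h
    exact ⟨_, hK.period κ hκ m, hm⟩
  · rintro ⟨κ, hκ, h⟩
    exact ⟨κ, hκ, boundaryPoint_mem_sector g h⟩

/-- Sectors around distinct centers are disjoint up to the period 4g, so constructions that choose a
center do not depend on the choice once they are periodic. -/
theorem eq_add_of_mem (hK : IsCenterSet g K) {κ κ' : ℝ} (hκ : κ ∈ K) (hκ' : κ' ∈ K)
    {z : PolygonDisk} (h : z ∈ sector g κ) (h' : z ∈ sector g κ') :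
    ∃ m : ℤ, κ = κ' + 4 * g * m := by
  obtain ⟨m, hm⟩ := dist_of_mem_sector g h h'
  exact ⟨m, hK.sep _ hκ _ (hK.period _ hκ' m) hm⟩

theorem gluing_a (hK : IsCenterSet g K) (i : Fin g) {t : ℝ} (ht : t ∈ Set.Icc (0 : ℝ) 1)
    (hz : boundaryPoint g (4 * (i : ℕ) + t) ∈ sectors g K ∨
      boundaryPoint g (4 * (i : ℕ) + 3 - t) ∈ sectors g K) :
    ∃ κ ∈ K, |4 * (i : ℕ) + t - κ| < 1 / 2 ∧ κ ∈ Set.Icc (4 * (i : ℕ) : ℝ) (4 * (i : ℕ) + 1) ∧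
      8 * (i : ℕ) + 3 - κ ∈ K := by
  have key : ∃ κ ∈ K, |4 * (i : ℕ) + t - κ| < 1 / 2 := by
    rcases hz with hz | hz
    · exact hK.boundaryPoint_mem_iff.1 hz
    · obtain ⟨κ, hκ, h⟩ := hK.boundaryPoint_mem_iff.1 hz
      refine ⟨8 * (i : ℕ) + 3 - κ, hK.side_a' i κ hκ ?_, ?_⟩
      · have := abs_lt.1 h
        constructor <;> linarith [ht.1, ht.2]
      · rw [abs_lt] at h ⊢
        constructor <;> linarith
  obtain ⟨κ, hκ, h⟩ := key
  have h' := abs_lt.1 h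
  exact ⟨κ, hκ, h, hK.side_a i κ hκ ⟨by linarith [ht.1], by linarith [ht.2]⟩⟩

theorem gluing_b (hK : IsCenterSet g K) (i : Fin g) {t : ℝ} (ht : t ∈ Set.Icc (0 : ℝ) 1)
    (hz : boundaryPoint g (4 * (i : ℕ) + 1 + t) ∈ sectors g K ∨
      boundaryPoint g (4 * (i : ℕ) + 4 - t) ∈ sectors g K) :
    ∃ κ ∈ K, |4 * (i : ℕ) + 1 + t - κ| < 1 / 2 ∧
      κ ∈ Set.Icc (4 * (i : ℕ) + 1 : ℝ) (4 * (i : ℕ) + 2) ∧ 8 * (i : ℕ) + 5 - κ ∈ K := by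
  have key : ∃ κ ∈ K, |4 * (i : ℕ) + 1 + t - κ| < 1 / 2 := by
    rcases hz with hz | hz
    · exact hK.boundaryPoint_mem_iff.1 hz
    · obtain ⟨κ, hκ, h⟩ := hK.boundaryPoint_mem_iff.1 hz
      refine ⟨8 * (i : ℕ) + 5 - κ, hK.side_b' i κ hκ ?_, ?_⟩
      · have := abs_lt.1 h
        constructor <;> linarith [ht.1, ht.2]
      · rw [abs_lt] at h ⊢
        constructor <;> linarith
  obtain ⟨κ, hκ, h⟩ := key
  have h' := abs_lt.1 h
  exact ⟨κ, hκ, h, hK.side_b i κ hκ ⟨by linarith [ht.1], by linarith [ht.2]⟩⟩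

/-- A pair of glued points of `sectors g K` is glued inside two corresponding sectors. -/
theorem gluing (hK : IsCenterSet g K) {z z' : PolygonDisk} (h : SideGluing g z z')
    (hz : z ∈ sectors g K ∨ z' ∈ sectors g K) :
    ∃ θ κ σ : ℝ, z = boundaryPoint g θ ∧ z' = boundaryPoint g (σ - θ) ∧ |θ - κ| < 1 / 2 ∧ κ ∈ K ∧
      σ - κ ∈ K ∧
      ((∃ i : Fin g, σ = 8 * (i : ℕ) + 3 ∧ θ ∈ Set.Icc (4 * (i : ℕ) : ℝ) (4 * (i : ℕ) + 1) ∧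
        κ ∈ Set.Icc (4 * (i : ℕ) : ℝ) (4 * (i : ℕ) + 1)) ∨
      ∃ i : Fin g, σ = 8 * (i : ℕ) + 5 ∧ θ ∈ Set.Icc (4 * (i : ℕ) + 1 : ℝ) (4 * (i : ℕ) + 2) ∧
        κ ∈ Set.Icc (4 * (i : ℕ) + 1 : ℝ) (4 * (i : ℕ) + 2)) := by
  cases h with
  | a i t ht =>
    obtain ⟨κ, hκ, h, h1, h2⟩ := hK.gluing_a i ht hz
    refine ⟨4 * (i : ℕ) + t, κ, 8 * (i : ℕ) + 3, rfl, ?_, h, hκ, h2, .inl ⟨i, rfl, ?_, h1⟩⟩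
    · congr 1; ring
    · constructor <;> linarith [ht.1, ht.2]
  | b i t ht =>
    obtain ⟨κ, hκ, h, h1, h2⟩ := hK.gluing_b i ht hz
    refine ⟨4 * (i : ℕ) + 1 + t, κ, 8 * (i : ℕ) + 5, rfl, ?_, h, hκ, h2, .inr ⟨i, rfl, ?_, h1⟩⟩
    · congr 1; ring
    · constructor <;> linarith [ht.1, ht.2]

theorem saturated (hK : IsCenterSet g K) {z z' : PolygonDisk} (h : SideGluing g z z') :
    z ∈ sectors g K ↔ z' ∈ sectors g K := by
  constructor
  · intro hz
    obtain ⟨θ, κ, σ, rfl, rfl, h1, -, h2, -⟩ := hK.gluing h (.inl hz)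
    refine hK.boundaryPoint_mem_iff.2 ⟨_, h2, ?_⟩
    rw [abs_lt] at h1 ⊢; constructor <;> linarith
  · intro hz
    obtain ⟨θ, κ, σ, rfl, rfl, h1, h2, -⟩ := hK.gluing h (.inr hz)
    exact hK.boundaryPoint_mem_iff.2 ⟨_, h2, h1⟩

end IsCenterSet

variable (g)

omit [NeZero g] in
/-- The centers at the vertices. -/
theorem isCenterSet_vertices : IsCenterSet g (Set.range ((↑) : ℤ → ℝ)) where
  period := by
    rintro _ ⟨k, rfl⟩ m
    exact ⟨k + 4 * g * m, by push_cast; ring⟩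
  sep := by
    rintro _ ⟨k, rfl⟩ _ ⟨l, rfl⟩ h
    have : |k - l| < 1 := by exact_mod_cast h
    rw [Int.abs_lt_one_iff] at this
    rw [sub_eq_zero.1 this]
  side_a := by
    rintro i _ ⟨k, rfl⟩ ⟨h1, h2⟩
    have h1' : (4 * (i : ℕ) - 1 : ℤ) < k := by
      have : ((4 * (i : ℕ) - 1 : ℤ) : ℝ) < k := by push_cast; linarith
      exact_mod_cast this
    have h2' : k < (4 * (i : ℕ) + 2 : ℤ) := by
      have : (k : ℝ) < ((4 * (i : ℕ) + 2 : ℤ) : ℝ) := by push_cast; linarith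
      exact_mod_cast this
    refine ⟨⟨?_, ?_⟩, ⟨8 * (i : ℕ) + 3 - k, by push_cast; ring⟩⟩
    · exact_mod_cast (by omega : (4 * (i : ℕ) : ℤ) ≤ k)
    · exact_mod_cast (by omega : k ≤ (4 * (i : ℕ) + 1 : ℤ))
  side_a' := by
    rintro i _ ⟨k, rfl⟩ -
    exact ⟨8 * (i : ℕ) + 3 - k, by push_cast; ring⟩
  side_b := by
    rintro i _ ⟨k, rfl⟩ ⟨h1, h2⟩
    have h1' : (4 * (i : ℕ) : ℤ) < k := by
      have : ((4 * (i : ℕ) : ℤ) : ℝ) < k := by push_cast; linarith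
      exact_mod_cast this
    have h2' : k < (4 * (i : ℕ) + 3 : ℤ) := by
      have : (k : ℝ) < ((4 * (i : ℕ) + 3 : ℤ) : ℝ) := by push_cast; linarith
      exact_mod_cast this
    refine ⟨⟨?_, ?_⟩, ⟨8 * (i : ℕ) + 5 - k, by push_cast; ring⟩⟩
    · exact_mod_cast (by omega : (4 * (i : ℕ) + 1 : ℤ) ≤ k)
    · exact_mod_cast (by omega : k ≤ (4 * (i : ℕ) + 2 : ℤ))
  side_b' := by
    rintro i _ ⟨k, rfl⟩ -
    exact ⟨8 * (i : ℕ) + 5 - k, by push_cast; ring⟩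

/-- The centers at the mid points of the sides `4i` and `4i + 2` (for `e = 0`) or `4i + 1` and
`4i + 3` (for `e = 1`). -/
def sideCenters (i : Fin g) (e : Fin 2) : Set ℝ :=
  {κ | ∃ m : ℤ, κ = 4 * (i : ℕ) + (e : ℕ) + 1 / 2 + 4 * g * m ∨
    κ = 4 * (i : ℕ) + (e : ℕ) + 5 / 2 + 4 * g * m}

theorem int_eq_zero_of_abs_lt {q : ℤ} {x : ℝ} (h : x = 4 * (q : ℝ)) (h1 : -4 < x) (h2 : x < 4) :
    q = 0 := by
  have h3 : (-1 : ℝ) < q := by linarith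
  have h4 : (q : ℝ) < 1 := by linarith
  have h3' : -1 < q := by exact_mod_cast h3
  have h4' : q < 1 := by exact_mod_cast h4
  omega

omit [NeZero g] in
theorem sideCenters_local {i : Fin g} {e : Fin 2} {κ : ℝ} (h : κ ∈ sideCenters g i e) (j : ℕ)
    (h1 : 4 * (j : ℝ) - 1 / 2 < κ) (h2 : κ < 4 * (j : ℝ) + 9 / 2) :
    ∃ m : ℤ, (4 * (i : ℕ) + 4 * g * m : ℝ) = 4 * j ∧
      (κ = 4 * j + (e : ℕ) + 1 / 2 ∨ κ = 4 * j + (e : ℕ) + 5 / 2) := by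
  obtain ⟨m, hm⟩ := h
  -- The integer q counts the handles between the center and handle j. The window around handle j is
  -- short enough to force |4q| < 4.
  obtain ⟨q, hq⟩ : ∃ q : ℤ, (q : ℝ) = (i : ℕ) - j + g * m :=
    ⟨(i : ℕ) - j + g * m, by push_cast; ring⟩
  have hm2 : κ = 4 * q + 4 * j + (e : ℕ) + 1 / 2 ∨ κ = 4 * q + 4 * j + (e : ℕ) + 5 / 2 := by
    rw [hq]
    rcases hm with rfl | rfl
    · left; ring
    · right; ring
  have he : ((e : ℕ) : ℝ) = 0 ∨ ((e : ℕ) : ℝ) = 1 := by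
    have : (e : ℕ) = 0 ∨ (e : ℕ) = 1 := by omega
    exact_mod_cast this
  have hq0 : q = 0 := by
    refine int_eq_zero_of_abs_lt (x := 4 * q) rfl ?_ ?_ <;>
      rcases he with he | he <;> rw [he] at hm2 <;> rcases hm2 with h | h <;> linarith
  rw [hq0] at hm2 hq
  push_cast at hm2 hq
  refine ⟨m, by linarith, ?_⟩
  rcases hm2 with h | h
  · left; linarith
  · right; linarith

omit [NeZero g] in
theorem isCenterSet_sides (i : Fin g) (e : Fin 2) : IsCenterSet g (sideCenters g i e) := by
  have he : ((e : ℕ) : ℝ) = 0 ∨ ((e : ℕ) : ℝ) = 1 := by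
    have : (e : ℕ) = 0 ∨ (e : ℕ) = 1 := by omega
    exact_mod_cast this
  refine ⟨?_, ?_, ?_, ?_, ?_, ?_⟩
  · rintro κ ⟨m, rfl | rfl⟩ m'
    · exact ⟨m + m', .inl (by push_cast; ring)⟩
    · exact ⟨m + m', .inr (by push_cast; ring)⟩
  -- Two centers of this set differ by 4q or 4q ± 2, so they coincide as soon as they are closer
  -- than 1.
  · have aux (q : ℤ) (x : ℝ) (h : |x| < 1) (e : x = 4 * (q : ℝ) ∨ x = 4 * (q : ℝ) + 2 ∨
        x = 4 * (q : ℝ) - 2) : x = 0 := by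
      rw [abs_lt] at h
      rcases e with e | e | e
      · rw [int_eq_zero_of_abs_lt e (by linarith) (by linarith)] at e
        simpa using e
      · have := int_eq_zero_of_abs_lt (x := x - 2) (q := q) (by linarith) (by linarith)
          (by linarith)
        rw [this] at e; norm_num at e; linarith
      · have := int_eq_zero_of_abs_lt (x := x + 2) (q := q) (by linarith) (by linarith)
          (by linarith)
        rw [this] at e; norm_num at e; linarith
    rintro κ ⟨m, hm⟩ κ' ⟨m', hm'⟩ h
    refine sub_eq_zero.1 (aux (g * (m - m')) _ h ?_)
    push_cast
    rcases hm with rfl | rfl <;> rcases hm' with rfl | rfl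
    · left; ring
    · right; right; ring
    · right; left; ring
    · left; ring
  · rintro j κ hκ ⟨h1, h2⟩
    obtain ⟨m, hm, h⟩ := sideCenters_local g hκ j (by linarith) (by linarith)
    have h3 : κ = 4 * (j : ℕ) + (e : ℕ) + 1 / 2 := by rcases he with he | he <;> grind
    have h4 : ((e : ℕ) : ℝ) = 0 := by rcases he with he | he <;> grind
    exact ⟨⟨by linarith, by linarith⟩, m, .inr (by linarith)⟩
  · rintro j κ hκ ⟨h1, h2⟩
    obtain ⟨m, hm, h⟩ := sideCenters_local g hκ j (by linarith) (by linarith)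
    have h3 : κ = 4 * (j : ℕ) + (e : ℕ) + 5 / 2 := by rcases he with he | he <;> grind
    have h4 : ((e : ℕ) : ℝ) = 0 := by rcases he with he | he <;> grind
    exact ⟨m, .inl (by linarith)⟩
  · rintro j κ hκ ⟨h1, h2⟩
    obtain ⟨m, hm, h⟩ := sideCenters_local g hκ j (by linarith) (by linarith)
    have h3 : κ = 4 * (j : ℕ) + (e : ℕ) + 1 / 2 := by rcases he with he | he <;> grind
    have h4 : ((e : ℕ) : ℝ) = 1 := by rcases he with he | he <;> grind
    exact ⟨⟨by linarith, by linarith⟩, m, .inr (by linarith)⟩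
  · rintro j κ hκ ⟨h1, h2⟩
    obtain ⟨m, hm, h⟩ := sideCenters_local g hκ j (by linarith) (by linarith)
    have h3 : κ = 4 * (j : ℕ) + (e : ℕ) + 5 / 2 := by rcases he with he | he <;> grind
    have h4 : ((e : ℕ) : ℝ) = 1 := by rcases he with he | he <;> grind
    exact ⟨m, .inl (by linarith)⟩

end StandardSurface

/-! ### Contractions of open subsets of the surface -/

namespace StandardSurface

open unitInterval

variable {g : ℕ}

/-- A homotopy `H` of the saturated open subset `W` of the polygon that contracts its image in
the surface to the point `m`. -/
structure IsContraction (g : ℕ) (W : Set PolygonDisk) (m : StandardSurface g)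
    (H : PolygonDisk → I → PolygonDisk) : Prop where
  isOpen : IsOpen W
  saturated : ∀ z z', SideGluing g z z' → (z ∈ W ↔ z' ∈ W)
  continuousOn : ContinuousOn (fun p : PolygonDisk × I => H p.1 p.2) (W ×ˢ Set.univ)
  zero : ∀ z ∈ W, H z 0 = z
  compat : ∀ z z', SideGluing g z z' → z ∈ W → ∀ s, proj g (H z s) = proj g (H z' s)
  one : ∀ z ∈ W, m = proj g (H z 1)

/-- The subset of the surface whose preimage in the polygon is the saturated set `W`. -/
def imageSet {W : Set PolygonDisk} (hW : ∀ z z', SideGluing g z z' → (z ∈ W ↔ z' ∈ W)) :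
    Set (StandardSurface g) :=
  {x | Quot.lift (· ∈ W) (fun z z' h => propext (hW z z' h)) x}

theorem proj_mem_imageSet {W : Set PolygonDisk}
    (hW : ∀ z z', SideGluing g z z' → (z ∈ W ↔ z' ∈ W)) (z : PolygonDisk) :
    proj g z ∈ imageSet hW ↔ z ∈ W := Iff.rfl

theorem isQuotientMap_proj (g : ℕ) : Topology.IsQuotientMap (proj g) := isQuotientMap_quot_mk

theorem isOpen_imageSet {W : Set PolygonDisk}
    (hW : ∀ z z', SideGluing g z z' → (z ∈ W ↔ z' ∈ W)) (ho : IsOpen W) :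
    IsOpen (imageSet hW) :=
  (isQuotientMap_proj g).isOpen_preimage.1 ho

theorem proj_surjective (g : ℕ) : Function.Surjective (proj g) := (isQuotientMap_proj g).surjective

open Classical in
/-- The homotopy induced on the surface. -/
noncomputable def IsContraction.descend {W : Set PolygonDisk} {m : StandardSurface g}
    {H : PolygonDisk → I → PolygonDisk} (hH : IsContraction g W m H) (s : I) :
    StandardSurface g → StandardSurface g :=
  Quot.lift (fun z => if z ∈ W then proj g (H z s) else proj g z) (fun z z' h => by
    by_cases hz : z ∈ W
    · have hz' := (hH.saturated z z' h).1 hz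
      simp only [hz, hz', if_true]
      exact hH.compat z z' h hz s
    · have hz' := mt (hH.saturated z z' h).2 hz
      simp only [hz, hz', if_false]
      exact Quot.sound h)

theorem IsContraction.descend_proj {W : Set PolygonDisk} {m : StandardSurface g}
    {H : PolygonDisk → I → PolygonDisk} (hH : IsContraction g W m H) (s : I) {z : PolygonDisk}
    (hz : z ∈ W) : hH.descend s (proj g z) = proj g (H z s) := if_pos hz

/-- Continuity must descend through the quotient map times the interval. Currying avoids product
quotients: the homotopy becomes a map to C(I, Σ_g), which descends along the quotient map restricted
to an open saturated set, and is then uncurried. -/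
theorem IsContraction.continuous_descend {W : Set PolygonDisk} {m : StandardSurface g}
    {H : PolygonDisk → I → PolygonDisk} (hH : IsContraction g W m H) :
    Continuous fun p : imageSet hH.saturated × I => hH.descend p.2 p.1 := by
  have ho := isOpen_imageSet hH.saturated hH.isOpen
  have hq := (isQuotientMap_proj g).restrictPreimage_isOpen ho
  have hc : Continuous fun p : (proj g ⁻¹' imageSet hH.saturated) × I => proj g (H p.1 p.2) :=
    (proj g).continuous.comp (hH.continuousOn.comp_continuous
      (f := fun p : (proj g ⁻¹' imageSet hH.saturated) × I => ((p.1 : PolygonDisk), p.2))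
      (by fun_prop) fun p => ⟨p.1.2, trivial⟩)
  let Φ : C(proj g ⁻¹' imageSet hH.saturated, C(I, StandardSurface g)) :=
    ContinuousMap.curry ⟨_, hc⟩
  have hΨ : Continuous fun x : imageSet hH.saturated =>
      (⟨fun s => hH.descend s x, by
        obtain ⟨z, hz⟩ := proj_surjective g x.1
        have hz' : z ∈ W := by rw [← proj_mem_imageSet hH.saturated, hz]; exact x.2
        simp_rw [← hz, hH.descend_proj _ hz']
        exact (Φ ⟨z, hz'⟩).continuous⟩ : C(I, StandardSurface g)) := by
    rw [hq.continuous_iff]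
    convert! Φ.continuous using 1
    ext z s
    exact hH.descend_proj s z.2
  exact ContinuousMap.continuous_uncurry_of_continuous ⟨_, hΨ⟩

instance : ContractibleSpace I :=
  (convex_Icc (0 : ℝ) 1).contractibleSpace ⟨0, by simp⟩

/-- Paths inside a contractible piece are homotopic to paths that pass through the point to which
the piece contracts. -/
theorem IsContraction.mk_eq {W : Set PolygonDisk} {m : StandardSurface g}
    {H : PolygonDisk → I → PolygonDisk} (hH : IsContraction g W m H) {x y : StandardSurface g}
    (γ : Path x y) (hγ : ∀ t, γ t ∈ imageSet hH.saturated) {z z' : PolygonDisk}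
    (hz : z ∈ W) (hz' : z' ∈ W) (hx : x = proj g z) (hy : y = proj g z') :
    Path.Homotopic.Quotient.mk γ =
      (diskClass g z (H z 1) hx (hH.one z hz)).trans
        (diskClass g (H z' 1) z' (hH.one z' hz') hy) := by
  -- The contraction applied along γ gives a square with γ at the bottom, the constant path m on
  -- top, and the tracks of the two ends as vertical sides. The square is simply connected, so the
  -- bottom equals the composite of the other three sides.
  let K : C(I × I, StandardSurface g) := ⟨fun p => hH.descend p.2 (γ p.1),
    hH.continuous_descend.comp (f := fun p : I × I =>
      ((⟨γ p.1, hγ p.1⟩, p.2) : imageSet hH.saturated × I)) (by fun_prop)⟩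
  have K_apply (t s : I) : K (t, s) = hH.descend s (γ t) := rfl
  have K0 (s : I) : K (0, s) = proj g (H z s) := by
    rw [K_apply, γ.source, hx, hH.descend_proj s hz]
  have K1 (s : I) : K (1, s) = proj g (H z' s) := by
    rw [K_apply, γ.target, hy, hH.descend_proj s hz']
  have Kt0 (t : I) : K (t, 0) = γ t := by
    obtain ⟨w, hw⟩ := proj_surjective g (γ t)
    have hw' : w ∈ W := by rw [← proj_mem_imageSet hH.saturated, hw]; exact hγ t
    rw [K_apply, ← hw, hH.descend_proj 0 hw', hH.zero w hw']
  have Kt1 (t : I) : K (t, 1) = m := by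
    obtain ⟨w, hw⟩ := proj_surjective g (γ t)
    have hw' : w ∈ W := by rw [← proj_mem_imageSet hH.saturated, hw]; exact hγ t
    rw [K_apply, ← hw, hH.descend_proj 1 hw', ← hH.one w hw']
  have hx0 : x = K (0, 0) := by rw [Kt0, γ.source]
  have hy0 : y = K (1, 0) := by rw [Kt0, γ.target]
  have track (w : PolygonDisk) (hw : w ∈ W) : Continuous fun s : I => H w s :=
    hH.continuousOn.comp_continuous (f := fun s : I => (w, s)) (by fun_prop)
      fun s => ⟨hw, trivial⟩
  let idPath : Path (0 : I) 1 := ⟨ContinuousMap.id I, rfl, rfl⟩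
  let δ (w : PolygonDisk) (hw : w ∈ W) : Path w (H w 1) :=
    ⟨⟨fun s => H w s, track w hw⟩, hH.zero w hw, rfl⟩
  rw [← through_eq_mk K hx0 hy0 (idPath.map (f := fun t => (t, (0 : I))) (by fun_prop)) γ
      fun t => (Kt0 t).symm, ← through_trans K _ (0, 1) _ hx0 (Kt1 0).symm hy0,
    ← through_trans K (0, 1) (1, 1) _ (Kt1 0).symm (Kt1 1).symm hy0,
    through_congr K (proj g) hx0 (Kt1 0).symm hx (hH.one z hz)
      (idPath.map (f := fun t => ((0 : I), t)) (by fun_prop)) (δ z hz) K0,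
    through_eq_mk K (Kt1 0).symm (Kt1 1).symm
      (idPath.map (f := fun t => (t, (1 : I))) (by fun_prop)) (Path.refl m)
      fun t => (Kt1 t).symm,
    through_congr K (proj g) (Kt1 1).symm hy0 (hH.one z' hz') hy
      (idPath.map (f := fun t => ((1 : I), t)) (by fun_prop)).symm (δ z' hz').symm
      fun t => K1 _]
  rw [Path.Homotopic.Quotient.mk_refl, Path.Homotopic.Quotient.refl_trans]

/-! ### The contractions -/

theorem SideGluing.norm_left {z z' : PolygonDisk} (h : SideGluing g z z') : ‖(z : ℂ)‖ = 1 := by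
  cases h <;> exact norm_boundaryPoint _ _

theorem SideGluing.norm_right {z z' : PolygonDisk} (h : SideGluing g z z') : ‖(z' : ℂ)‖ = 1 := by
  cases h <;> exact norm_boundaryPoint _ _

theorem center_mem : (0 : ℂ) ∈ Metric.closedBall (0 : ℂ) 1 := by simp

/-- The radial contraction of the interior of the polygon. -/
noncomputable def shrink (z : PolygonDisk) (s : I) : PolygonDisk :=
  ⟨((1 - s : ℝ) : ℂ) * z, by
    rw [mem_closedBall_zero_iff, norm_mul, Complex.norm_real, Real.norm_eq_abs,
      abs_of_nonneg (sub_nonneg.2 s.2.2)]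
    exact mul_le_one₀ (by linarith [s.2.1]) (norm_nonneg _) (norm_mem z).2⟩

theorem isContraction_interior (g : ℕ) :
    IsContraction g {z | ‖(z : ℂ)‖ < 1} (proj g ⟨0, center_mem⟩) shrink where
  isOpen := isOpen_lt (by fun_prop) continuous_const
  saturated z z' h := by simp [SideGluing.norm_left h, SideGluing.norm_right h]
  continuousOn := by
    refine Continuous.continuousOn (Continuous.subtype_mk ?_ _)
    fun_prop
  zero z _ := Subtype.ext (by simp [shrink])
  compat z z' h hz := by
    simp [SideGluing.norm_left h] at hz
  one z _ := congrArg (proj g) (Subtype.ext (by simp [shrink]))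

open Classical in
/-- The homotopy that pushes the sectors with centers in `K` to the centers. -/
noncomputable def push (g : ℕ) (K : Set ℝ) (z : PolygonDisk) (s : I) : PolygonDisk :=
  if h : ∃ κ ∈ K, z ∈ sector g κ then
    polar g ((1 - s) * ‖(z : ℂ)‖ + s) (h.choose + (1 - s) * relAngle g h.choose z)
  else z

theorem polar_add_int (g : ℕ) [NeZero g] (r θ : ℝ) (m : ℤ) :
    polar g r (θ + 4 * g * m) = polar g r θ := by
  simp only [polar, boundaryPoint_add_int]

/-- The center chosen in the definition differs from κ by a multiple of 4g, which changes neither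
the relative angle nor the polar point. -/
theorem push_eq [NeZero g] {K : Set ℝ} (hK : IsCenterSet g K) {κ : ℝ} (hκ : κ ∈ K)
    {z : PolygonDisk} (hz : z ∈ sector g κ) (s : I) :
    push g K z s = polar g ((1 - s) * ‖(z : ℂ)‖ + s) (κ + (1 - s) * relAngle g κ z) := by
  have h : ∃ κ ∈ K, z ∈ sector g κ := ⟨κ, hκ, hz⟩
  rw [push, dif_pos h]
  obtain ⟨m, hm⟩ := hK.eq_add_of_mem h.choose_spec.1 hκ h.choose_spec.2 hz
  rw [hm, relAngle_add_int, add_right_comm, polar_add_int]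

theorem push_boundaryPoint [NeZero g] {K : Set ℝ} (hK : IsCenterSet g K) {κ θ : ℝ} (hκ : κ ∈ K)
    (h : |θ - κ| < 1 / 2) (s : I) :
    push g K (boundaryPoint g θ) s = boundaryPoint g (κ + (1 - s) * (θ - κ)) := by
  rw [push_eq hK hκ (boundaryPoint_mem_sector g h), norm_boundaryPoint,
    relAngle_boundaryPoint g h, ← polar_one]
  congr 1
  ring

theorem edgePoint_side_a (i : Fin g) {θ : ℝ}
    (h : θ ∈ Set.Icc (4 * (i : ℕ) : ℝ) (4 * (i : ℕ) + 1)) :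
    edgePoint g θ = edgePoint g (8 * (i : ℕ) + 3 - θ) := by
  have := edgePoint_a g i (θ - 4 * (i : ℕ)) ⟨by linarith [h.1], by linarith [h.2]⟩
  convert! this using 2 <;> ring

theorem edgePoint_side_b (i : Fin g) {θ : ℝ}
    (h : θ ∈ Set.Icc (4 * (i : ℕ) + 1 : ℝ) (4 * (i : ℕ) + 2)) :
    edgePoint g θ = edgePoint g (8 * (i : ℕ) + 5 - θ) := by
  have := edgePoint_b g i (θ - (4 * (i : ℕ) + 1)) ⟨by linarith [h.1], by linarith [h.2]⟩
  convert! this using 2 <;> ring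

theorem isContraction_push [NeZero g] {K : Set ℝ} (hK : IsCenterSet g K) (m : StandardSurface g)
    (hm : ∀ κ ∈ K, m = edgePoint g κ) : IsContraction g (sectors g K) m (push g K) where
  isOpen := isOpen_sectors g K
  saturated z z' h := hK.saturated h
  continuousOn := by
    rintro ⟨z, s⟩ ⟨⟨κ, hκ, hz⟩, -⟩
    have hnhds : sector g κ ×ˢ (Set.univ : Set I) ∈ nhds (z, s) :=
      prod_mem_nhds ((isOpen_sector g κ).mem_nhds hz) Filter.univ_mem
    have h1 : ContinuousOn (fun p : PolygonDisk × I => (1 - (p.2 : ℝ)) * ‖(p.1 : ℂ)‖ + p.2)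
        (sector g κ ×ˢ Set.univ) := Continuous.continuousOn (by fun_prop)
    have h2 : ContinuousOn (fun p : PolygonDisk × I => relAngle g κ p.1)
        (sector g κ ×ˢ Set.univ) :=
      ((continuousOn_relAngle g κ).mono fun z hz => hz.1).comp continuousOn_fst fun p hp => hp.1
    have h3 : ContinuousOn (fun p : PolygonDisk × I => (1 - (p.2 : ℝ)))
        (sector g κ ×ˢ Set.univ) := Continuous.continuousOn (by fun_prop)
    have hcont : ContinuousOn (fun p : PolygonDisk × I =>
        polar g ((1 - p.2) * ‖(p.1 : ℂ)‖ + p.2) (κ + (1 - p.2) * relAngle g κ p.1))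
        (sector g κ ×ˢ Set.univ) :=
      (continuous_polar g).comp_continuousOn (f := fun p : PolygonDisk × I =>
        ((1 - (p.2 : ℝ)) * ‖(p.1 : ℂ)‖ + p.2, κ + (1 - (p.2 : ℝ)) * relAngle g κ p.1))
        (h1.prodMk (continuousOn_const.add (h3.mul h2)))
    have hpush : ContinuousOn (fun p : PolygonDisk × I => push g K p.1 p.2)
        (sector g κ ×ˢ Set.univ) := hcont.congr fun p hp => push_eq hK hκ hp.1 p.2
    exact (hpush.continuousAt hnhds).continuousWithinAt
  zero := by
    rintro z ⟨κ, hκ, hz⟩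
    rw [push_eq hK hκ hz]
    simpa using polar_relAngle g κ z
  compat := by
    intro z z' h hz s
    obtain ⟨θ, κ, τ, rfl, rfl, h1, hκ, hκ', h2⟩ := hK.gluing h (.inl hz)
    have h1' : |τ - θ - (τ - κ)| < 1 / 2 := by rw [abs_lt] at h1 ⊢; constructor <;> linarith
    rw [push_boundaryPoint hK hκ h1, push_boundaryPoint hK hκ' h1']
    -- The affine contraction towards a center commutes with the reflection θ ↦ τ - θ that glues the
    -- sides.
    have e : τ - κ + (1 - s) * (τ - θ - (τ - κ)) = τ - (κ + (1 - s) * (θ - κ)) := by ring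
    rw [e]
    -- The moving point stays on the closed side that contains both the point and its center, so its
    -- image remains glued to the image of the partner point.
    have conv {a b : ℝ} (ha : θ ∈ Set.Icc a b) (hb : κ ∈ Set.Icc a b) :
        κ + (1 - s) * (θ - κ) ∈ Set.Icc a b := by
      have := linePath_mem hb ha (unitInterval.symm s)
      simpa [linePath] using this
    rcases h2 with ⟨i, rfl, h3, h4⟩ | ⟨i, rfl, h3, h4⟩
    · exact edgePoint_side_a i (conv h3 h4)
    · exact edgePoint_side_b i (conv h3 h4)
  one := by
    rintro z ⟨κ, hκ, hz⟩
    rw [push_eq hK hκ hz, hm κ hκ]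
    simp only [Set.Icc.coe_one, sub_self, zero_mul, zero_add, add_zero, polar_one]
    rfl

theorem push_one [NeZero g] {K : Set ℝ} (hK : IsCenterSet g K) {z : PolygonDisk}
    (hz : z ∈ sectors g K) : ∃ κ ∈ K, push g K z 1 = boundaryPoint g κ := by
  obtain ⟨κ, hκ, hz⟩ := hz
  refine ⟨κ, hκ, ?_⟩
  rw [push_eq hK hκ hz]
  simp [polar_one]

end StandardSurface

/-! ### The sides generate the fundamental group -/

namespace StandardSurface

open unitInterval

variable (g : ℕ) [NeZero g]

theorem exists_int_decomposition (k : ℤ) :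
    ∃ (m : ℤ) (i : Fin g) (j : Fin 4), k = 4 * (i : ℕ) + (j : ℕ) + 4 * g * m := by
  have hg : (0 : ℤ) < 4 * g := by have := NeZero.pos g; omega
  have h1 := Int.emod_nonneg k hg.ne'
  have h2 := Int.emod_lt_of_pos k hg
  have h3 := Int.emod_add_mul_ediv k (4 * g)
  refine ⟨k / (4 * g), ⟨(k % (4 * g)).toNat / 4, by omega⟩, ⟨(k % (4 * g)).toNat % 4, by omega⟩, ?_⟩
  have h4 : ((k % (4 * g)).toNat : ℤ) = k % (4 * g) := Int.toNat_of_nonneg h1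
  have h5 : (4 * ((k % (4 * g)).toNat / 4 : ℕ) + ((k % (4 * g)).toNat % 4 : ℕ) : ℤ) =
      k % (4 * g) := by omega
  rw [h5, h3]

theorem exists_boundaryPoint_eq_add (k : ℤ) (x : ℝ) : ∃ (i : Fin g) (j : Fin 4),
    boundaryPoint g (k + x) = boundaryPoint g (4 * (i : ℕ) + (j : ℕ) + x) := by
  obtain ⟨m, i, j, rfl⟩ := exists_int_decomposition g k
  refine ⟨i, j, ?_⟩
  rw [← boundaryPoint_add_int g (4 * (i : ℕ) + (j : ℕ) + x) m]
  congr 1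
  push_cast
  ring

/-- The subgroup generated by the sides. -/
noncomputable def sideSubgroup : Subgroup (FundamentalGroup (StandardSurface g) (base g)) :=
  Subgroup.closure (Set.range (genA g) ∪ Set.range (genB g))

omit [NeZero g] in
theorem genA_mem (i : Fin g) : genA g i ∈ sideSubgroup g :=
  Subgroup.subset_closure (.inl ⟨i, rfl⟩)

omit [NeZero g] in
theorem genB_mem (i : Fin g) : genB g i ∈ sideSubgroup g :=
  Subgroup.subset_closure (.inr ⟨i, rfl⟩)

theorem vertexLoop_mem (k : ℕ) (hk : k ≤ g) : vertexLoop g k hk ∈ sideSubgroup g := by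
  induction k with
  | zero => rw [vertexLoop_zero]; exact one_mem _
  | succ k ih =>
    rw [vertexLoop_succ g ⟨k, hk⟩]
    have hA := genA_mem g ⟨k, hk⟩
    have hB := genB_mem g ⟨k, hk⟩
    exact mul_mem (inv_mem hB) (mul_mem (mul_mem (mul_mem (inv_mem hA) hB) hA) (ih _))

omit [NeZero g] in
theorem base_eq_vertex (i : Fin g) (j : Fin 4) :
    base g = edgePoint g (4 * (i : ℕ) + (j : ℕ)) := by
  fin_cases j
  · simpa using base_eq_zero g i
  · simpa using base_eq_one g i
  · simpa using base_eq_two g i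
  · simpa using base_eq_three g i

theorem arcLoop_vertex_mem (i : Fin g) (j : Fin 4) :
    arcLoop g 0 (4 * (i : ℕ) + (j : ℕ)) (base_eq g) (base_eq_vertex g i j) ∈ sideSubgroup g := by
  have hV := vertexLoop_mem g i i.2.le
  have hA := genA_mem g i
  have hB := genB_mem g i
  fin_cases j
  · rw [arcLoop_congr g (η' := 4 * (i : ℕ)) _ _ rfl (by simp)]
    exact hV
  · rw [arcLoop_congr g (η' := 4 * (i : ℕ) + 1) _ _ rfl (by simp), arcLoop_zero_one]
    exact mul_mem hA hV
  · rw [arcLoop_congr g (η' := 4 * (i : ℕ) + 2) _ _ rfl (by simp), arcLoop_zero_two]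
    exact mul_mem (mul_mem hB hA) hV
  · rw [arcLoop_congr g (η' := 4 * (i : ℕ) + 3) _ _ rfl (by simp), arcLoop_zero_three]
    exact mul_mem (mul_mem (mul_mem (inv_mem hA) hB) hA) hV

/-- The loops whose classes are products of sides. -/
def IsSideLoop (c : Path.Homotopic.Quotient (base g) (base g)) : Prop :=
  FundamentalGroup.fromPath c ∈ sideSubgroup g

variable {g}

omit [NeZero g] in
theorem IsSideLoop.trans {c c' : Path.Homotopic.Quotient (base g) (base g)} (h : IsSideLoop g c)
    (h' : IsSideLoop g c') : IsSideLoop g (c.trans c') :=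
  mul_mem (S := Subgroup (FundamentalGroup (StandardSurface g) (base g))) h' h

omit [NeZero g] in
theorem IsSideLoop.symm {c : Path.Homotopic.Quotient (base g) (base g)} (h : IsSideLoop g c) :
    IsSideLoop g c.symm :=
  inv_mem (S := Subgroup (FundamentalGroup (StandardSurface g) (base g))) h

omit [NeZero g] in
theorem isSideLoop_refl : IsSideLoop g (Path.Homotopic.Quotient.refl (base g)) :=
  one_mem (sideSubgroup g)

omit [NeZero g] in
theorem arc_symm {θ θ' : ℝ} {x x' : StandardSurface g} (hx : x = edgePoint g θ)
    (hx' : x' = edgePoint g θ') : (arc g θ θ' hx hx').symm = arc g θ' θ hx' hx :=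
  through_symm _ _ _ _ _

omit [NeZero g] in
theorem diskClass_refl (z : PolygonDisk) {x : StandardSurface g} (h h' : x = proj g z) :
    diskClass g z z h h' = Path.Homotopic.Quotient.refl x := through_refl _ _ _

/-- The loop along `c` and then along a path of the polygon back to the base point. -/
noncomputable def closeUp {x : StandardSurface g} (c : Path.Homotopic.Quotient (base g) x)
    (z : PolygonDisk) (hx : x = proj g z) : Path.Homotopic.Quotient (base g) (base g) :=
  c.trans (diskClass g z (boundaryPoint g 0) hx (base_eq_proj g))

/-- The path of the polygon from the vertex `0` to `z`. -/
noncomputable abbrev reach {x : StandardSurface g} (z : PolygonDisk) (hx : x = proj g z) :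
    Path.Homotopic.Quotient (base g) x :=
  diskClass g (boundaryPoint g 0) z (base_eq_proj g) hx

omit [NeZero g] in
theorem closeUp_reach_self {x : StandardSurface g} (z : PolygonDisk) (hx : x = proj g z) :
    closeUp (reach z hx) z hx = Path.Homotopic.Quotient.refl (base g) := by
  rw [closeUp, through_trans, through_refl]

omit [NeZero g] in
theorem closeUp_reach_symm {x : StandardSurface g} (z z' : PolygonDisk) (hx : x = proj g z)
    (hx' : x = proj g z') : (closeUp (reach z hx) z' hx').symm = closeUp (reach z' hx') z hx := by
  have h : (closeUp (reach z hx) z' hx').trans (closeUp (reach z' hx') z hx) =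
      Path.Homotopic.Quotient.refl (base g) := by
    simp only [closeUp]
    rw [Path.Homotopic.Quotient.trans_assoc, ← Path.Homotopic.Quotient.trans_assoc _ (reach z' hx'),
      through_trans, through_refl, Path.Homotopic.Quotient.refl_trans, through_trans, through_refl]
  calc (closeUp (reach z hx) z' hx').symm
      = (closeUp (reach z hx) z' hx').symm.trans ((closeUp (reach z hx) z' hx').trans
          (closeUp (reach z' hx') z hx)) := by rw [h, Path.Homotopic.Quotient.trans_refl]
    _ = _ := by
      rw [← Path.Homotopic.Quotient.trans_assoc, Path.Homotopic.Quotient.symm_trans,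
        Path.Homotopic.Quotient.refl_trans]

theorem isSideLoop_arc_vertex (i : Fin g) (j : Fin 4) :
    IsSideLoop g (arc g 0 (4 * (i : ℕ) + (j : ℕ)) (base_eq g) (base_eq_vertex g i j)) :=
  arcLoop_vertex_mem g i j

theorem isSideLoop_closeUp_vertex (i : Fin g) (j : Fin 4) (i' : Fin g) (j' : Fin 4)
    {w w' : PolygonDisk} (hw : w = boundaryPoint g (4 * (i : ℕ) + (j : ℕ)))
    (hw' : w' = boundaryPoint g (4 * (i' : ℕ) + (j' : ℕ))) (h : base g = proj g w)
    (h' : base g = proj g w') : IsSideLoop g (closeUp (reach w h) w' h') := by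
  subst hw hw'
  rw [closeUp, reach, diskClass_boundary, diskClass_boundary, ← arc_symm (θ := 0)]
  exact (isSideLoop_arc_vertex i j).trans (isSideLoop_arc_vertex i' j').symm

-- By `IsContraction.mk_eq`, δ may be rerouted along the track of z to its target and back along the
-- track of z'. The new closed loop is therefore the old one followed by a loop that depends only on
-- the two targets, and `hgood` deals with those.
omit [NeZero g] in
theorem IsContraction.closeUp_step {W : Set PolygonDisk} {m : StandardSurface g}
    {H : PolygonDisk → I → PolygonDisk} (hH : IsContraction g W m H)
    (hgood : ∀ z (_ : z ∈ W) z' (_ : z' ∈ W) (h : m = proj g (H z 1)) (h' : m = proj g (H z' 1)),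
      IsSideLoop g (closeUp (reach (H z 1) h) (H z' 1) h'))
    {x y : StandardSurface g} (δ : Path x y) (hδ : ∀ t, δ t ∈ imageSet hH.saturated)
    (c : Path.Homotopic.Quotient (base g) x) (z z' : PolygonDisk) (hx : x = proj g z)
    (hy : y = proj g z') (h : IsSideLoop g (closeUp c z hx)) :
    IsSideLoop g (closeUp (c.trans (Path.Homotopic.Quotient.mk δ)) z' hy) := by
  have hz : z ∈ W := by
    rw [← proj_mem_imageSet hH.saturated, ← hx, ← δ.source]; exact hδ 0
  have hz' : z' ∈ W := by
    rw [← proj_mem_imageSet hH.saturated, ← hy, ← δ.target]; exact hδ 1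
  have hm := h.trans (hgood z hz z' hz' (hH.one z hz) (hH.one z' hz'))
  convert! hm using 1
  simp only [closeUp]
  rw [hH.mk_eq δ hδ hz hz' hx hy]
  simp only [Path.Homotopic.Quotient.trans_assoc]
  rw [through_trans]
  congr 1
  simp only [← Path.Homotopic.Quotient.trans_assoc]
  rw [through_trans]

variable (g) in
/-- An open set of the surface inside which paths change the class in `π₁` modulo the subgroup
generated by the sides only in the expected way. -/
def IsGoodSet (U : Set (StandardSurface g)) : Prop :=
  IsOpen U ∧ ∀ {x y : StandardSurface g} (δ : Path x y), (∀ t, δ t ∈ U) →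
    ∀ (c : Path.Homotopic.Quotient (base g) x) (z z' : PolygonDisk) (hx : x = proj g z)
      (hy : y = proj g z'), IsSideLoop g (closeUp c z hx) →
      IsSideLoop g (closeUp (c.trans (Path.Homotopic.Quotient.mk δ)) z' hy)

theorem base_eq_int (k : ℤ) : base g = edgePoint g k := by
  obtain ⟨i, j, h⟩ := exists_boundaryPoint_eq_add g k 0
  rw [add_zero, add_zero] at h
  rw [edgePoint, h]
  exact base_eq_vertex g i j

theorem isContraction_vertices :
    IsContraction g (sectors g (Set.range ((↑) : ℤ → ℝ))) (base g)
      (push g (Set.range ((↑) : ℤ → ℝ))) :=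
  isContraction_push (isCenterSet_vertices g) _ (by rintro _ ⟨k, rfl⟩; exact base_eq_int k)

/-- The targets are vertices, and boundary arcs from vertex 0 to any vertex are words in the sides.
-/
theorem isGoodSet_vertices :
    IsGoodSet g (imageSet (isContraction_vertices (g := g)).saturated) := by
  refine ⟨isOpen_imageSet _ isContraction_vertices.isOpen,
    isContraction_vertices.closeUp_step ?_⟩
  intro z hz z' hz' h h'
  obtain ⟨_, ⟨k, rfl⟩, hk⟩ := push_one (isCenterSet_vertices g) hz
  obtain ⟨_, ⟨k', rfl⟩, hk'⟩ := push_one (isCenterSet_vertices g) hz'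
  obtain ⟨i, j, e⟩ := exists_boundaryPoint_eq_add g k 0
  obtain ⟨i', j', e'⟩ := exists_boundaryPoint_eq_add g k' 0
  rw [add_zero, add_zero] at e e'
  exact isSideLoop_closeUp_vertex i j i' j' (hk.trans e) (hk'.trans e') _ _

omit [NeZero g] in
theorem edgePoint_side (i : Fin g) (e : Fin 2) {t : ℝ} (ht : t ∈ Set.Icc (0 : ℝ) 1) :
    edgePoint g (4 * (i : ℕ) + (e : ℕ) + t) = edgePoint g (4 * (i : ℕ) + (e : ℕ) + 3 - t) := by
  fin_cases e
  · simpa using edgePoint_a g i t ht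
  · have := edgePoint_b g i t ht
    rw [show (4 * (i : ℕ) + 4 - t : ℝ) = 4 * (i : ℕ) + ((1 : Fin 2) : ℕ) + 3 - t by
      norm_num; ring] at this
    simpa using this

omit [NeZero g] in
theorem arc_side (i : Fin g) (e : Fin 2) {s t : ℝ} (hs : s ∈ Set.Icc (0 : ℝ) 1)
    (ht : t ∈ Set.Icc (0 : ℝ) 1) {x x' : StandardSurface g}
    (hx : x = edgePoint g (4 * (i : ℕ) + (e : ℕ) + s))
    (hx' : x' = edgePoint g (4 * (i : ℕ) + (e : ℕ) + t)) :
    arc g (4 * (i : ℕ) + (e : ℕ) + s) (4 * (i : ℕ) + (e : ℕ) + t) hx hx' =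
      arc g (4 * (i : ℕ) + (e : ℕ) + 3 - s) (4 * (i : ℕ) + (e : ℕ) + 3 - t)
        (hx.trans (edgePoint_side i e hs)) (hx'.trans (edgePoint_side i e ht)) := by
  refine through_congr _ _ _ _ _ _ ((linePath s t).map (f := fun r => 4 * (i : ℕ) + (e : ℕ) + r)
    (by fun_prop)) ((linePath s t).map (f := fun r => 4 * (i : ℕ) + (e : ℕ) + 3 - r)
    (by fun_prop)) ?_
  exact fun r => edgePoint_side i e (linePath_mem hs ht r)

theorem sideCenters_cases {i : Fin g} {e : Fin 2} {κ : ℝ} (h : κ ∈ sideCenters g i e) :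
    boundaryPoint g κ = boundaryPoint g (4 * (i : ℕ) + (e : ℕ) + 1 / 2) ∨
      boundaryPoint g κ = boundaryPoint g (4 * (i : ℕ) + (e : ℕ) + 5 / 2) := by
  obtain ⟨m, rfl | rfl⟩ := h
  · left; exact boundaryPoint_add_int g _ m
  · right; exact boundaryPoint_add_int g _ m

theorem isContraction_sides (i : Fin g) (e : Fin 2) :
    IsContraction g (sectors g (sideCenters g i e))
      (edgePoint g (4 * (i : ℕ) + (e : ℕ) + 1 / 2)) (push g (sideCenters g i e)) :=
  isContraction_push (isCenterSet_sides g i e) _ (by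
    intro κ hκ
    rcases sideCenters_cases hκ with h | h
    · rw [edgePoint, edgePoint, h]
    · rw [edgePoint_side i e (by norm_num), edgePoint, edgePoint, h]
      congr 2; ring)

/-- The loop passes from a midpoint to its partner midpoint. Splitting at the adjacent vertices
leaves two boundary arcs between vertices and two half sides, and the half sides cancel. -/
theorem isSideLoop_closeUp_side (i : Fin g) (e : Fin 2) {x : StandardSurface g}
    (h : x = proj g (boundaryPoint g (4 * (i : ℕ) + (e : ℕ) + 1 / 2)))
    (h' : x = proj g (boundaryPoint g (4 * (i : ℕ) + (e : ℕ) + 5 / 2))) :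
    IsSideLoop g (closeUp (reach (boundaryPoint g (4 * (i : ℕ) + (e : ℕ) + 1 / 2)) h)
      (boundaryPoint g (4 * (i : ℕ) + (e : ℕ) + 5 / 2)) h') := by
  have hb : base g = edgePoint g (4 * (i : ℕ) + (e : ℕ)) := by
    have := base_eq_int (g := g) (4 * (i : ℕ) + (e : ℕ))
    push_cast at this; exact this
  have hb' : base g = edgePoint g (4 * (i : ℕ) + (e : ℕ) + 3) := by
    have := base_eq_int (g := g) (4 * (i : ℕ) + (e : ℕ) + 3)
    push_cast at this; exact this
  rw [closeUp, reach, diskClass_boundary, diskClass_boundary, ← arc_trans g _ hb _,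
    ← arc_trans g (θ' := 4 * (i : ℕ) + (e : ℕ) + 3) (θ'' := 0) _ hb' _]
  set h1 := h.trans (edgePoint_eq g _).symm
  set h2 := h'.trans (edgePoint_eq g _).symm
  -- The half side leading to the midpoint is glued to the half side from vertex 4i + e + 3 back to
  -- the partner midpoint; the second arc retraces it.
  have e3 : (arc g (4 * (i : ℕ) + (e : ℕ)) (4 * (i : ℕ) + (e : ℕ) + 1 / 2) hb h1).trans
      (arc g (4 * (i : ℕ) + (e : ℕ) + 5 / 2) (4 * (i : ℕ) + (e : ℕ) + 3) h2 hb') =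
      Path.Homotopic.Quotient.refl _ := by
    rw [arc_congr g (θ := 4 * (i : ℕ) + (e : ℕ)) (η := 4 * (i : ℕ) + (e : ℕ) + 0) _ _
      (by ring) rfl, arc_side i e (by simp) (by norm_num),
      arc_congr g (θ := 4 * (i : ℕ) + (e : ℕ) + 3 - 0) (η := 4 * (i : ℕ) + (e : ℕ) + 3)
      (η' := 4 * (i : ℕ) + (e : ℕ) + 5 / 2) _ _ (by ring) (by ring), arc_trans]
    exact through_refl _ _ _
  rw [Path.Homotopic.Quotient.trans_assoc, ← Path.Homotopic.Quotient.trans_assoc _ _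
      (arc g (4 * (i : ℕ) + (e : ℕ) + 3) 0 hb' _), e3,
      Path.Homotopic.Quotient.refl_trans, ← arc_symm (θ := 0)]
  refine IsSideLoop.trans ?_ (IsSideLoop.symm ?_)
  · obtain ⟨j, hj⟩ : ∃ j : Fin 4, (j : ℕ) = (e : ℕ) := ⟨⟨e, by omega⟩, rfl⟩
    rw [arc_congr g (η' := 4 * (i : ℕ) + (j : ℕ)) _ _ rfl (by rw [hj])]
    exact isSideLoop_arc_vertex i j
  · have he : (e : ℕ) = 0 ∨ (e : ℕ) = 1 := by omega
    rcases he with he | he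
    · rw [arc_congr g (η' := 4 * (i : ℕ) + ((3 : Fin 4) : ℕ)) _ _ rfl (by
        rw [he, show ((3 : Fin 4) : ℕ) = 3 from rfl]; push_cast; ring)]
      exact isSideLoop_arc_vertex i 3
    -- For e = 1 the end vertex 4i + 4 belongs to the next handle. `vertexLoop` also allows the
    -- index g, so the last handle needs no separate case.
    · rw [arc_congr g (η' := 4 * (i + 1 : ℕ)) _ _ rfl (by rw [he]; push_cast; ring)]
      exact vertexLoop_mem g (i + 1) i.2

theorem isGoodSet_sides (i : Fin g) (e : Fin 2) :
    IsGoodSet g (imageSet (isContraction_sides i e).saturated) := by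
  refine ⟨isOpen_imageSet _ (isContraction_sides i e).isOpen,
    (isContraction_sides i e).closeUp_step ?_⟩
  intro z hz z' hz' h h'
  obtain ⟨κ, hκ, hk⟩ := push_one (isCenterSet_sides g i e) hz
  obtain ⟨κ', hκ', hk'⟩ := push_one (isCenterSet_sides g i e) hz'
  generalize push g (sideCenters g i e) z 1 = w at *
  generalize push g (sideCenters g i e) z' 1 = w' at *
  rcases sideCenters_cases hκ with e1 | e1 <;> rcases sideCenters_cases hκ' with e2 | e2 <;>
    rw [e1] at hk <;> rw [e2] at hk' <;> subst hk hk'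
  · rw [closeUp_reach_self]; exact isSideLoop_refl
  · exact isSideLoop_closeUp_side i e _ _
  · rw [← closeUp_reach_symm]; exact (isSideLoop_closeUp_side i e _ _).symm
  · rw [closeUp_reach_self]; exact isSideLoop_refl

theorem isGoodSet_interior (g : ℕ) [NeZero g] :
    IsGoodSet g (imageSet (isContraction_interior g).saturated) := by
  refine ⟨isOpen_imageSet _ (isContraction_interior g).isOpen,
    (isContraction_interior g).closeUp_step ?_⟩
  intro z hz z' hz' h h'
  have e : shrink z' 1 = shrink z 1 := Subtype.ext (by simp [shrink])
  generalize shrink z 1 = w at *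
  generalize shrink z' 1 = w' at *
  subst e
  rw [closeUp_reach_self]
  exact isSideLoop_refl

/-- A boundary parameter is either closer than 1/2 to an integer, hence near a vertex, or exactly a
half integer, hence the midpoint of a side. -/
theorem exists_mem_piece (z : PolygonDisk) : ‖(z : ℂ)‖ < 1 ∨
    z ∈ sectors g (Set.range ((↑) : ℤ → ℝ)) ∨
      ∃ (i : Fin g) (e : Fin 2), z ∈ sectors g (sideCenters g i e) := by
  rcases (norm_mem z).2.lt_or_eq with h | h
  · exact .inl h
  obtain ⟨θ, rfl⟩ : ∃ θ, z = boundaryPoint g θ := by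
    have := polar_relAngle g 0 z
    rw [h, polar_one] at this
    exact ⟨_, this.symm⟩
  rcases (abs_sub_round θ).lt_or_eq with h1 | h1
  · exact .inr (.inl ((isCenterSet_vertices g).boundaryPoint_mem_iff.2 ⟨_, ⟨round θ, rfl⟩, h1⟩))
  · obtain ⟨k, hk⟩ : ∃ k : ℤ, θ = k + 1 / 2 := by
      rcases (abs_eq (by norm_num)).1 h1 with h2 | h2
      · exact ⟨round θ, by linarith⟩
      · exact ⟨round θ - 1, by push_cast; linarith⟩
    obtain ⟨m, i, j, rfl⟩ := exists_int_decomposition g k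
    have : ∃ e : Fin 2, θ ∈ sideCenters g i e := by
      rw [hk]
      fin_cases j
      · exact ⟨0, m, .inl (by push_cast; simp; ring)⟩
      · exact ⟨1, m, .inl (by push_cast; simp; ring)⟩
      · exact ⟨0, m, .inr (by push_cast; simp; ring)⟩
      · exact ⟨1, m, .inr (by push_cast; simp; ring)⟩
    obtain ⟨e, he⟩ := this
    exact .inr (.inr ⟨i, e, (isCenterSet_sides g i e).boundaryPoint_mem_iff.2 ⟨θ, he, by simp⟩⟩)

theorem exists_isGoodSet (x : StandardSurface g) : ∃ U, IsGoodSet g U ∧ x ∈ U := by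
  obtain ⟨z, rfl⟩ := proj_surjective g x
  rcases exists_mem_piece (g := g) z with h | h | ⟨i, e, h⟩
  · exact ⟨_, isGoodSet_interior g, h⟩
  · exact ⟨_, isGoodSet_vertices, h⟩
  · exact ⟨_, isGoodSet_sides i e, h⟩

/-- A Lebesgue subdivision cuts the loop into pieces inside good sets. Along these the property that
the initial part, closed up through the polygon, is a word in the sides propagates to the end. -/
theorem sideSubgroup_eq_top : sideSubgroup g = ⊤ := by
  rw [Subgroup.eq_top_iff']
  intro c
  obtain ⟨γ, rfl⟩ := Path.Homotopic.Quotient.mk_surjective c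
  choose U hU hmem using exists_isGoodSet (g := g)
  obtain ⟨t, ht0, hmono, ⟨N, hN⟩, ht⟩ := exists_monotone_Icc_subset_open_cover_unitInterval
    (c := fun x => γ ⁻¹' U x) (fun x => (hU x).1.preimage γ.continuous)
    (fun s _ => Set.mem_iUnion.2 ⟨γ s, hmem _⟩)
  let K : C(I, StandardSurface g) := γ.toContinuousMap
  have h0 : base g = K 0 := γ.source.symm
  -- The claim is made for every representative z of the subdivision point: consecutive good sets
  -- may use different points of the polygon over it.
  have claim : ∀ (n : ℕ) (z : PolygonDisk) (hz : K (t n) = proj g z),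
      IsSideLoop g (closeUp (through K 0 (t n) h0 rfl) z hz) := by
    intro n
    induction n with
    | zero =>
      -- The end point is generalized because `t 0 = 0` is only an equation. A representative of the
      -- base point other than the vertex 0 is reached by the constant path, which lies in the
      -- vertex piece.
      have aux (x : StandardSurface g) (hx : base g = x) (z : PolygonDisk) (hz : x = proj g z)
          (c : Path.Homotopic.Quotient (base g) x)
          (hc : c = (Path.Homotopic.Quotient.refl (base g)).cast rfl hx.symm) :
          IsSideLoop g (closeUp c z hz) := by
        subst hx hc
        have h1 := isGoodSet_vertices.2 (Path.refl (base g)) ?_ (Path.Homotopic.Quotient.refl _)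
          (boundaryPoint g 0) z (base_eq_proj g) hz ?_
        · rw [Path.Homotopic.Quotient.mk_refl, Path.Homotopic.Quotient.refl_trans] at h1
          rwa [Path.Homotopic.Quotient.cast_rfl_rfl]
        · intro _
          exact (isCenterSet_vertices g).boundaryPoint_mem_iff.2 ⟨_, ⟨0, rfl⟩, by simp⟩
        · rw [closeUp, diskClass_refl, Path.Homotopic.Quotient.refl_trans]
          exact isSideLoop_refl
      intro z hz
      refine aux _ (by rw [ht0]; exact h0) z hz _ ?_
      have : ∀ s (hs : s = 0), through K 0 s h0 rfl =
          (Path.Homotopic.Quotient.refl (base g)).cast rfl ((congrArg K hs).trans h0.symm) := by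
        rintro _ rfl
        exact through_eq_mk K h0 rfl (Path.refl 0) ((Path.refl (base g)).cast rfl h0.symm)
          fun _ => h0
      exact this _ ht0
    | succ n ih =>
      intro z hz
      obtain ⟨w, hw⟩ := proj_surjective g (K (t n))
      obtain ⟨x, hx⟩ := ht n
      have := (hU x).2 (γ.subpath (t n) (t (n + 1))) ?_ _ w z hw.symm hz (ih w hw.symm)
      · rw [← through_eq_mk K rfl rfl ⟨⟨Set.Icc.convexComb (t n) (t (n + 1)), by fun_prop⟩,
          by simp, by simp⟩ (γ.subpath (t n) (t (n + 1))) (fun _ => rfl), through_trans] at this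
        exact this
      · intro s
        have hs : γ.subpath (t n) (t (n + 1)) s ∈ γ '' Set.Icc (t n) (t (n + 1)) := by
          rw [← Path.range_subpath_of_le _ _ _ (hmono (Nat.le_succ n))]; exact ⟨s, rfl⟩
        obtain ⟨r, hr, e⟩ := hs
        rw [← e]
        exact hx hr
  have aux (s : I) (hs : s = 1) (h : K s = proj g (boundaryPoint g 0))
      (hc : IsSideLoop g (closeUp (through K 0 s h0 rfl) (boundaryPoint g 0) h)) :
      IsSideLoop g (Path.Homotopic.Quotient.mk γ) := by
    subst hs
    have e1 : (through K 0 1 h0 rfl) = (Path.Homotopic.Quotient.mk γ).cast rfl γ.target :=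
      through_eq_mk K h0 rfl ⟨ContinuousMap.id I, rfl, rfl⟩ (γ.cast rfl γ.target) fun _ => rfl
    have aux2 (y : StandardSurface g) (hy : y = base g) (h : y = proj g (boundaryPoint g 0))
        (hc : IsSideLoop g (closeUp ((Path.Homotopic.Quotient.mk γ).cast rfl hy)
          (boundaryPoint g 0) h)) : IsSideLoop g (Path.Homotopic.Quotient.mk γ) := by
      subst hy
      rwa [closeUp, diskClass_refl, Path.Homotopic.Quotient.trans_refl,
        Path.Homotopic.Quotient.cast_rfl_rfl] at hc
    rw [e1] at hc
    exact aux2 _ _ _ hc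
  exact aux (t N) (hN N le_rfl) _ (claim N (boundaryPoint g 0)
    (by rw [hN N le_rfl]; exact γ.target))

end StandardSurface

/-! ### The normal covering of the surface associated with a tuple of group elements -/

section Corner

variable {g : ℕ} {G : Type u} [Group G] (x y : Fin g → G)

/-- The holonomy from the vertex `0` of the polygon to the vertex `4i + j`. -/
def cornerLabel (i : Fin g) (j : Fin 4) : G :=
  commutatorPrefix x y i * ![1, x i, x i * y i, x i * y i * (x i)⁻¹] j

/-- The holonomy across the sides `4i` and `4i + 2`. -/
def sideLabelA (i : Fin g) : G := cornerLabel x y i 0 * (cornerLabel x y i 3)⁻¹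

/-- The holonomy across the sides `4i + 1` and `4i + 3`. -/
def sideLabelB (i : Fin g) : G := cornerLabel x y i 2 * (cornerLabel x y i 3)⁻¹

theorem sideLabelA_mul_three (i : Fin g) :
    sideLabelA x y i * cornerLabel x y i 3 = cornerLabel x y i 0 := by simp [sideLabelA]

/-- A side label is defined so that the corner labels match at one end of the side. The match at the
other end is what the word x y x⁻¹ y⁻¹ provides. -/
theorem sideLabelA_mul_two (i : Fin g) :
    sideLabelA x y i * cornerLabel x y i 2 = cornerLabel x y i 1 := by
  simp [sideLabelA, cornerLabel]
  group

theorem sideLabelB_mul_three (i : Fin g) :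
    sideLabelB x y i * cornerLabel x y i 3 = cornerLabel x y i 2 := by simp [sideLabelB]

/-- The far corner of the fourth side is the first corner of the next handle, so here the completed
commutator enters. -/
theorem sideLabelB_mul_four (i : Fin g) :
    sideLabelB x y i * commutatorPrefix x y (i + 1) = cornerLabel x y i 1 := by
  rw [commutatorPrefix_succ, commutatorElement_def]
  simp [sideLabelB, cornerLabel]
  group

theorem cornerLabel_zero (i : Fin g) : cornerLabel x y i 0 = commutatorPrefix x y i := by
  simp [cornerLabel]

end Corner

/-- The gluing of the copies of the polygon indexed by `G`. -/
inductive CoverGluing {g : ℕ} {G : Type u} [Group G] (x y : Fin g → G) :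
    (_ : G) × PolygonDisk → (_ : G) × PolygonDisk → Prop
  | a (i : Fin g) (t : ℝ) (ht : t ∈ Set.Icc (0 : ℝ) 1) (h : G) :
      CoverGluing x y ⟨h, boundaryPoint g (4 * (i : ℕ) + t)⟩
        ⟨h * sideLabelA x y i, boundaryPoint g (4 * (i : ℕ) + 3 - t)⟩
  | b (i : Fin g) (t : ℝ) (ht : t ∈ Set.Icc (0 : ℝ) 1) (h : G) :
      CoverGluing x y ⟨h, boundaryPoint g (4 * (i : ℕ) + 1 + t)⟩
        ⟨h * sideLabelB x y i, boundaryPoint g (4 * (i : ℕ) + 4 - t)⟩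

/-- The total space of the normal covering associated with `x`, `y`. -/
abbrev SurfaceCover {g : ℕ} {G : Type u} [Group G] (x y : Fin g → G) : Type u :=
  Quot (CoverGluing x y)

namespace SurfaceCover

open StandardSurface

variable {g : ℕ} {G : Type u} [Group G] {x y : Fin g → G}

variable (x y) in
/-- The copy of the polygon with index `h`. -/
def sheet (h : G) : C(PolygonDisk, SurfaceCover x y) :=
  ⟨fun z => Quot.mk _ ⟨h, z⟩, continuous_quot_mk.comp continuous_sigmaMk⟩

theorem exists_sheet (e : SurfaceCover x y) : ∃ h z, e = sheet x y h z := by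
  obtain ⟨⟨h, z⟩, rfl⟩ := Quot.exists_rep e
  exact ⟨h, z, rfl⟩

theorem sheet_a (i : Fin g) {t : ℝ} (ht : t ∈ Set.Icc (0 : ℝ) 1) (h : G) :
    sheet x y h (boundaryPoint g (4 * (i : ℕ) + t)) =
      sheet x y (h * sideLabelA x y i) (boundaryPoint g (4 * (i : ℕ) + 3 - t)) :=
  Quot.sound (.a i t ht h)

theorem sheet_b (i : Fin g) {t : ℝ} (ht : t ∈ Set.Icc (0 : ℝ) 1) (h : G) :
    sheet x y h (boundaryPoint g (4 * (i : ℕ) + 1 + t)) =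
      sheet x y (h * sideLabelB x y i) (boundaryPoint g (4 * (i : ℕ) + 4 - t)) :=
  Quot.sound (.b i t ht h)

theorem _root_.CoverGluing.mul_left {p p' : (_ : G) × PolygonDisk} (hp : CoverGluing x y p p')
    (k : G) : CoverGluing x y ⟨k * p.1, p.2⟩ ⟨k * p'.1, p'.2⟩ := by
  cases hp with
  | a i t ht h => simpa only [mul_assoc] using CoverGluing.a (x := x) (y := y) i t ht (k * h)
  | b i t ht h => simpa only [mul_assoc] using CoverGluing.b (x := x) (y := y) i t ht (k * h)

theorem _root_.CoverGluing.sideGluing {p p' : (_ : G) × PolygonDisk}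
    (hp : CoverGluing x y p p') : SideGluing g p.2 p'.2 := by
  cases hp with
  | a i t ht h => exact .a i t ht
  | b i t ht h => exact .b i t ht

instance : MulAction G (SurfaceCover x y) where
  smul k := Quot.map (fun p => ⟨k * p.1, p.2⟩) fun _ _ hp => hp.mul_left k
  one_smul e := by
    obtain ⟨⟨h, z⟩, rfl⟩ := Quot.exists_rep e
    exact congrArg (Quot.mk _) (Sigma.ext (one_mul h) HEq.rfl)
  mul_smul k k' e := by
    obtain ⟨⟨h, z⟩, rfl⟩ := Quot.exists_rep e
    exact congrArg (Quot.mk _) (Sigma.ext (mul_assoc k k' h) HEq.rfl)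

theorem smul_sheet (k h : G) (z : PolygonDisk) : k • sheet x y h z = sheet x y (k * h) z := rfl

instance : ContinuousConstSMul G (SurfaceCover x y) where
  continuous_const_smul k := continuous_quot_lift _ (continuous_quot_mk.comp
    (continuous_sigma fun h => continuous_sigmaMk (σ := fun _ : G => PolygonDisk) (i := k * h)))

variable (x y) in
/-- The covering map. -/
noncomputable def toSurface : C(SurfaceCover x y, StandardSurface g) where
  toFun := Quot.lift (fun p => proj g p.2) fun _ _ hp => Quot.sound hp.sideGluing
  continuous_toFun := continuous_quot_lift _ (continuous_sigma fun _ => (proj g).continuous)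

theorem isQuotientMap_toSurface : Topology.IsQuotientMap (toSurface x y) :=
  Topology.IsQuotientMap.of_comp (f := sheet x y 1) (sheet x y 1).continuous
    (toSurface x y).continuous (isQuotientMap_proj g)

/-- Every gluing multiplies the index on the right by an element independent of the sheet, and so
does a chain of gluings. Left translation therefore acts transitively on fibers. -/
theorem exists_sheet_eq {z z' : PolygonDisk} (h : proj g z = proj g z') :
    ∃ k : G, ∀ h, sheet x y h z = sheet x y (h * k) z' := by
  induction Quot.eqvGen_exact h with
  | rel z z' hz =>
    cases hz with
    | a i t ht => exact ⟨_, fun h => sheet_a i ht h⟩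
    | b i t ht => exact ⟨_, fun h => sheet_b i ht h⟩
  | refl z => exact ⟨1, fun h => by rw [mul_one]⟩
  | symm z z' _ ih =>
    obtain ⟨k, hk⟩ := ih (Quot.eqvGen_sound ‹_›)
    exact ⟨k⁻¹, fun h => by rw [hk, inv_mul_cancel_right]⟩
  | trans z z' z'' _ _ ih ih' =>
    obtain ⟨k, hk⟩ := ih (Quot.eqvGen_sound ‹_›)
    obtain ⟨k', hk'⟩ := ih' (Quot.eqvGen_sound ‹_›)
    exact ⟨k * k', fun h => by rw [hk, hk', mul_assoc]⟩

theorem toSurface_eq_iff {e e' : SurfaceCover x y} :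
    toSurface x y e = toSurface x y e' ↔ e ∈ MulAction.orbit G e' := by
  obtain ⟨h, z, rfl⟩ := exists_sheet e
  obtain ⟨h', z', rfl⟩ := exists_sheet e'
  constructor
  · intro he
    obtain ⟨k, hk⟩ := exists_sheet_eq (x := x) (y := y) he
    exact ⟨h * k * h'⁻¹, by simp only [smul_sheet, inv_mul_cancel_right, hk]⟩
  · rintro ⟨k, hk⟩
    rw [← hk]
    rfl

variable (x y) in
/-- A locally constant trivialization of the gluing data over a saturated open set. -/
structure IsLabelling (W : Set PolygonDisk) (l : PolygonDisk → G) : Prop where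
  isOpen_fiber : ∀ c, IsOpen {z | z ∈ W ∧ l z = c}
  saturated : ∀ z z', SideGluing g z z' → (z ∈ W ↔ z' ∈ W)
  side_a : ∀ (i : Fin g) (t : ℝ), t ∈ Set.Icc (0 : ℝ) 1 → boundaryPoint g (4 * (i : ℕ) + t) ∈ W →
    l (boundaryPoint g (4 * (i : ℕ) + t)) =
      sideLabelA x y i * l (boundaryPoint g (4 * (i : ℕ) + 3 - t))
  side_b : ∀ (i : Fin g) (t : ℝ), t ∈ Set.Icc (0 : ℝ) 1 →
    boundaryPoint g (4 * (i : ℕ) + 1 + t) ∈ W →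
    l (boundaryPoint g (4 * (i : ℕ) + 1 + t)) =
      sideLabelB x y i * l (boundaryPoint g (4 * (i : ℕ) + 4 - t))

/-- The product of the sheet index and the label is invariant under the gluing, so over W its level
sets are open and separate the sheets. Left translation by k multiplies the invariant by k. -/
theorem IsLabelling.exists_disjoint {W : Set PolygonDisk} {l : PolygonDisk → G}
    (hl : IsLabelling x y W l) (h : G) {z : PolygonDisk} (hz : z ∈ W) :
    ∃ U ∈ nhds (sheet x y h z), ∀ k : G, ((k • ·) '' U ∩ U).Nonempty → k = 1 := by
  have inv (p p' : (_ : G) × PolygonDisk) (hp : CoverGluing x y p p') :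
      (p.2 ∈ W ∧ p.1 * l p.2 = h * l z) = (p'.2 ∈ W ∧ p'.1 * l p'.2 = h * l z) := by
    rw [hl.saturated _ _ hp.sideGluing]
    refine propext (and_congr_right fun hW => ?_)
    cases hp with
    | a i t ht h' =>
      rw [hl.side_a i t ht ((hl.saturated _ _ (.a i t ht)).2 hW), mul_assoc]
    | b i t ht h' =>
      rw [hl.side_b i t ht ((hl.saturated _ _ (.b i t ht)).2 hW), mul_assoc]
  let U : Set (SurfaceCover x y) := {e | Quot.lift _ inv e}
  have hU : IsOpen U := by
    rw [← isQuotientMap_quot_mk.isOpen_preimage, isOpen_sigma_iff]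
    intro h'
    have := hl.isOpen_fiber (h'⁻¹ * (h * l z))
    convert! this using 1
    ext z'
    exact and_congr_right fun _ => (eq_inv_mul_iff_mul_eq).symm
  refine ⟨U, hU.mem_nhds ⟨hz, rfl⟩, ?_⟩
  rintro k ⟨_, ⟨e, he, rfl⟩, he'⟩
  obtain ⟨h', z', rfl⟩ := exists_sheet e
  have h1 : h' * l z' = h * l z := he.2
  have h2 : k * h' * l z' = h * l z := he'.2
  rw [mul_assoc, h1] at h2
  exact mul_eq_right.1 h2

variable (x y) in
theorem isLabelling_interior : IsLabelling x y {z | ‖(z : ℂ)‖ < 1} fun _ => 1 where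
  isOpen_fiber c := (isOpen_lt (by fun_prop) continuous_const).inter isOpen_const
  saturated := (isContraction_interior g).saturated
  side_a i t _ h := by simp [norm_boundaryPoint] at h
  side_b i t _ h := by simp [norm_boundaryPoint] at h

variable [NeZero g]

open Classical in
/-- The function on the sectors with the values `L κ` on the sector with center `κ`. -/
noncomputable def sectorLabel (g : ℕ) (K : Set ℝ) (L : ℝ → G) (z : PolygonDisk) : G :=
  if h : ∃ κ ∈ K, z ∈ sector g κ then L h.choose else 1

theorem sectorLabel_eq {K : Set ℝ} (hK : IsCenterSet g K) {L : ℝ → G}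
    (hL : ∀ κ ∈ K, ∀ m : ℤ, L (κ + 4 * g * m) = L κ) {κ : ℝ} (hκ : κ ∈ K) {z : PolygonDisk}
    (hz : z ∈ sector g κ) : sectorLabel g K L z = L κ := by
  have h : ∃ κ ∈ K, z ∈ sector g κ := ⟨κ, hκ, hz⟩
  rw [sectorLabel, dif_pos h]
  obtain ⟨m, hm⟩ := hK.eq_add_of_mem h.choose_spec.1 hκ h.choose_spec.2 hz
  rw [hm, hL κ hκ]

theorem isLabelling_sectors {K : Set ℝ} (hK : IsCenterSet g K) {L : ℝ → G}
    (hL : ∀ κ ∈ K, ∀ m : ℤ, L (κ + 4 * g * m) = L κ)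
    (hA : ∀ i : Fin g, ∀ κ ∈ K, κ ∈ Set.Icc (4 * (i : ℕ) : ℝ) (4 * (i : ℕ) + 1) →
      L κ = sideLabelA x y i * L (8 * (i : ℕ) + 3 - κ))
    (hB : ∀ i : Fin g, ∀ κ ∈ K, κ ∈ Set.Icc (4 * (i : ℕ) + 1 : ℝ) (4 * (i : ℕ) + 2) →
      L κ = sideLabelB x y i * L (8 * (i : ℕ) + 5 - κ)) :
    IsLabelling x y (sectors g K) (sectorLabel g K L) where
  isOpen_fiber c := by
    have : {z | z ∈ sectors g K ∧ sectorLabel g K L z = c} =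
        ⋃ κ ∈ K, ⋃ _ : L κ = c, sector g κ := by
      ext z
      simp only [Set.mem_ofPred_eq, Set.mem_iUnion, exists_prop]
      constructor
      · rintro ⟨⟨κ, hκ, hz⟩, h⟩
        exact ⟨κ, hκ, (sectorLabel_eq hK hL hκ hz).symm.trans h, hz⟩
      · rintro ⟨κ, hκ, h, hz⟩
        exact ⟨⟨κ, hκ, hz⟩, (sectorLabel_eq hK hL hκ hz).trans h⟩
    rw [this]
    exact isOpen_biUnion fun κ _ => isOpen_iUnion fun _ => isOpen_sector g κ
  saturated z z' h := hK.saturated h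
  side_a i t ht hz := by
    obtain ⟨κ, hκ, h, h1, h2⟩ := hK.gluing_a i ht (.inl hz)
    rw [sectorLabel_eq hK hL hκ (boundaryPoint_mem_sector g h),
      sectorLabel_eq hK hL h2 (boundaryPoint_mem_sector g ?_), hA i κ hκ h1]
    rw [abs_lt] at h ⊢; constructor <;> linarith
  side_b i t ht hz := by
    obtain ⟨κ, hκ, h, h1, h2⟩ := hK.gluing_b i ht (.inl hz)
    rw [sectorLabel_eq hK hL hκ (boundaryPoint_mem_sector g h),
      sectorLabel_eq hK hL h2 (boundaryPoint_mem_sector g ?_), hB i κ hκ h1]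
    rw [abs_lt] at h ⊢; constructor <;> linarith

variable (x y) in
/-- The holonomy from the vertex `0` to the vertex `k`. -/
noncomputable def vertexLabel (k : ℤ) : G :=
  cornerLabel x y (exists_int_decomposition g k).choose_spec.choose
    (exists_int_decomposition g k).choose_spec.choose_spec.choose

theorem vertexLabel_eq (i : Fin g) (j : Fin 4) (m : ℤ) :
    vertexLabel x y (4 * (i : ℕ) + (j : ℕ) + 4 * g * m) = cornerLabel x y i j := by
  set k : ℤ := 4 * (i : ℕ) + (j : ℕ) + 4 * g * m with hk
  have h := exists_int_decomposition g k
  have h' := h.choose_spec.choose_spec.choose_spec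
  rw [vertexLabel]
  generalize h.choose_spec.choose_spec.choose = j' at *
  generalize h.choose_spec.choose = i' at *
  generalize h.choose = m' at *
  have e1 : (4 * (i : ℕ) + (j : ℕ) : ℤ) % (4 * g) = k % (4 * g) := by
    rw [hk, Int.add_mul_emod_self_left]
  have e2 : (4 * (i' : ℕ) + (j' : ℕ) : ℤ) % (4 * g) = k % (4 * g) := by
    rw [h', Int.add_mul_emod_self_left]
  rw [Int.emod_eq_of_lt (by omega) (by omega)] at e1 e2
  have e3 : i' = i := by ext; omega
  have e4 : j' = j := by ext; omega
  rw [e3, e4]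

theorem vertexLabel_add (k m : ℤ) : vertexLabel x y (k + 4 * g * m) = vertexLabel x y k := by
  obtain ⟨m', i, j, rfl⟩ := exists_int_decomposition g k
  rw [vertexLabel_eq, add_assoc, ← mul_add, vertexLabel_eq]

/-- For the last handle this vertex is the vertex 0 with label 1, while the prefix is the whole
product of commutators. The relation is exactly what makes the labelling close up around the base
point. -/
theorem vertexLabel_four (hxy : commutatorProduct x y = 1) (i : Fin g) :
    vertexLabel x y (4 * (i : ℕ) + 4) = commutatorPrefix x y (i + 1) := by
  by_cases h : (i : ℕ) + 1 < g
  · have := vertexLabel_eq (x := x) (y := y) ⟨i + 1, h⟩ 0 0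
    rw [cornerLabel_zero] at this
    rw [← this]
    congr 1
  · have hi : (i : ℕ) + 1 = g := by omega
    have h0 := vertexLabel_eq (x := x) (y := y) ⟨0, NeZero.pos g⟩ 0 1
    rw [cornerLabel_zero, commutatorPrefix_zero] at h0
    rw [hi, commutatorPrefix_last, hxy, ← h0]
    congr 1
    have : (g : ℤ) = i + 1 := by omega
    rw [this]
    simp
    ring

theorem isLabelling_vertices (hxy : commutatorProduct x y = 1) :
    IsLabelling x y (sectors g (Set.range ((↑) : ℤ → ℝ)))
      (sectorLabel g (Set.range ((↑) : ℤ → ℝ)) fun κ => vertexLabel x y ⌊κ⌋) := by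
  have h0 (i : Fin g) (j : Fin 4) (k : ℤ) (hk : k = 4 * (i : ℕ) + (j : ℕ)) :
      vertexLabel x y k = cornerLabel x y i j := by
    rw [← vertexLabel_eq i j 0, hk, mul_zero, add_zero]
  refine isLabelling_sectors (isCenterSet_vertices g) ?_ ?_ ?_
  · rintro _ ⟨k, rfl⟩ m
    have : (k : ℝ) + 4 * g * m = ((k + 4 * g * m : ℤ) : ℝ) := by push_cast; ring
    simp only [this, Int.floor_intCast, vertexLabel_add]
  · rintro i _ ⟨k, rfl⟩ ⟨h1, h2⟩
    have h1' : (4 * (i : ℕ) : ℤ) ≤ k := by exact_mod_cast h1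
    have h2' : k ≤ 4 * (i : ℕ) + 1 := by exact_mod_cast h2
    have : (8 * (i : ℕ) + 3 : ℝ) - k = ((8 * (i : ℕ) + 3 - k : ℤ) : ℝ) := by push_cast; ring
    simp only [this, Int.floor_intCast]
    have hk : k = 4 * (i : ℕ) ∨ k = 4 * (i : ℕ) + 1 := by omega
    rcases hk with rfl | rfl
    · rw [h0 i 0 _ (by simp), h0 i 3 _ (by simp; ring), sideLabelA_mul_three]
    · rw [h0 i 1 _ (by simp), h0 i 2 _ (by simp; ring), sideLabelA_mul_two]
  · rintro i _ ⟨k, rfl⟩ ⟨h1, h2⟩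
    have h1' : (4 * (i : ℕ) + 1 : ℤ) ≤ k := by exact_mod_cast h1
    have h2' : k ≤ 4 * (i : ℕ) + 2 := by exact_mod_cast h2
    have : (8 * (i : ℕ) + 5 : ℝ) - k = ((8 * (i : ℕ) + 5 - k : ℤ) : ℝ) := by push_cast; ring
    simp only [this, Int.floor_intCast]
    have hk : k = 4 * (i : ℕ) + 1 ∨ k = 4 * (i : ℕ) + 2 := by omega
    rcases hk with rfl | rfl
    · rw [show (8 * (i : ℕ) + 5 - (4 * (i : ℕ) + 1) : ℤ) = 4 * (i : ℕ) + 4 by ring,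
        h0 i 1 _ (by simp), vertexLabel_four hxy, sideLabelB_mul_four]
    · rw [h0 i 2 _ (by simp), h0 i 3 _ (by simp; ring), sideLabelB_mul_three]

-- Near the interior of a side there is just one crossing condition: the sectors of the first copy
-- carry the side label, those of the partner carry 1. No relation is needed.
open Classical in
variable (x y) in
theorem isLabelling_sides (i : Fin g) (e : Fin 2) :
    IsLabelling x y (sectors g (sideCenters g i e)) (sectorLabel g (sideCenters g i e) fun κ =>
      if ∃ m : ℤ, κ = 4 * (i : ℕ) + (e : ℕ) + 1 / 2 + 4 * g * m then
        (if e = 0 then sideLabelA x y i else sideLabelB x y i) else 1) := by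
  -- The two families of centers differ by 2 modulo 4g, so equality would make 1 an even number.
  have hneg (m : ℤ) : ¬ ∃ m' : ℤ, (4 * (i : ℕ) + (e : ℕ) + 5 / 2 + 4 * g * m : ℝ) =
      4 * (i : ℕ) + (e : ℕ) + 1 / 2 + 4 * g * m' := by
    rintro ⟨m', h⟩
    have : (1 : ℝ) = 2 * (g * (m' - m)) := by linarith
    have : (1 : ℤ) = 2 * (g * (m' - m)) := by exact_mod_cast this
    omega
  have hloc (κ : ℝ) (hκ : κ ∈ sideCenters g i e) (j : Fin g) (h1 : 4 * ((j : ℕ) : ℝ) - 1 / 2 < κ)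
      (h2 : κ < 4 * ((j : ℕ) : ℝ) + 9 / 2) :
      i = j ∧ (κ = 4 * (j : ℕ) + (e : ℕ) + 1 / 2 ∨ κ = 4 * (j : ℕ) + (e : ℕ) + 5 / 2) := by
    obtain ⟨m, hm, h⟩ := sideCenters_local g hκ j h1 h2
    refine ⟨?_, h⟩
    have hm' : (4 * (i : ℕ) + 4 * g * m : ℤ) = 4 * (j : ℕ) := by exact_mod_cast hm
    have e1 : (4 * (i : ℕ) : ℤ) % (4 * g) = (4 * (j : ℕ) : ℤ) % (4 * g) := by
      rw [← hm', Int.add_mul_emod_self_left]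
    rw [Int.emod_eq_of_lt (by omega) (by omega), Int.emod_eq_of_lt (by omega) (by omega)] at e1
    ext; omega
  refine isLabelling_sectors (isCenterSet_sides g i e) ?_ ?_ ?_
  · intro κ hκ m
    congr 1
    refine propext ⟨?_, ?_⟩
    · rintro ⟨m', h⟩; exact ⟨m' - m, by push_cast; linarith⟩
    · rintro ⟨m', h⟩; exact ⟨m' + m, by push_cast; linarith⟩
  · rintro j κ hκ ⟨h1, h2⟩
    obtain ⟨rfl, h⟩ := hloc κ hκ j (by linarith) (by linarith)
    have he : e = 0 ∧ κ = 4 * (i : ℕ) + 1 / 2 := by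
      fin_cases e <;> rcases h with h | h <;> simp at h ⊢ <;> first | exact h | linarith
    obtain ⟨rfl, rfl⟩ := he
    rw [if_pos ⟨0, by simp⟩, if_pos rfl, if_neg, mul_one]
    convert! hneg 0 using 4
    simp
    ring
  · rintro j κ hκ ⟨h1, h2⟩
    obtain ⟨rfl, h⟩ := hloc κ hκ j (by linarith) (by linarith)
    have he : e = 1 ∧ κ = 4 * (i : ℕ) + 1 + 1 / 2 := by
      fin_cases e <;> rcases h with h | h <;> simp at h ⊢ <;> first | exact h | linarith
    obtain ⟨rfl, rfl⟩ := he
    rw [if_pos ⟨0, by simp⟩, if_neg one_ne_zero, if_neg, mul_one]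
    convert! hneg 0 using 4
    simp
    ring

/-- Every point lies over a piece with a labelling, so translates of small neighborhoods are
disjoint. The relation matters only over the vertex. -/
theorem isQuotientCoveringMap_toSurface (hxy : commutatorProduct x y = 1) :
    IsQuotientCoveringMap (toSurface x y) G where
  toIsQuotientMap := isQuotientMap_toSurface
  continuous_const_smul := continuous_const_smul
  apply_eq_iff_mem_orbit := toSurface_eq_iff
  disjoint e := by
    obtain ⟨h, z, rfl⟩ := exists_sheet e
    rcases exists_mem_piece (g := g) z with h1 | h1 | ⟨i, e, h1⟩
    · exact (isLabelling_interior x y).exists_disjoint h h1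
    · exact (isLabelling_vertices hxy).exists_disjoint h h1
    · exact (isLabelling_sides x y i e).exists_disjoint h h1

end SurfaceCover

/-! ### Monodromy of the covering and the presentation of the fundamental group -/

theorem map_commutatorProduct {G : Type u} {H : Type v} [Group G] [Group H] {g : ℕ} (f : G →* H)
    (x y : Fin g → G) :
    f (commutatorProduct x y) = commutatorProduct (fun i => f (x i)) (fun i => f (y i)) := by
  simp only [commutatorProduct, map_list_prod, List.map_ofFn]
  congr 2
  ext i
  simp [map_commutatorElement]

namespace SurfaceCover

open StandardSurface

variable {g : ℕ} [NeZero g] {G : Type u} [Group G] {x y : Fin g → G}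

variable (x y) in
/-- The base point of the covering. -/
noncomputable def origin : SurfaceCover x y := sheet x y 1 (boundaryPoint g 0)

-- The gluings connect the corners of a handle in the order 0, 3, 2, 1, 4, which is the order around
-- the vertex. Following them carries one identification with `origin` through the handle to the
-- next one.
omit [NeZero g] in
theorem sheet_vertices (i : Fin g)
    (h : sheet x y (commutatorPrefix x y i)⁻¹ (boundaryPoint g (4 * (i : ℕ))) = origin x y) :
    (∀ j : Fin 4, sheet x y (cornerLabel x y i j)⁻¹ (boundaryPoint g (4 * (i : ℕ) + (j : ℕ))) =
      origin x y) ∧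
    sheet x y (commutatorPrefix x y (i + 1))⁻¹ (boundaryPoint g (4 * (i + 1 : ℕ))) =
      origin x y := by
  have h0 : sheet x y (cornerLabel x y i 0)⁻¹ (boundaryPoint g (4 * (i : ℕ))) = origin x y := by
    rwa [cornerLabel_zero]
  have h3 : sheet x y (cornerLabel x y i 3)⁻¹ (boundaryPoint g (4 * (i : ℕ) + 3)) =
      origin x y := by
    have := sheet_a (x := x) (y := y) i (t := 0) (by simp) (cornerLabel x y i 0)⁻¹
    rw [add_zero, h0, sub_zero, ← sideLabelA_mul_three, mul_inv_rev, inv_mul_cancel_right] at this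
    exact this.symm
  have h2 : sheet x y (cornerLabel x y i 2)⁻¹ (boundaryPoint g (4 * (i : ℕ) + 2)) =
      origin x y := by
    have := sheet_b (x := x) (y := y) i (t := 1) (by simp) (cornerLabel x y i 2)⁻¹
    rw [show (4 * (i : ℕ) + 4 - 1 : ℝ) = 4 * (i : ℕ) + 3 by ring,
      show (4 * (i : ℕ) + 1 + 1 : ℝ) = 4 * (i : ℕ) + 2 by ring, ← sideLabelB_mul_three,
      mul_inv_rev, inv_mul_cancel_right, h3, ← mul_inv_rev, sideLabelB_mul_three] at this
    exact this
  have h1 : sheet x y (cornerLabel x y i 1)⁻¹ (boundaryPoint g (4 * (i : ℕ) + 1)) =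
      origin x y := by
    have := sheet_a (x := x) (y := y) i (t := 1) (by simp) (cornerLabel x y i 1)⁻¹
    rw [show (4 * (i : ℕ) + 3 - 1 : ℝ) = 4 * (i : ℕ) + 2 by ring, ← sideLabelA_mul_two,
      mul_inv_rev, inv_mul_cancel_right, h2, ← mul_inv_rev, sideLabelA_mul_two] at this
    exact this
  refine ⟨fun j => ?_, ?_⟩
  · fin_cases j
    · simpa using h0
    · simpa using h1
    · simpa using h2
    · simpa using h3
  · have := sheet_b (x := x) (y := y) i (t := 0) (by simp) (cornerLabel x y i 1)⁻¹
    rw [add_zero, sub_zero, h1, ← sideLabelB_mul_four, mul_inv_rev, inv_mul_cancel_right] at this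
    rw [this]
    congr 2
    push_cast; ring

omit [NeZero g] in
theorem sheet_vertex (i : Fin g) (j : Fin 4) :
    sheet x y (cornerLabel x y i j)⁻¹ (boundaryPoint g (4 * (i : ℕ) + (j : ℕ))) = origin x y := by
  have key (k : ℕ) (hk : k < g) :
      sheet x y (commutatorPrefix x y k)⁻¹ (boundaryPoint g (4 * (k : ℕ))) = origin x y := by
    induction k with
    | zero => simp [origin]
    | succ k ih => exact (sheet_vertices ⟨k, by omega⟩ (ih (by omega))).2
  exact (sheet_vertices i (key i i.2)).1 j

omit [NeZero g] in
variable (x y) in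
theorem toSurface_origin : toSurface x y (origin x y) = base g := rfl

variable (hxy : commutatorProduct x y = 1)

/-- The holonomy homomorphism. -/
noncomputable def holonomy : FundamentalGroup (StandardSurface g) (base g) →* G :=
  (MulEquiv.inv' G).symm.toMonoidHom.comp
    ((isQuotientCoveringMap_toSurface hxy).fundamentalGroupToMulOpposite
      ⟨origin x y, toSurface_origin x y⟩)

/-- Monodromy gives the opposite element of k, and the identification of the opposite group with G
is inversion; hence the inverse. -/
theorem holonomy_eq_of_path {γ : Path (base g) (base g)} {k : G}
    (Γ : Path (origin x y) (k • origin x y)) (h : ∀ t, toSurface x y (Γ t) = γ t) :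
    holonomy hxy (FundamentalGroup.fromPath (Path.Homotopic.Quotient.mk γ)) = k⁻¹ := by
  have hp := isQuotientCoveringMap_toSurface hxy
  have hk : toSurface x y (k • origin x y) = base g := hp.map_smul k
  have := hp.isCoveringMap.monodromy_eq_of_map_eq
    (ex := ⟨origin x y, toSurface_origin x y⟩) (ey := ⟨k • origin x y, hk⟩)
    (γ := Path.Homotopic.Quotient.mk γ) (Path.Homotopic.Quotient.mk Γ)
    (congrArg Path.Homotopic.Quotient.mk (Path.ext (funext h)))
  have h2 : hp.fundamentalGroupToMulOpposite ⟨origin x y, toSurface_origin x y⟩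
      (FundamentalGroup.fromPath (Path.Homotopic.Quotient.mk γ)) = MulOpposite.op k := by
    rw [IsQuotientCoveringMap.fundamentalGroupToMulOpposite_apply_eq_Iff]
    exact (congrArg Subtype.val this).symm
  exact congrArg (MulEquiv.inv' G).symm h2

omit [NeZero g] in
theorem mul_inv_smul_sheet {c c' k : G} (h : c⁻¹ * c' = k) {z : PolygonDisk}
    (hz : sheet x y c'⁻¹ z = origin x y) : sheet x y c⁻¹ z = k • origin x y := by
  rw [← hz, smul_sheet, ← h, mul_inv_cancel_right]

variable (x y) in
/-- The lift of the loop `a_i`. -/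
noncomputable def liftA (i : Fin g) : Path (origin x y) (x i • origin x y) where
  toFun t := sheet x y (cornerLabel x y i 0)⁻¹ (boundaryPoint g (4 * (i : ℕ) + t))
  continuous_toFun := (sheet x y _).continuous.comp ((continuous_boundaryPoint g).comp
    (by fun_prop))
  source' := by simpa using sheet_vertex i 0
  target' := by
    refine mul_inv_smul_sheet (c' := cornerLabel x y i 1) ?_ (by simpa using sheet_vertex i 1)
    simp [cornerLabel]

variable (x y) in
/-- The lift of the loop `b_i`. -/
noncomputable def liftB (i : Fin g) : Path (origin x y) (y i • origin x y) where
  toFun t := sheet x y (cornerLabel x y i 1)⁻¹ (boundaryPoint g (4 * (i : ℕ) + 1 + t))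
  continuous_toFun := (sheet x y _).continuous.comp ((continuous_boundaryPoint g).comp
    (by fun_prop))
  source' := by simpa using sheet_vertex i 1
  target' := by
    refine mul_inv_smul_sheet (c' := cornerLabel x y i 2) ?_ ?_
    · simp [cornerLabel]
    · have := sheet_vertex (x := x) (y := y) i 2
      rw [← this, Set.Icc.coe_one]
      congr 2
      norm_num [add_assoc]

theorem holonomy_genA (i : Fin g) : holonomy hxy (genA g i) = (x i)⁻¹ :=
  holonomy_eq_of_path hxy (liftA x y i) fun _ => rfl

theorem holonomy_genB (i : Fin g) : holonomy hxy (genB g i) = (y i)⁻¹ :=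
  holonomy_eq_of_path hxy (liftB x y i) fun _ => rfl

/-- The holonomy is trivial precisely on loops whose lift closes up, and these are the images of
loops in the covering. -/
theorem ker_holonomy : (holonomy hxy).ker =
    (FundamentalGroup.mapOfEq (toSurface x y) (toSurface_origin x y)).range := by
  have hp := isQuotientCoveringMap_toSurface hxy
  refine Eq.trans ?_ (hp.ker_monodromyPerm ⟨origin x y, toSurface_origin x y⟩)
  rw [← hp.ker_fundamentalGroupToMulOpposite]
  ext c
  exact (MulEquiv.inv' G).symm.map_eq_one_iff

-- Lifts of the sides join `origin` to its translates by the x_i and y_i. Translating these paths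
-- reaches every sheet, and each sheet is connected.
omit [NeZero g] in
theorem pathConnectedSpace (hgen : Subgroup.closure (Set.range x ∪ Set.range y) = ⊤) :
    PathConnectedSpace (SurfaceCover x y) := by
  have h1 (k : G) : Joined (origin x y) (k • origin x y) := by
    have hk : k ∈ Subgroup.closure (Set.range x ∪ Set.range y) := hgen ▸ Subgroup.mem_top k
    have hs (k : G) {e e' : SurfaceCover x y} (h : Joined e e') : Joined (k • e) (k • e') :=
      h.map (continuous_const_smul k)
    induction hk using Subgroup.closure_induction with
    | mem k hk =>
      rcases hk with ⟨i, rfl⟩ | ⟨i, rfl⟩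
      · exact ⟨liftA x y i⟩
      · exact ⟨liftB x y i⟩
    | one => rw [one_smul]
    | mul k k' _ _ h h' => exact h.trans (by rw [mul_smul]; exact hs k h')
    | inv k _ h => simpa using (hs k⁻¹ h).symm
  have h2 (e : SurfaceCover x y) : Joined (origin x y) e := by
    obtain ⟨h, z, rfl⟩ := exists_sheet e
    refine (h1 h).trans ?_
    have := (PathConnectedSpace.joined (boundaryPoint g 0) z).map (sheet x y h).continuous
    rwa [origin, smul_sheet, mul_one]
  exact ⟨⟨origin x y⟩, fun e e' => (h2 e).symm.trans (h2 e')⟩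

end SurfaceCover

/-! ### The presentation of the surface group. -/

namespace StandardSurface

theorem isStandardGeneratingSystem_gen (g : ℕ) [NeZero g] :
    IsStandardGeneratingSystem (fun i => (genA g i)⁻¹) (fun i => (genB g i)⁻¹) where
  generates := by
    rw [eq_top_iff, ← sideSubgroup_eq_top, sideSubgroup, Subgroup.closure_le]
    rintro _ (⟨i, rfl⟩ | ⟨i, rfl⟩)
    · exact inv_mem_iff.1 (Subgroup.subset_closure (.inl ⟨i, rfl⟩))
    · exact inv_mem_iff.1 (Subgroup.subset_closure (.inr ⟨i, rfl⟩))
  relation := commutatorProduct_gen g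
  defining := by
    let r : FreeGroup (Fin g ⊕ Fin g) :=
      commutatorProduct (fun i : Fin g => FreeGroup.of (Sum.inl i))
        (fun i : Fin g => FreeGroup.of (Sum.inr i))
    change _ = Subgroup.normalClosure {r}
    apply le_antisymm
    · intro w hw
      -- The test group is F/N. The classes of the free generators satisfy the relation there, so
      -- they define a covering whose holonomy sends the inverse sides back to these classes. A word
      -- that is trivial in the fundamental group is thus trivial in F/N.
      let N := Subgroup.normalClosure {r}
      let x : Fin g → FreeGroup (Fin g ⊕ Fin g) ⧸ N :=
        fun i => QuotientGroup.mk' N (FreeGroup.of (Sum.inl i))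
      let y : Fin g → FreeGroup (Fin g ⊕ Fin g) ⧸ N :=
        fun i => QuotientGroup.mk' N (FreeGroup.of (Sum.inr i))
      have hxy : commutatorProduct x y = 1 := by
        rw [← map_commutatorProduct]
        exact (QuotientGroup.eq_one_iff _).2 (Subgroup.subset_normalClosure rfl)
      have : (SurfaceCover.holonomy hxy).comp (FreeGroup.lift
          (Sum.elim (fun i => (genA g i)⁻¹) (fun i => (genB g i)⁻¹))) = QuotientGroup.mk' N := by
        apply FreeGroup.ext_hom
        rintro (i | i)
        · rw [MonoidHom.comp_apply, FreeGroup.lift_apply_of, Sum.elim_inl, map_inv,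
            SurfaceCover.holonomy_genA, inv_inv]
        · rw [MonoidHom.comp_apply, FreeGroup.lift_apply_of, Sum.elim_inr, map_inv,
            SurfaceCover.holonomy_genB, inv_inv]
      have h := DFunLike.congr_fun this w
      rw [MonoidHom.comp_apply, MonoidHom.mem_ker.1 hw, map_one] at h
      exact (QuotientGroup.eq_one_iff _).1 h.symm
    · refine Subgroup.normalClosure_le_normal ?_
      rw [Set.singleton_subset_iff]
      refine MonoidHom.mem_ker.2 ((map_commutatorProduct _ _ _).trans ?_)
      simpa using commutatorProduct_gen g

end StandardSurface

/-! ### Chords of the polygon -/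

namespace StandardSurface

open scoped ComplexConjugate

/-- The point with relative height `v` on the chord from `boundaryPoint g (μ - δ)` to
`boundaryPoint g (μ + δ)`. -/
noncomputable def chord (g : ℕ) (μ δ v : ℝ) : PolygonDisk :=
  ⟨(boundaryPoint g μ : ℂ) * ⟨Real.cos (2 * Real.pi * δ / (4 * g)),
    (Set.projIcc (-1 : ℝ) 1 (neg_le_self zero_le_one) v : ℝ) * Real.sin (2 * Real.pi * δ / (4 * g))⟩, by
    rw [mem_closedBall_zero_iff, norm_mul, norm_boundaryPoint, one_mul]
    rw [← sq_le_one_iff₀ (norm_nonneg _), Complex.sq_norm, Complex.normSq_mk]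
    have h := (Set.projIcc (-1 : ℝ) 1 (neg_le_self zero_le_one) v).2
    have h2 := Real.sin_sq_add_cos_sq (2 * Real.pi * δ / (4 * g))
    have h3 : (Set.projIcc (-1 : ℝ) 1 (neg_le_self zero_le_one) v : ℝ) ^ 2 ≤ 1 :=
      (sq_le_one_iff_abs_le_one _).2 (abs_le.2 h)
    nlinarith [sq_nonneg (Real.sin (2 * Real.pi * δ / (4 * g)))]⟩

theorem chord_coe (g : ℕ) (μ δ : ℝ) {v : ℝ} (hv : v ∈ Set.Icc (-1 : ℝ) 1) :
    (chord g μ δ v : ℂ) = (boundaryPoint g μ : ℂ) *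
      ⟨Real.cos (2 * Real.pi * δ / (4 * g)), v * Real.sin (2 * Real.pi * δ / (4 * g))⟩ := by
  simp only [chord, Set.projIcc_of_mem _ hv]

theorem continuous_chord (g : ℕ) (μ : ℝ) : Continuous fun p : ℝ × ℝ => chord g μ p.1 p.2 := by
  refine Continuous.subtype_mk (continuous_const.mul ?_) _
  refine Complex.equivRealProdCLM.symm.continuous.comp (Continuous.prodMk (by fun_prop) ?_)
  exact (continuous_subtype_val.comp (continuous_projIcc.comp continuous_snd)).mul (by fun_prop)

theorem chord_one (g : ℕ) (μ δ : ℝ) : chord g μ δ 1 = boundaryPoint g (μ + δ) := by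
  apply Subtype.ext
  rw [chord_coe g μ δ (by norm_num)]
  have : (⟨Real.cos (2 * Real.pi * δ / (4 * g)), 1 * Real.sin (2 * Real.pi * δ / (4 * g))⟩ : ℂ) =
      Complex.exp ((2 * Real.pi * δ / (4 * g) : ℝ) * Complex.I) := by
    rw [Complex.exp_ofReal_mul_I]
    apply Complex.ext <;> simp [-Complex.ofReal_cos, -Complex.ofReal_sin]
  rw [this]
  simp only [boundaryPoint]
  rw [← Complex.exp_add]
  congr 1
  push_cast
  ring

theorem chord_neg_one (g : ℕ) (μ δ : ℝ) : chord g μ δ (-1) = boundaryPoint g (μ - δ) := by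
  rw [sub_eq_add_neg, ← chord_one]
  apply Subtype.ext
  rw [chord_coe g μ δ (by norm_num), chord_coe g μ _ (by norm_num)]
  congr 2
  · rw [← Real.cos_neg]; congr 1; ring
  · rw [neg_one_mul, one_mul, ← Real.sin_neg]; congr 1; ring

/-- The parameter `δ` of the chord with center `μ` through a point. -/
noncomputable def depth (g : ℕ) (μ : ℝ) (z : PolygonDisk) : ℝ :=
  Real.arccos ((z : ℂ) * conj (boundaryPoint g μ : ℂ)).re * (4 * g) / (2 * Real.pi)

/-- The relative height of a point on its chord with center `μ`. -/
noncomputable def height (g : ℕ) (μ : ℝ) (z : PolygonDisk) : ℝ :=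
  ((z : ℂ) * conj (boundaryPoint g μ : ℂ)).im / Real.sin (2 * Real.pi * depth g μ z / (4 * g))

theorem continuous_depth (g : ℕ) (μ : ℝ) : Continuous (depth g μ) := by
  unfold depth
  fun_prop

variable {g : ℕ} [NeZero g]

theorem angle_depth (μ : ℝ) (z : PolygonDisk) : 2 * Real.pi * depth g μ z / (4 * g) =
    Real.arccos ((z : ℂ) * conj (boundaryPoint g μ : ℂ)).re := by
  have := Real.pi_pos
  have hg : (g : ℝ) ≠ 0 := NeZero.ne _
  rw [depth]
  field_simp

theorem sin_pos_of_mem {δ : ℝ} (hδ : δ ∈ Set.Ioo (0 : ℝ) (2 * g)) :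
    0 < Real.sin (2 * Real.pi * δ / (4 * g)) := by
  have h1 := Real.pi_pos
  have h2 := four_mul_pos g
  apply Real.sin_pos_of_pos_of_lt_pi
  · have := hδ.1; positivity
  · rw [div_lt_iff₀ h2]; nlinarith [hδ.2]

theorem continuousOn_height (μ : ℝ) :
    ContinuousOn (height g μ) {z | depth g μ z ∈ Set.Ioo (0 : ℝ) (2 * g)} := by
  have := continuous_depth g μ
  refine ContinuousOn.div (Continuous.continuousOn (by fun_prop))
    (Continuous.continuousOn (by fun_prop)) fun z hz => (sin_pos_of_mem hz).ne'

omit [NeZero g] in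
theorem chord_mul_conj (μ δ : ℝ) {v : ℝ} (hv : v ∈ Set.Icc (-1 : ℝ) 1) :
    (chord g μ δ v : ℂ) * conj (boundaryPoint g μ : ℂ) =
      ⟨Real.cos (2 * Real.pi * δ / (4 * g)), v * Real.sin (2 * Real.pi * δ / (4 * g))⟩ := by
  rw [chord_coe g μ δ hv, mul_right_comm, boundaryPoint_mul_conj_self, one_mul]

theorem depth_chord (μ : ℝ) {δ : ℝ} (hδ : δ ∈ Set.Icc (0 : ℝ) (2 * g)) {v : ℝ}
    (hv : v ∈ Set.Icc (-1 : ℝ) 1) : depth g μ (chord g μ δ v) = δ := by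
  have h1 := Real.pi_pos
  have h2 := four_mul_pos g
  rw [depth, chord_mul_conj μ δ hv]
  dsimp only
  rw [Real.arccos_cos]
  · have hg : (g : ℝ) ≠ 0 := NeZero.ne _
    field_simp
  · have := hδ.1; positivity
  · rw [div_le_iff₀ h2]; nlinarith [hδ.2]

theorem height_chord (μ : ℝ) {δ : ℝ} (hδ : δ ∈ Set.Ioo (0 : ℝ) (2 * g)) {v : ℝ}
    (hv : v ∈ Set.Icc (-1 : ℝ) 1) : height g μ (chord g μ δ v) = v := by
  rw [height, depth_chord μ (Set.Ioo_subset_Icc_self hδ) hv, chord_mul_conj μ δ hv]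
  exact mul_div_cancel_right₀ _ (sin_pos_of_mem hδ).ne'

theorem height_mem {μ : ℝ} {z : PolygonDisk} (hz : depth g μ z ∈ Set.Ioo (0 : ℝ) (2 * g)) :
    height g μ z ∈ Set.Icc (-1 : ℝ) 1 := by
  have h0 := sin_pos_of_mem hz
  have hn : ‖(z : ℂ) * conj (boundaryPoint g μ : ℂ)‖ ≤ 1 := by
    rw [norm_mul, RCLike.norm_conj, norm_boundaryPoint, mul_one]; exact (norm_mem z).2
  rw [Set.mem_Icc, ← abs_le, height, abs_div, abs_of_pos h0, div_le_one h0, angle_depth, Real.sin_arccos]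
  apply Real.le_sqrt_of_sq_le
  rw [← sq_le_one_iff₀ (norm_nonneg _), Complex.sq_norm, Complex.normSq_apply] at hn
  rw [sq_abs]
  linarith

theorem chord_depth {μ : ℝ} {z : PolygonDisk} (hz : depth g μ z ∈ Set.Ioo (0 : ℝ) (2 * g)) :
    chord g μ (depth g μ z) (height g μ z) = z := by
  apply Subtype.ext
  rw [chord_coe _ _ _ (height_mem hz), height, div_mul_cancel₀ _ (sin_pos_of_mem hz).ne',
    angle_depth, Real.cos_arccos]
  · rw [Complex.eta, mul_comm (z : ℂ), ← mul_assoc, boundaryPoint_mul_conj_self, one_mul]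
  · have hn : ‖(z : ℂ) * conj (boundaryPoint g μ : ℂ)‖ ≤ 1 := by
      rw [norm_mul, RCLike.norm_conj, norm_boundaryPoint, mul_one]; exact (norm_mem z).2
    linarith [(abs_le.1 ((Complex.abs_re_le_norm _).trans hn)).1]
  · have hn : ‖(z : ℂ) * conj (boundaryPoint g μ : ℂ)‖ ≤ 1 := by
      rw [norm_mul, RCLike.norm_conj, norm_boundaryPoint, mul_one]; exact (norm_mem z).2
    linarith [(abs_le.1 ((Complex.abs_re_le_norm _).trans hn)).2]

/-- Rounding makes the parameter differ from μ by at most 2g, half the circle. There the depth is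
the absolute value of the difference, leaving the two ends μ ± δ of the chord. -/
theorem exists_depth_boundaryPoint (μ θ : ℝ) : ∃ m : ℤ,
    θ + 4 * g * m = μ + depth g μ (boundaryPoint g θ) ∨
      θ + 4 * g * m = μ - depth g μ (boundaryPoint g θ) := by
  have hg := four_mul_pos g
  have key (δ : ℝ) (hδ : |δ| ≤ 2 * g) : depth g μ (boundaryPoint g (μ + δ)) = |δ| := by
    rcases abs_cases δ with ⟨h, h'⟩ | ⟨h, h'⟩
    · rw [← chord_one, depth_chord μ (by rw [← h]; exact ⟨abs_nonneg _, hδ⟩) (by norm_num), h]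
    · rw [show μ + δ = μ - (-δ) by ring, ← chord_neg_one,
        depth_chord μ (by rw [← h]; exact ⟨abs_nonneg _, hδ⟩) (by norm_num), h]
  have hr := abs_sub_round ((θ - μ) / (4 * g))
  set m := round ((θ - μ) / (4 * g))
  refine ⟨-m, ?_⟩
  have h1 : |θ - 4 * g * m - μ| ≤ 2 * g := by
    have : θ - 4 * g * m - μ = ((θ - μ) / (4 * g) - m) * (4 * g) := by
      rw [sub_mul, div_mul_cancel₀ _ hg.ne']; ring
    rw [this, abs_mul, abs_of_pos hg]
    nlinarith
  have h2 := key _ h1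
  rw [add_sub_cancel] at h2
  have h3 : boundaryPoint g (θ - 4 * g * m) = boundaryPoint g θ := by
    rw [← boundaryPoint_add_int g θ (-m)]; congr 1; push_cast; ring
  rw [← h3, h2]
  push_cast
  rcases abs_cases (θ - 4 * g * m - μ) with ⟨h, -⟩ | ⟨h, -⟩
  · left; rw [h]; ring
  · right; rw [h]; ring

end StandardSurface

/-! ### Twists along annuli in the surface -/

namespace StandardSurface

/-- An annulus in the surface, given by coordinates `u` (modulo `1`) and `s ∈ (0, 1)` on an open
saturated set of the polygon. -/
structure Annulus (g : ℕ) where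
  carrier : Set PolygonDisk
  u : PolygonDisk → ℝ
  s : PolygonDisk → ℝ
  J : C(ℝ × ℝ, StandardSurface g)
  isOpen : IsOpen carrier
  continuousOn_u : ContinuousOn u carrier
  continuousOn_s : ContinuousOn s carrier
  isClosed_core : IsClosed {z | z ∈ carrier ∧ s z ∈ Set.Icc (1 / 4 : ℝ) (3 / 4)}
  periodic : ∀ a b (m : ℤ), J (a + m, b) = J (a, b)
  J_coord : ∀ z ∈ carrier, J (u z, s z) = proj g z
  saturated : ∀ z z', SideGluing g z z' → (z ∈ carrier ↔ z' ∈ carrier)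
  s_eq : ∀ z z', SideGluing g z z' → z ∈ carrier → s z = s z'
  u_eq : ∀ z z', SideGluing g z z' → z ∈ carrier → ∃ m : ℤ, u z = u z' + m
  exists_rep : ∀ a, ∀ b ∈ Set.Ioo (0 : ℝ) 1, ∃ z ∈ carrier, s z = b ∧ ∃ m : ℤ, u z = a + m
  s_mem : ∀ z ∈ carrier, s z ∈ Set.Ioo (0 : ℝ) 1

/-- The ramp function from `0` to `1` on `[1 / 4, 3 / 4]`. -/
noncomputable def ramp (b : ℝ) : ℝ := max 0 (min 1 (2 * (b - 1 / 4)))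

theorem continuous_ramp : Continuous ramp := by unfold ramp; fun_prop

theorem ramp_of_le {b : ℝ} (h : b ≤ 1 / 4) : ramp b = 0 :=
  max_eq_left ((min_le_right _ _).trans (by linarith))

theorem ramp_of_ge {b : ℝ} (h : 3 / 4 ≤ b) : ramp b = 1 := by
  rw [ramp, min_eq_left (by linarith), max_eq_right zero_le_one]

theorem ramp_mem (b : ℝ) : ramp b ∈ Set.Icc (0 : ℝ) 1 :=
  ⟨le_max_left _ _, max_le zero_le_one (min_le_left _ _)⟩

theorem ramp_half : ramp (1 / 2) = 1 / 2 := by norm_num [ramp]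

theorem ramp_le_half {b : ℝ} (h : b ≤ 1 / 2) : ramp b ≤ 1 / 2 :=
  max_le (by norm_num) ((min_le_right _ _).trans (by linarith))

theorem half_le_ramp {b : ℝ} (h : 1 / 2 ≤ b) : 1 / 2 ≤ ramp b :=
  le_max_of_le_right (le_min (by norm_num) (by linarith))

namespace Annulus

variable {g : ℕ} (A : Annulus g) (η : ℤ)

open Classical in
/-- The twist on the polygon. -/
noncomputable def preTwist (z : PolygonDisk) : StandardSurface g :=
  if z ∈ A.carrier then A.J (A.u z + η * ramp (A.s z), A.s z) else proj g z

theorem preTwist_of_mem {z : PolygonDisk} (hz : z ∈ A.carrier) :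
    A.preTwist η z = A.J (A.u z + η * ramp (A.s z), A.s z) := if_pos hz

theorem preTwist_of_notMem {z : PolygonDisk} (hz : z ∉ A.carrier) :
    A.preTwist η z = proj g z := if_neg hz

/-- Off the core the ramp is 0 or 1, and a full turn is invisible by periodicity. -/
theorem preTwist_of_notMem_core {z : PolygonDisk}
    (hz : ¬ (z ∈ A.carrier ∧ A.s z ∈ Set.Icc (1 / 4 : ℝ) (3 / 4))) :
    A.preTwist η z = proj g z := by
  by_cases h : z ∈ A.carrier
  · rw [preTwist_of_mem A η h]
    by_cases h1 : A.s z ≤ 1 / 4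
    · rw [ramp_of_le h1, mul_zero, add_zero, A.J_coord z h]
    · have h2 : 3 / 4 ≤ A.s z := by
        by_contra h2
        exact hz ⟨h, by constructor <;> linarith⟩
      rw [ramp_of_ge h2, mul_one, A.periodic, A.J_coord z h]
  · exact A.preTwist_of_notMem η h

/-- Inside the open carrier the coordinate formula is continuous. A point outside has the complement
of the closed core as a neighborhood, on which the twist is just the projection. -/
theorem continuous_preTwist : Continuous (A.preTwist η) := by
  rw [continuous_iff_continuousAt]
  intro z
  by_cases hz : z ∈ A.carrier
  · have hn := A.isOpen.mem_nhds hz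
    have hu := A.continuousOn_u.continuousAt hn
    have hs := A.continuousOn_s.continuousAt hn
    have h1 : ContinuousAt (fun z => A.J (A.u z + η * ramp (A.s z), A.s z)) z :=
      A.J.continuous.continuousAt.comp (f := fun z => (A.u z + η * ramp (A.s z), A.s z))
        ((hu.add (continuousAt_const.mul (continuous_ramp.continuousAt.comp hs))).prodMk hs)
    refine h1.congr ?_
    filter_upwards [hn] with w hw
    exact (A.preTwist_of_mem η hw).symm
  · refine (proj g).continuous.continuousAt.congr ?_
    filter_upwards [A.isClosed_core.isOpen_compl.mem_nhds (fun h => hz h.1)] with w hw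
    exact (A.preTwist_of_notMem_core η hw).symm

theorem preTwist_eq {z z' : PolygonDisk} (h : SideGluing g z z') :
    A.preTwist η z = A.preTwist η z' := by
  by_cases hz : z ∈ A.carrier
  · have hz' := (A.saturated z z' h).1 hz
    obtain ⟨m, hm⟩ := A.u_eq z z' h hz
    rw [preTwist_of_mem A η hz, preTwist_of_mem A η hz', A.s_eq z z' h hz, hm, add_right_comm,
      A.periodic]
  · have hz' := mt (A.saturated z z' h).2 hz
    rw [preTwist_of_notMem A η hz, preTwist_of_notMem A η hz']
    exact Quot.sound h

/-- The twist map. -/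
noncomputable def twistMap : C(StandardSurface g, StandardSurface g) where
  toFun := Quot.lift (A.preTwist η) fun _ _ h => A.preTwist_eq η h
  continuous_toFun := continuous_quot_lift _ (A.continuous_preTwist η)

theorem twistMap_proj (z : PolygonDisk) : A.twistMap η (proj g z) = A.preTwist η z := rfl

theorem twistMap_J (a : ℝ) {b : ℝ} (hb : b ∈ Set.Ioo (0 : ℝ) 1) :
    A.twistMap η (A.J (a, b)) = A.J (a + η * ramp b, b) := by
  obtain ⟨z, hz, rfl, m, hm⟩ := A.exists_rep a b hb
  have : A.J (a, A.s z) = proj g z := by rw [← A.J_coord z hz, hm, A.periodic]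
  rw [this, twistMap_proj, preTwist_of_mem A η hz, hm, add_right_comm, A.periodic]

theorem twistMap_neg_twistMap (x : StandardSurface g) :
    A.twistMap (-η) (A.twistMap η x) = x := by
  obtain ⟨z, rfl⟩ := proj_surjective g x
  rw [twistMap_proj]
  by_cases hz : z ∈ A.carrier
  · rw [preTwist_of_mem A η hz, twistMap_J A _ _ (A.s_mem z hz)]
    rw [show A.u z + η * ramp (A.s z) + (-η : ℤ) * ramp (A.s z) = A.u z by push_cast; ring,
      A.J_coord z hz]
  · rw [preTwist_of_notMem A η hz, twistMap_proj, preTwist_of_notMem A _ hz]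

/-- The twist homeomorphism. -/
noncomputable def twist : StandardSurface g ≃ₜ StandardSurface g where
  toFun := A.twistMap η
  invFun := A.twistMap (-η)
  left_inv := A.twistMap_neg_twistMap η
  right_inv x := by simpa using A.twistMap_neg_twistMap (-η) x
  continuous_toFun := (A.twistMap η).continuous
  continuous_invFun := (A.twistMap (-η)).continuous

theorem twist_of_notMem {z : PolygonDisk} (hz : z ∉ A.carrier) :
    A.twist η (proj g z) = proj g z := A.preTwist_of_notMem η hz

/-- `twistMap_J` applies only for 0 < s < 1. At both ends the path is at the fixed base point, and
the formula persists because the ramp is 0 or 1 and J has period 1. -/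
theorem twist_crossing (h0 : A.twist η (base g) = base g) (a : ℝ) (γ : Path (base g) (base g))
    (hγ : ∀ t, γ t = A.J (a, t)) (t : unitInterval) :
    A.twist η (γ t) = A.J (a + η * ramp t, t) := by
  rcases t.2.1.eq_or_lt with ht | ht
  · have : t = 0 := Subtype.ext ht.symm
    subst this
    have e := hγ 0
    rw [γ.source] at e
    rw [γ.source, h0, Set.Icc.coe_zero, ramp_of_le (by norm_num), mul_zero, add_zero]
    exact e
  rcases t.2.2.eq_or_lt with ht' | ht'
  · have : t = 1 := Subtype.ext ht'
    subst this
    have e := hγ 1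
    rw [γ.target] at e
    rw [γ.target, h0, Set.Icc.coe_one, ramp_of_ge (by norm_num), mul_one, A.periodic]
    exact e
  · rw [hγ]
    exact A.twistMap_J η a ⟨ht, ht'⟩

end Annulus

/-- The extension of a function on `[0, 1]` with equal boundary values to a periodic function. -/
noncomputable def periodize {X : Type*} [TopologicalSpace X] (f : C(ℝ × ℝ, X))
    (h : ∀ b, f (0, b) = f (1, b)) : C(ℝ × ℝ, X) where
  toFun p := f (Int.fract p.1, p.2)
  continuous_toFun := by
    have := ContinuousOn.comp_fract (s := fun p : ℝ × ℝ => p.1)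
      (f := fun (p : ℝ × ℝ) u => f (u, p.2))
      (Continuous.continuousOn (by unfold Function.uncurry; fun_prop)) continuous_fst
      (fun p => h p.2)
    exact this

theorem periodize_apply {X : Type*} [TopologicalSpace X] (f : C(ℝ × ℝ, X))
    (h : ∀ b, f (0, b) = f (1, b)) (a b : ℝ) :
    periodize f h (a, b) = f (Int.fract a, b) := rfl

theorem periodize_add_int {X : Type*} [TopologicalSpace X] (f : C(ℝ × ℝ, X))
    (h : ∀ b, f (0, b) = f (1, b)) (a b : ℝ) (m : ℤ) :
    periodize f h (a + m, b) = periodize f h (a, b) := by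
  rw [periodize_apply, periodize_apply, Int.fract_add_intCast]

theorem periodize_of_mem {X : Type*} [TopologicalSpace X] (f : C(ℝ × ℝ, X))
    (h : ∀ b, f (0, b) = f (1, b)) {a : ℝ} (ha : a ∈ Set.Icc (0 : ℝ) 1) (b : ℝ) :
    periodize f h (a, b) = f (a, b) := by
  rcases ha.2.lt_or_eq with h1 | rfl
  · rw [periodize_apply, Int.fract_eq_self.2 ⟨ha.1, h1⟩]
  · rw [periodize_apply, Int.fract_one, h]

/-! ### Bands of chords between two sides -/

/-- The union of the open chords from the side `p` to the side `q`. -/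
def band (g : ℕ) (p q : ℤ) : Set PolygonDisk :=
  {z | depth g ((p + q + 1) / 2) z ∈ Set.Ioo ((q - p - 1) / 2 : ℝ) ((q - p + 1) / 2)}

/-- The position of a chord in a band. -/
noncomputable def bandPos (g : ℕ) (p q : ℤ) (z : PolygonDisk) : ℝ :=
  depth g ((p + q + 1) / 2) z - (q - p - 1) / 2

/-- The position in a chord of a band. -/
noncomputable def bandHeight (g : ℕ) (p q : ℤ) (z : PolygonDisk) : ℝ :=
  height g ((p + q + 1) / 2) z

/-- The point with given coordinates in a band. -/
noncomputable def bandPoint (g : ℕ) (p q : ℤ) (b v : ℝ) : PolygonDisk :=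
  chord g ((p + q + 1) / 2) ((q - p - 1) / 2 + b) v

theorem continuous_bandPoint (g : ℕ) (p q : ℤ) :
    Continuous fun x : ℝ × ℝ => bandPoint g p q x.1 x.2 := by
  have h : Continuous fun x : ℝ × ℝ => (((q - p - 1) / 2 + x.1 : ℝ), x.2) := by fun_prop
  have h' := Continuous.comp (continuous_chord g ((p + q + 1 : ℝ) / 2)) h
  exact h'.congr fun x => rfl

theorem bandPoint_one (g : ℕ) (p q : ℤ) (b : ℝ) :
    bandPoint g p q b 1 = boundaryPoint g (q + b) := by
  rw [bandPoint, chord_one]; congr 1; ring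

theorem bandPoint_neg_one (g : ℕ) (p q : ℤ) (b : ℝ) :
    bandPoint g p q b (-1) = boundaryPoint g (p + 1 - b) := by
  rw [bandPoint, chord_neg_one]; congr 1; ring

theorem continuous_bandPos (g : ℕ) (p q : ℤ) : Continuous (bandPos g p q) :=
  (continuous_depth g _).sub continuous_const

theorem mem_band_iff {g : ℕ} {p q : ℤ} {z : PolygonDisk} :
    z ∈ band g p q ↔ bandPos g p q z ∈ Set.Ioo (0 : ℝ) 1 := by
  simp only [band, bandPos, Set.mem_Ioo, Set.mem_ofPred_eq]
  constructor <;> rintro ⟨h1, h2⟩ <;> constructor <;> linarith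

theorem isOpen_band (g : ℕ) (p q : ℤ) : IsOpen (band g p q) :=
  isOpen_Ioo.preimage (continuous_depth g _)

variable {g : ℕ} [NeZero g] {p q : ℤ}

omit [NeZero g] in
theorem depth_mem_of_mem_band (h1 : p < q) (h2 : q - p < 4 * g) {b : ℝ}
    (hb : b ∈ Set.Ioo (0 : ℝ) 1) : ((q - p - 1) / 2 + b : ℝ) ∈ Set.Ioo (0 : ℝ) (2 * g) := by
  have h1' : (p : ℝ) + 1 ≤ q := by exact_mod_cast h1
  have h2' : (q : ℝ) - p + 1 ≤ 4 * g := by exact_mod_cast h2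
  constructor <;> linarith [hb.1, hb.2]

omit [NeZero g] in
theorem depth_eq (z : PolygonDisk) :
    depth g ((p + q + 1) / 2) z = (q - p - 1) / 2 + bandPos g p q z := by
  rw [bandPos]; ring

theorem continuousOn_bandHeight (h1 : p < q) (h2 : q - p < 4 * g) :
    ContinuousOn (bandHeight g p q) (band g p q) := by
  refine (continuousOn_height _).mono fun z hz => ?_
  change depth g ((p + q + 1) / 2) z ∈ Set.Ioo (0 : ℝ) (2 * g)
  rw [depth_eq]
  exact depth_mem_of_mem_band h1 h2 (mem_band_iff.1 hz)

theorem bandHeight_mem (h1 : p < q) (h2 : q - p < 4 * g) {z : PolygonDisk} (hz : z ∈ band g p q) :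
    bandHeight g p q z ∈ Set.Icc (-1 : ℝ) 1 := by
  refine height_mem ?_
  rw [depth_eq]
  exact depth_mem_of_mem_band h1 h2 (mem_band_iff.1 hz)

theorem bandPoint_bandPos (h1 : p < q) (h2 : q - p < 4 * g) {z : PolygonDisk}
    (hz : z ∈ band g p q) : bandPoint g p q (bandPos g p q z) (bandHeight g p q z) = z := by
  rw [bandPoint, ← depth_eq]
  refine chord_depth ?_
  rw [depth_eq]
  exact depth_mem_of_mem_band h1 h2 (mem_band_iff.1 hz)

theorem bandPos_bandPoint (h1 : p < q) (h2 : q - p < 4 * g) {b v : ℝ}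
    (hb : b ∈ Set.Ioo (0 : ℝ) 1) (hv : v ∈ Set.Icc (-1 : ℝ) 1) :
    bandPos g p q (bandPoint g p q b v) = b := by
  rw [bandPos, bandPoint,
    depth_chord _ (Set.Ioo_subset_Icc_self (depth_mem_of_mem_band h1 h2 hb)) hv]
  ring

theorem bandHeight_bandPoint (h1 : p < q) (h2 : q - p < 4 * g) {b v : ℝ}
    (hb : b ∈ Set.Ioo (0 : ℝ) 1) (hv : v ∈ Set.Icc (-1 : ℝ) 1) :
    bandHeight g p q (bandPoint g p q b v) = v :=
  height_chord _ (depth_mem_of_mem_band h1 h2 hb) hv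

theorem bandPoint_mem (h1 : p < q) (h2 : q - p < 4 * g) {b v : ℝ}
    (hb : b ∈ Set.Ioo (0 : ℝ) 1) (hv : v ∈ Set.Icc (-1 : ℝ) 1) :
    bandPoint g p q b v ∈ band g p q := by
  rwa [mem_band_iff, bandPos_bandPoint h1 h2 hb hv]

/-- The depth of a boundary point determines its parameter modulo 4g up to reflection in the center
of the chords. The depths occurring in the band then leave only the open sides p and q. -/
theorem side_of_mem_band {N : ℤ} {t : ℝ} (ht : t ∈ Set.Icc (0 : ℝ) 1)
    (h : boundaryPoint g (N + t) ∈ band g p q) :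
    t ∈ Set.Ioo (0 : ℝ) 1 ∧ ∃ m : ℤ, N + 4 * g * m = q ∨ N + 4 * g * m = p := by
  have key (M k : ℤ) (b : ℝ) (hb : b ∈ Set.Ioo (0 : ℝ) 1) (e : (M : ℝ) + t = k + b) :
      M = k ∧ t = b := by
    have h1 : M < k + 1 := by
      have : (M : ℝ) < k + 1 := by linarith [hb.2, ht.1]
      exact_mod_cast this
    have h2 : k < M + 1 := by
      have : (k : ℝ) < M + 1 := by linarith [hb.1, ht.2]
      exact_mod_cast this
    obtain rfl : M = k := by omega
    exact ⟨rfl, by linarith⟩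
  obtain ⟨m, hm⟩ := exists_depth_boundaryPoint (g := g) ((p + q + 1) / 2) (N + t)
  have hb := mem_band_iff.1 h
  rw [depth_eq] at hm
  rcases hm with hm | hm
  · obtain ⟨e1, e2⟩ := key (N + 4 * g * m) q _ hb (by push_cast; linarith)
    exact ⟨e2 ▸ hb, m, .inl e1⟩
  · obtain ⟨e1, e2⟩ := key (N + 4 * g * m) p (1 - bandPos g p q (boundaryPoint g (N + t)))
      ⟨by linarith [hb.2], by linarith [hb.1]⟩ (by push_cast; linarith)
    exact ⟨⟨by linarith [hb.2], by linarith [hb.1]⟩, m, .inr e1⟩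

theorem upper_side (h1 : p < q) (h2 : q - p < 4 * g) {t : ℝ} (ht : t ∈ Set.Ioo (0 : ℝ) 1) :
    boundaryPoint g (q + t) ∈ band g p q ∧ bandPos g p q (boundaryPoint g (q + t)) = t ∧
      bandHeight g p q (boundaryPoint g (q + t)) = 1 := by
  rw [← bandPoint_one g p q]
  exact ⟨bandPoint_mem h1 h2 ht (by norm_num), bandPos_bandPoint h1 h2 ht (by norm_num),
    bandHeight_bandPoint h1 h2 ht (by norm_num)⟩

theorem lower_side (h1 : p < q) (h2 : q - p < 4 * g) {t : ℝ} (ht : t ∈ Set.Ioo (0 : ℝ) 1) :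
    boundaryPoint g (p + t) ∈ band g p q ∧ bandPos g p q (boundaryPoint g (p + t)) = 1 - t ∧
      bandHeight g p q (boundaryPoint g (p + t)) = -1 := by
  have ht' : 1 - t ∈ Set.Ioo (0 : ℝ) 1 := ⟨by linarith [ht.2], by linarith [ht.1]⟩
  have := bandPoint_neg_one g p q (1 - t)
  rw [show (p : ℝ) + 1 - (1 - t) = p + t by ring] at this
  rw [← this]
  exact ⟨bandPoint_mem h1 h2 ht' (by norm_num), bandPos_bandPoint h1 h2 ht' (by norm_num),
    bandHeight_bandPoint h1 h2 ht' (by norm_num)⟩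

omit [NeZero g] in
theorem side_unique {i i' : Fin g} {c c' m : ℤ} (hc : 0 ≤ c ∧ c < 4) (hc' : 0 ≤ c' ∧ c' < 4)
    (h : 4 * (i : ℕ) + c + 4 * g * m = 4 * (i' : ℕ) + c') : i = i' ∧ c = c' ∧ m = 0 := by
  have e1 : (4 * (i : ℕ) + c : ℤ) % (4 * g) = (4 * (i' : ℕ) + c' : ℤ) % (4 * g) := by
    rw [← h, Int.add_mul_emod_self_left]
  rw [Int.emod_eq_of_lt (by omega) (by omega), Int.emod_eq_of_lt (by omega) (by omega)] at e1
  have e2 : (g : ℤ) * m = 0 := by linarith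
  have hg : (g : ℤ) ≠ 0 := by have := i.2; omega
  refine ⟨Fin.ext (by omega), by omega, ?_⟩
  rcases mul_eq_zero.1 e2 with h | h
  · exact absurd h hg
  · exact h

omit [NeZero g] in
theorem _root_.SideGluing.exists_side {z z' : PolygonDisk} (h : SideGluing g z z') :
    ∃ (i : Fin g) (e : Fin 2) (t : ℝ), t ∈ Set.Icc (0 : ℝ) 1 ∧
      z = boundaryPoint g ((4 * (i : ℕ) + (e : ℕ) : ℤ) + t) ∧
      z' = boundaryPoint g ((4 * (i : ℕ) + (e : ℕ) + 2 : ℤ) + (1 - t)) := by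
  cases h with
  | a i t ht =>
    refine ⟨i, 0, t, ht, ?_, ?_⟩ <;> congr 1 <;> push_cast <;> simp; ring
  | b i t ht =>
    refine ⟨i, 1, t, ht, ?_, ?_⟩ <;> congr 1 <;> push_cast <;> simp; ring

end StandardSurface

/-! ### The annuli of the twists -/

namespace StandardSurface

/-- The retraction of `ℝ` to `[0, 1]`. -/
noncomputable def clamp (b : ℝ) : ℝ := (Set.projIcc (0 : ℝ) 1 zero_le_one b : ℝ)

theorem continuous_clamp : Continuous clamp := continuous_subtype_val.comp continuous_projIcc

theorem clamp_mem (b : ℝ) : clamp b ∈ Set.Icc (0 : ℝ) 1 :=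
  (Set.projIcc (0 : ℝ) 1 zero_le_one b).2

theorem clamp_of_mem {b : ℝ} (hb : b ∈ Set.Icc (0 : ℝ) 1) : clamp b = b := by
  rw [clamp, Set.projIcc_of_mem _ hb]

variable {g : ℕ} [NeZero g]

/-! ### The annulus crossing a single side of one handle. -/

section Handle

variable (i : Fin g) (e : Fin 2)

/-- The first side of the band connecting a side with its partner. -/
def handleSide : ℤ := 4 * (i : ℕ) + (e : ℕ)

omit [NeZero g] in
theorem handleSide_lt : handleSide i e < handleSide i e + 2 := by omega

theorem handleSide_sub_lt : handleSide i e + 2 - handleSide i e < 4 * g := by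
  have := NeZero.pos g
  omega

/-- The chords of the band connecting a side with its partner. -/
noncomputable def handleMap : C(ℝ × ℝ, StandardSurface g) where
  toFun x := proj g (bandPoint g (handleSide i e) (handleSide i e + 2) (1 - clamp x.2)
    (2 * x.1 - 1))
  continuous_toFun := by
    have h : Continuous fun x : ℝ × ℝ => (1 - clamp x.2, 2 * x.1 - 1) := by
      have := continuous_clamp
      fun_prop
    have h' := (continuous_bandPoint g (handleSide i e) (handleSide i e + 2)).comp h
    exact (proj g).continuous.comp (h'.congr fun x => rfl)

omit [NeZero g] in
theorem handleMap_apply (a b : ℝ) : handleMap i e (a, b) =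
    proj g (bandPoint g (handleSide i e) (handleSide i e + 2) (1 - clamp b) (2 * a - 1)) := rfl

omit [NeZero g] in
theorem handleMap_zero (b : ℝ) : handleMap i e (0, b) = edgePoint g (handleSide i e + clamp b) := by
  rw [handleMap_apply, show (2 * 0 - 1 : ℝ) = -1 by norm_num, bandPoint_neg_one, edgePoint_eq]
  congr 2
  ring

omit [NeZero g] in
theorem handleMap_one (b : ℝ) : handleMap i e (1, b) = edgePoint g (handleSide i e + clamp b) := by
  rw [handleMap_apply, show (2 * 1 - 1 : ℝ) = 1 by norm_num, bandPoint_one]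
  have h := edgePoint_side i e (clamp_mem b)
  rw [handleSide]
  push_cast
  rw [h, edgePoint_eq]
  congr 2
  ring

/-- The band meets the boundary only in two open sides, which are partners of each other; hence a
glued pair that meets it lies on exactly these two. -/
theorem handle_gluing {z z' : PolygonDisk} (h : SideGluing g z z')
    (hz : z ∈ band g (handleSide i e) (handleSide i e + 2) ∨
      z' ∈ band g (handleSide i e) (handleSide i e + 2)) :
    ∃ t ∈ Set.Ioo (0 : ℝ) 1, z = boundaryPoint g (handleSide i e + t) ∧
      z' = boundaryPoint g ((handleSide i e + 2 : ℤ) + (1 - t)) := by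
  obtain ⟨i', e', t, ht, rfl, rfl⟩ := h.exists_side
  have ht' : 1 - t ∈ Set.Icc (0 : ℝ) 1 := ⟨by linarith [ht.2], by linarith [ht.1]⟩
  have key : t ∈ Set.Ioo (0 : ℝ) 1 ∧ i' = i ∧ e' = e := by
    rcases hz with hz | hz
    · obtain ⟨ht0, m, hm | hm⟩ := side_of_mem_band ht hz
      · obtain ⟨-, h2, -⟩ := side_unique (i := i') (i' := i) (c := (e' : ℕ)) (c' := (e : ℕ) + 2)
          (m := m) (by omega) (by omega) (by rw [handleSide] at hm; linarith)
        omega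
      · obtain ⟨h1, h2, -⟩ := side_unique (i := i') (i' := i) (c := (e' : ℕ)) (c' := (e : ℕ))
          (m := m) (by omega) (by omega) (by rw [handleSide] at hm; linarith)
        exact ⟨ht0, h1, Fin.ext (by omega)⟩
    · obtain ⟨ht0, m, hm | hm⟩ := side_of_mem_band ht' hz
      · obtain ⟨h1, h2, -⟩ := side_unique (i := i') (i' := i) (c := (e' : ℕ) + 2)
          (c' := (e : ℕ) + 2) (m := m) (by omega) (by omega) (by rw [handleSide] at hm; linarith)
        exact ⟨⟨by linarith [ht0.2], by linarith [ht0.1]⟩, h1, Fin.ext (by omega)⟩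
      · obtain ⟨-, h2, -⟩ := side_unique (i := i') (i' := i) (c := (e' : ℕ) + 2) (c' := (e : ℕ))
          (m := m) (by omega) (by omega) (by rw [handleSide] at hm; linarith)
        omega
  obtain ⟨h0, rfl, rfl⟩ := key
  exact ⟨t, h0, rfl, rfl⟩

theorem handle_coord {t : ℝ} (ht : t ∈ Set.Ioo (0 : ℝ) 1) {z z' : PolygonDisk}
    (hz : z = boundaryPoint g (handleSide i e + t))
    (hz' : z' = boundaryPoint g ((handleSide i e + 2 : ℤ) + (1 - t))) :
    (z ∈ band g (handleSide i e) (handleSide i e + 2) ∧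
      z' ∈ band g (handleSide i e) (handleSide i e + 2)) ∧
    bandPos g (handleSide i e) (handleSide i e + 2) z =
      bandPos g (handleSide i e) (handleSide i e + 2) z' ∧
    bandHeight g (handleSide i e) (handleSide i e + 2) z = -1 ∧
    bandHeight g (handleSide i e) (handleSide i e + 2) z' = 1 := by
  subst hz hz'
  obtain ⟨h1, h2, h3⟩ := lower_side (handleSide_lt i e) (handleSide_sub_lt i e) ht
  obtain ⟨h1', h2', h3'⟩ := upper_side (handleSide_lt i e) (handleSide_sub_lt i e) (t := 1 - t)
    ⟨by linarith [ht.2], by linarith [ht.1]⟩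
  exact ⟨⟨h1, h1'⟩, h2.trans h2'.symm, h3, h3'⟩

/-- The annulus of the band connecting a side with its partner. -/
noncomputable def handleAnnulus : Annulus g where
  carrier := band g (handleSide i e) (handleSide i e + 2)
  u z := (bandHeight g (handleSide i e) (handleSide i e + 2) z + 1) / 2
  s z := 1 - bandPos g (handleSide i e) (handleSide i e + 2) z
  J := periodize (handleMap i e) fun b => (handleMap_zero i e b).trans (handleMap_one i e b).symm
  isOpen := isOpen_band _ _ _
  continuousOn_u := ((continuousOn_bandHeight (handleSide_lt i e) (handleSide_sub_lt i e)).add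
    continuousOn_const).div_const _
  continuousOn_s := (continuous_const.sub (continuous_bandPos _ _ _)).continuousOn
  isClosed_core := by
    have : {z | z ∈ band g (handleSide i e) (handleSide i e + 2) ∧
        1 - bandPos g (handleSide i e) (handleSide i e + 2) z ∈ Set.Icc (1 / 4 : ℝ) (3 / 4)} =
        (fun z => 1 - bandPos g (handleSide i e) (handleSide i e + 2) z) ⁻¹'
          Set.Icc (1 / 4 : ℝ) (3 / 4) := by
      ext z
      refine ⟨fun h => h.2, fun h => ⟨mem_band_iff.2 ?_, h⟩⟩
      obtain ⟨h1, h2⟩ := h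
      constructor <;> linarith
    rw [this]
    exact isClosed_Icc.preimage (continuous_const.sub (continuous_bandPos _ _ _))
  periodic := periodize_add_int _ _
  J_coord z hz := by
    have h1 := bandHeight_mem (handleSide_lt i e) (handleSide_sub_lt i e) hz
    have h2 := mem_band_iff.1 hz
    rw [periodize_of_mem _ _ ⟨by linarith [h1.1], by linarith [h1.2]⟩, handleMap_apply,
      clamp_of_mem ⟨by linarith [h2.2], by linarith [h2.1]⟩, sub_sub_cancel,
      mul_div_cancel₀ _ two_ne_zero, add_sub_cancel_right,
      bandPoint_bandPos (handleSide_lt i e) (handleSide_sub_lt i e) hz]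
  saturated z z' h := by
    constructor
    · intro hz
      obtain ⟨t, ht, h1, h2⟩ := handle_gluing i e h (.inl hz)
      exact (handle_coord i e ht h1 h2).1.2
    · intro hz
      obtain ⟨t, ht, h1, h2⟩ := handle_gluing i e h (.inr hz)
      exact (handle_coord i e ht h1 h2).1.1
  s_eq z z' h hz := by
    obtain ⟨t, ht, h1, h2⟩ := handle_gluing i e h (.inl hz)
    rw [(handle_coord i e ht h1 h2).2.1]
  u_eq z z' h hz := by
    obtain ⟨t, ht, h1, h2⟩ := handle_gluing i e h (.inl hz)
    obtain ⟨-, -, h3, h4⟩ := handle_coord i e ht h1 h2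
    -- The partner sides are the ends u = 0 and u = 1 of the band, so the gluing closes it up with a
    -- shift by one turn.
    exact ⟨-1, by rw [h3, h4]; norm_num⟩
  exists_rep a b hb := by
    have h1 := Int.fract_nonneg a
    have h2 := (Int.fract_lt_one a).le
    have hb' : 1 - b ∈ Set.Ioo (0 : ℝ) 1 := ⟨by linarith [hb.2], by linarith [hb.1]⟩
    have hv : 2 * Int.fract a - 1 ∈ Set.Icc (-1 : ℝ) 1 := by constructor <;> linarith
    refine ⟨bandPoint g (handleSide i e) (handleSide i e + 2) (1 - b) (2 * Int.fract a - 1),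
      bandPoint_mem (handleSide_lt i e) (handleSide_sub_lt i e) hb' hv, ?_, -⌊a⌋, ?_⟩
    · rw [bandPos_bandPoint (handleSide_lt i e) (handleSide_sub_lt i e) hb' hv, sub_sub_cancel]
    · rw [bandHeight_bandPoint (handleSide_lt i e) (handleSide_sub_lt i e) hb' hv]
      have := Int.self_sub_floor a
      push_cast
      linarith
  s_mem z hz := by
    have h2 := mem_band_iff.1 hz
    constructor <;> linarith [h2.1, h2.2]

end Handle

/-! ### The annulus crossing b_0 and a_j, made of two bands. -/

section Link

variable (j : Fin g)

/-- The two sets of chords of the annulus that links the handle `0` to the handle `j`. -/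
noncomputable def linkMapAux (x : ℝ × ℝ) : StandardSurface g :=
  if x.1 ≤ 1 / 2 then proj g (bandPoint g 3 (4 * (j : ℕ)) (clamp x.2) (4 * x.1 - 1))
  else proj g (bandPoint g 1 (4 * (j : ℕ) + 2) (1 - clamp x.2) (3 - 4 * x.1))

omit [NeZero g] in
theorem link_half (b : ℝ) : proj g (bandPoint g 3 (4 * (j : ℕ)) (clamp b) 1) =
    proj g (bandPoint g 1 (4 * (j : ℕ) + 2) (1 - clamp b) 1) := by
  rw [bandPoint_one, bandPoint_one]
  have h := edgePoint_a g j (clamp b) (clamp_mem b)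
  simp only [edgePoint_eq] at h
  push_cast
  rw [h]
  congr 2
  ring

/-- The chords of the annulus that links the handle `0` to the handle `j`. -/
noncomputable def linkMap : C(ℝ × ℝ, StandardSurface g) where
  toFun := linkMapAux j
  continuous_toFun := by
    have hc := continuous_clamp
    have h1 : Continuous fun x : ℝ × ℝ => (clamp x.2, 4 * x.1 - 1) := by fun_prop
    have h2 : Continuous fun x : ℝ × ℝ => (1 - clamp x.2, 3 - 4 * x.1) := by fun_prop
    have h1' := (continuous_bandPoint g 3 (4 * (j : ℕ))).comp h1
    have h2' := (continuous_bandPoint g 1 (4 * (j : ℕ) + 2)).comp h2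
    refine Continuous.if_le ((proj g).continuous.comp (h1'.congr fun x => rfl))
      ((proj g).continuous.comp (h2'.congr fun x => rfl)) continuous_fst continuous_const ?_
    rintro ⟨a, b⟩ (rfl : a = 1 / 2)
    have := link_half j b
    norm_num at this ⊢
    exact this

omit [NeZero g] in
theorem linkMap_of_le {a : ℝ} (ha : a ≤ 1 / 2) (b : ℝ) : linkMap j (a, b) =
    proj g (bandPoint g 3 (4 * (j : ℕ)) (clamp b) (4 * a - 1)) := if_pos ha

omit [NeZero g] in
theorem linkMap_of_ge {a : ℝ} (ha : 1 / 2 ≤ a) (b : ℝ) : linkMap j (a, b) =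
    proj g (bandPoint g 1 (4 * (j : ℕ) + 2) (1 - clamp b) (3 - 4 * a)) := by
  rcases ha.eq_or_lt with rfl | ha
  · rw [linkMap_of_le j le_rfl]
    have := link_half j b
    norm_num at this ⊢
    exact this
  · exact if_neg ha.not_ge

theorem linkMap_zero (b : ℝ) : linkMap j (0, b) = edgePoint g (1 + clamp b) := by
  rw [linkMap_of_le j (by norm_num), show (4 * 0 - 1 : ℝ) = -1 by norm_num, bandPoint_neg_one]
  have h := edgePoint_b g 0 (clamp b) (clamp_mem b)
  simp only [Fin.val_zero, CharP.cast_eq_zero, mul_zero, zero_add] at h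
  rw [h, edgePoint_eq]
  congr 2
  push_cast
  ring

omit [NeZero g] in
theorem linkMap_one (b : ℝ) : linkMap j (1, b) = edgePoint g (1 + clamp b) := by
  rw [linkMap_of_ge j (by norm_num), show (3 - 4 * 1 : ℝ) = -1 by norm_num, bandPoint_neg_one,
    edgePoint_eq]
  congr 2
  push_cast
  ring

variable (hj : j ≠ 0)
include hj

theorem link_lt : (3 : ℤ) < 4 * (j : ℕ) := by
  have : (j : ℕ) ≠ 0 := fun h => hj (Fin.ext h)
  omega

omit [NeZero g] in
omit hj in
theorem link_sub_lt : (4 * (j : ℕ) - 3 : ℤ) < 4 * g := by omega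

theorem link_lt' : (1 : ℤ) < 4 * (j : ℕ) + 2 := by have := link_lt j hj; omega

omit [NeZero g] in
omit hj in
theorem link_sub_lt' : (4 * (j : ℕ) + 2 - 1 : ℤ) < 4 * g := by omega

-- The two bands have the same chord center 2j + 2, with depths in (2j - 2, 2j - 1) and in (2j, 2j +
-- 1).
omit [NeZero g] hj in
theorem link_disjoint {z : PolygonDisk} (h : z ∈ band g 3 (4 * (j : ℕ))) :
    z ∉ band g 1 (4 * (j : ℕ) + 2) := by
  intro h'
  have h1 := h.2
  have h2 := h'.1
  have e : (((1 : ℤ) : ℝ) + ((4 * (j : ℕ) + 2 : ℤ) : ℝ) + 1) / 2 =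
      (((3 : ℤ) : ℝ) + ((4 * (j : ℕ) : ℤ) : ℝ) + 1) / 2 := by push_cast; ring
  rw [e] at h2
  push_cast at h1 h2
  linarith

theorem link_gluing {z z' : PolygonDisk} (h : SideGluing g z z')
    (hz : z ∈ band g 3 (4 * (j : ℕ)) ∪ band g 1 (4 * (j : ℕ) + 2) ∨
      z' ∈ band g 3 (4 * (j : ℕ)) ∪ band g 1 (4 * (j : ℕ) + 2)) :
    ∃ t ∈ Set.Ioo (0 : ℝ) 1, (z = boundaryPoint g ((4 * (j : ℕ) : ℤ) + t) ∧
      z' = boundaryPoint g ((4 * (j : ℕ) + 2 : ℤ) + (1 - t))) ∨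
      (z = boundaryPoint g ((1 : ℤ) + t) ∧ z' = boundaryPoint g ((3 : ℤ) + (1 - t))) := by
  obtain ⟨i', e', t, ht, rfl, rfl⟩ := h.exists_side
  have ht' : 1 - t ∈ Set.Icc (0 : ℝ) 1 := ⟨by linarith [ht.2], by linarith [ht.1]⟩
  have h0 : ((0 : Fin g) : ℕ) = 0 := rfl
  have key : t ∈ Set.Ioo (0 : ℝ) 1 ∧ (i' = j ∧ e' = 0 ∨ i' = 0 ∧ e' = 1) := by
    rcases hz with (hz | hz) | (hz | hz)
    · obtain ⟨ht0, m, hm | hm⟩ := side_of_mem_band ht hz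
      · obtain ⟨h1, h2, -⟩ := side_unique (i := i') (i' := j) (c := (e' : ℕ)) (c' := 0)
          (m := m) (by omega) (by omega) (by linarith)
        exact ⟨ht0, .inl ⟨h1, Fin.ext (by omega)⟩⟩
      · obtain ⟨h1, h2, -⟩ := side_unique (i := i') (i' := 0) (c := (e' : ℕ)) (c' := 3)
          (m := m) (by omega) (by omega) (by rw [h0]; push_cast; linarith)
        omega
    · obtain ⟨ht0, m, hm | hm⟩ := side_of_mem_band ht hz
      · obtain ⟨h1, h2, -⟩ := side_unique (i := i') (i' := j) (c := (e' : ℕ)) (c' := 2)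
          (m := m) (by omega) (by omega) (by linarith)
        omega
      · obtain ⟨h1, h2, -⟩ := side_unique (i := i') (i' := 0) (c := (e' : ℕ)) (c' := 1)
          (m := m) (by omega) (by omega) (by rw [h0]; push_cast; linarith)
        exact ⟨ht0, .inr ⟨h1, Fin.ext (by simp; omega)⟩⟩
    · obtain ⟨ht0, m, hm | hm⟩ := side_of_mem_band ht' hz
      · obtain ⟨h1, h2, -⟩ := side_unique (i := i') (i' := j) (c := (e' : ℕ) + 2) (c' := 0)
          (m := m) (by omega) (by omega) (by linarith)
        omega
      · obtain ⟨h1, h2, -⟩ := side_unique (i := i') (i' := 0) (c := (e' : ℕ) + 2) (c' := 3)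
          (m := m) (by omega) (by omega) (by rw [h0]; push_cast; linarith)
        exact ⟨⟨by linarith [ht0.2], by linarith [ht0.1]⟩, .inr ⟨h1, Fin.ext (by simp; omega)⟩⟩
    · obtain ⟨ht0, m, hm | hm⟩ := side_of_mem_band ht' hz
      · obtain ⟨h1, h2, -⟩ := side_unique (i := i') (i' := j) (c := (e' : ℕ) + 2) (c' := 2)
          (m := m) (by omega) (by omega) (by linarith)
        exact ⟨⟨by linarith [ht0.2], by linarith [ht0.1]⟩, .inl ⟨h1, Fin.ext (by simp; omega)⟩⟩
      · obtain ⟨h1, h2, -⟩ := side_unique (i := i') (i' := 0) (c := (e' : ℕ) + 2) (c' := 1)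
          (m := m) (by omega) (by omega) (by rw [h0]; push_cast; linarith)
        omega
  obtain ⟨ht0, ⟨rfl, rfl⟩ | ⟨rfl, rfl⟩⟩ := key
  · exact ⟨t, ht0, .inl ⟨by simp, by simp⟩⟩
  · exact ⟨t, ht0, .inr ⟨by simp, by simp⟩⟩

open Classical in
omit [NeZero g] hj in
variable (g) in
/-- The coordinates of the annulus that links the handle `0` to the handle `j`. -/
noncomputable def linkCoord (j : Fin g) (z : PolygonDisk) : ℝ × ℝ :=
  if z ∈ band g 3 (4 * (j : ℕ)) then
    ((bandHeight g 3 (4 * (j : ℕ)) z + 1) / 4, bandPos g 3 (4 * (j : ℕ)) z)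
  else ((3 - bandHeight g 1 (4 * (j : ℕ) + 2) z) / 4, 1 - bandPos g 1 (4 * (j : ℕ) + 2) z)

omit [NeZero g] hj in
theorem linkCoord_of_mem {z : PolygonDisk} (h : z ∈ band g 3 (4 * (j : ℕ))) :
    linkCoord g j z = ((bandHeight g 3 (4 * (j : ℕ)) z + 1) / 4, bandPos g 3 (4 * (j : ℕ)) z) :=
  if_pos h

omit [NeZero g] hj in
theorem linkCoord_of_mem' {z : PolygonDisk} (h : z ∈ band g 1 (4 * (j : ℕ) + 2)) :
    linkCoord g j z = ((3 - bandHeight g 1 (4 * (j : ℕ) + 2) z) / 4,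
      1 - bandPos g 1 (4 * (j : ℕ) + 2) z) :=
  if_neg fun h' => link_disjoint j h' h

theorem link_coord {z z' : PolygonDisk} (h : SideGluing g z z')
    (hz : z ∈ band g 3 (4 * (j : ℕ)) ∪ band g 1 (4 * (j : ℕ) + 2) ∨
      z' ∈ band g 3 (4 * (j : ℕ)) ∪ band g 1 (4 * (j : ℕ) + 2)) :
    (z ∈ band g 3 (4 * (j : ℕ)) ∪ band g 1 (4 * (j : ℕ) + 2) ∧
      z' ∈ band g 3 (4 * (j : ℕ)) ∪ band g 1 (4 * (j : ℕ) + 2)) ∧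
    (linkCoord g j z).2 = (linkCoord g j z').2 ∧
      ∃ m : ℤ, (linkCoord g j z).1 = (linkCoord g j z').1 + m := by
  obtain ⟨t, ht, h⟩ := link_gluing j hj h hz
  have ht' : 1 - t ∈ Set.Ioo (0 : ℝ) 1 := ⟨by linarith [ht.2], by linarith [ht.1]⟩
  rcases h with ⟨rfl, rfl⟩ | ⟨rfl, rfl⟩
  · obtain ⟨h1, h2, h3⟩ := upper_side (link_lt j hj) (link_sub_lt j) ht
    obtain ⟨h1', h2', h3'⟩ := upper_side (link_lt' j hj) (link_sub_lt' j) ht'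
    rw [linkCoord_of_mem j h1, linkCoord_of_mem' j h1', h2, h3, h2', h3']
    -- Across side 4j both bands have u = 1/2, so there is no shift.
    refine ⟨⟨.inl h1, .inr h1'⟩, ?_, 0, ?_⟩ <;> norm_num
  · obtain ⟨h1, h2, h3⟩ := lower_side (link_lt' j hj) (link_sub_lt' j) ht
    obtain ⟨h1', h2', h3'⟩ := lower_side (link_lt j hj) (link_sub_lt j) ht'
    rw [linkCoord_of_mem' j h1, linkCoord_of_mem j h1', h2, h3, h2', h3']
    -- Across side 1 the second band ends at u = 1 and the first begins at u = 0; here the annulus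
    -- closes up.
    refine ⟨⟨.inr h1, .inl h1'⟩, ?_, 1, ?_⟩ <;> norm_num

theorem continuousOn_linkCoord : ContinuousOn (linkCoord g j)
    (band g 3 (4 * (j : ℕ)) ∪ band g 1 (4 * (j : ℕ) + 2)) := by
  rintro z (hz | hz)
  · refine ContinuousAt.continuousWithinAt ?_
    have hn := (isOpen_band g 3 (4 * (j : ℕ))).mem_nhds hz
    have h1 := (continuousOn_bandHeight (link_lt j hj) (link_sub_lt j)).continuousAt hn
    have h2 := (continuous_bandPos g 3 (4 * (j : ℕ))).continuousAt (x := z)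
    refine (((h1.add (continuousAt_const (y := (1 : ℝ)))).div_const 4).prodMk h2).congr ?_
    filter_upwards [hn] with w hw
    exact (linkCoord_of_mem j hw).symm
  · refine ContinuousAt.continuousWithinAt ?_
    have hn := (isOpen_band g 1 (4 * (j : ℕ) + 2)).mem_nhds hz
    have h1 := (continuousOn_bandHeight (link_lt' j hj) (link_sub_lt' j)).continuousAt hn
    have h2 := (continuous_bandPos g 1 (4 * (j : ℕ) + 2)).continuousAt (x := z)
    refine ((((continuousAt_const (y := (3 : ℝ))).sub h1).div_const 4).prodMk
      ((continuousAt_const (y := (1 : ℝ))).sub h2)).congr ?_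
    filter_upwards [hn] with w hw
    exact (linkCoord_of_mem' j hw).symm

/-- The annulus that links the handle `0` to the handle `j`. -/
noncomputable def linkAnnulus : Annulus g where
  carrier := band g 3 (4 * (j : ℕ)) ∪ band g 1 (4 * (j : ℕ) + 2)
  u z := (linkCoord g j z).1
  s z := (linkCoord g j z).2
  J := periodize (linkMap j) fun b => (linkMap_zero j b).trans (linkMap_one j b).symm
  isOpen := (isOpen_band _ _ _).union (isOpen_band _ _ _)
  continuousOn_u := (continuousOn_linkCoord j hj).fst
  continuousOn_s := (continuousOn_linkCoord j hj).snd
  isClosed_core := by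
    have : {z | z ∈ band g 3 (4 * (j : ℕ)) ∪ band g 1 (4 * (j : ℕ) + 2) ∧
        (linkCoord g j z).2 ∈ Set.Icc (1 / 4 : ℝ) (3 / 4)} =
        bandPos g 3 (4 * (j : ℕ)) ⁻¹' Set.Icc (1 / 4 : ℝ) (3 / 4) ∪
        bandPos g 1 (4 * (j : ℕ) + 2) ⁻¹' Set.Icc (1 / 4 : ℝ) (3 / 4) := by
      ext z
      constructor
      · rintro ⟨h | h, h1⟩
        · rw [linkCoord_of_mem j h] at h1
          exact .inl h1
        · rw [linkCoord_of_mem' j h] at h1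
          exact .inr ⟨by linarith [h1.2], by linarith [h1.1]⟩
      · rintro (⟨h1, h2⟩ | ⟨h1, h2⟩)
        · have h : z ∈ band g 3 (4 * (j : ℕ)) :=
            mem_band_iff.2 ⟨by linarith, by linarith⟩
          exact ⟨.inl h, by rw [linkCoord_of_mem j h]; exact ⟨h1, h2⟩⟩
        · have h : z ∈ band g 1 (4 * (j : ℕ) + 2) :=
            mem_band_iff.2 ⟨by linarith, by linarith⟩
          exact ⟨.inr h, by rw [linkCoord_of_mem' j h]; constructor <;> dsimp only <;> linarith⟩
    rw [this]
    exact (isClosed_Icc.preimage (continuous_bandPos _ _ _)).union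
      (isClosed_Icc.preimage (continuous_bandPos _ _ _))
  periodic := periodize_add_int _ _
  J_coord z hz := by
    rcases hz with hz | hz
    · have h1 := bandHeight_mem (link_lt j hj) (link_sub_lt j) hz
      have h2 := mem_band_iff.1 hz
      rw [linkCoord_of_mem j hz, periodize_of_mem _ _ ⟨by linarith [h1.1], by linarith [h1.2]⟩,
        linkMap_of_le j (by linarith [h1.2]), clamp_of_mem ⟨h2.1.le, h2.2.le⟩,
        mul_div_cancel₀ _ four_ne_zero, add_sub_cancel_right,
        bandPoint_bandPos (link_lt j hj) (link_sub_lt j) hz]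
    · have h1 := bandHeight_mem (link_lt' j hj) (link_sub_lt' j) hz
      have h2 := mem_band_iff.1 hz
      rw [linkCoord_of_mem' j hz, periodize_of_mem _ _ ⟨by linarith [h1.2], by linarith [h1.1]⟩,
        linkMap_of_ge j (by linarith [h1.2]), clamp_of_mem ⟨by linarith [h2.2], by linarith [h2.1]⟩,
        mul_div_cancel₀ _ four_ne_zero, sub_sub_cancel, sub_sub_cancel,
        bandPoint_bandPos (link_lt' j hj) (link_sub_lt' j) hz]
  saturated z z' h :=
    ⟨fun hz => (link_coord j hj h (.inl hz)).1.2, fun hz => (link_coord j hj h (.inr hz)).1.1⟩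
  s_eq z z' h hz := (link_coord j hj h (.inl hz)).2.1
  u_eq z z' h hz := (link_coord j hj h (.inl hz)).2.2
  exists_rep a b hb := by
    have h1 := Int.fract_nonneg a
    have h2 := (Int.fract_lt_one a).le
    have h3 := Int.self_sub_floor a
    have hb' : 1 - b ∈ Set.Ioo (0 : ℝ) 1 := ⟨by linarith [hb.2], by linarith [hb.1]⟩
    rcases le_total (Int.fract a) (1 / 2) with h | h
    · have hv : 4 * Int.fract a - 1 ∈ Set.Icc (-1 : ℝ) 1 := by constructor <;> linarith
      have hm := bandPoint_mem (link_lt j hj) (link_sub_lt j) hb hv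
      refine ⟨_, .inl hm, ?_, -⌊a⌋, ?_⟩
      · rw [linkCoord_of_mem j hm, bandPos_bandPoint (link_lt j hj) (link_sub_lt j) hb hv]
      · rw [linkCoord_of_mem j hm, bandHeight_bandPoint (link_lt j hj) (link_sub_lt j) hb hv]
        push_cast
        linarith
    · have hv : 3 - 4 * Int.fract a ∈ Set.Icc (-1 : ℝ) 1 := by constructor <;> linarith
      have hm := bandPoint_mem (link_lt' j hj) (link_sub_lt' j) hb' hv
      refine ⟨_, .inr hm, ?_, -⌊a⌋, ?_⟩
      · rw [linkCoord_of_mem' j hm, bandPos_bandPoint (link_lt' j hj) (link_sub_lt' j) hb' hv,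
          sub_sub_cancel]
      · rw [linkCoord_of_mem' j hm, bandHeight_bandPoint (link_lt' j hj) (link_sub_lt' j) hb' hv]
        push_cast
        linarith
  s_mem z hz := by
    rcases hz with hz | hz
    · have h2 := mem_band_iff.1 hz
      rw [linkCoord_of_mem j hz]
      exact h2
    · have h2 := mem_band_iff.1 hz
      rw [linkCoord_of_mem' j hz]
      constructor <;> dsimp only <;> linarith [h2.1, h2.2]

end Link

end StandardSurface

/-! ### The action of the twists on the fundamental group -/

theorem FundamentalGroup.mapOfEq_fromPath {X Y : Type*} [TopologicalSpace X] [TopologicalSpace Y]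
    (f : C(X, Y)) {x : X} {y : Y} (h : f x = y) (γ : Path x x) (δ : Path y y)
    (hδ : ∀ t, δ t = f (γ t)) :
    FundamentalGroup.mapOfEq f h (FundamentalGroup.fromPath (Path.Homotopic.Quotient.mk γ)) =
      FundamentalGroup.fromPath (Path.Homotopic.Quotient.mk δ) := by
  subst h
  rw [FundamentalGroup.mapOfEq_apply]
  exact congrArg Path.Homotopic.Quotient.mk (Path.ext (funext fun t => (hδ t).symm))

/-- A twisted side passes through two bands, so it has no single lift to the disk. Its halves lift
separately, and the class is the composite of two classes that depend only on end points in the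
disk. -/
theorem Path.mk_eq_through_trans {X Y : Type*} [TopologicalSpace X] [TopologicalSpace Y]
    [SimplyConnectedSpace Y] (K : C(Y, X)) {x y m : X} (γ : Path x y) (δ δ' : C(ℝ, Y))
    (h : ∀ t ∈ Set.Icc (0 : ℝ) (1 / 2), γ.extend t = K (δ t))
    (h' : ∀ t ∈ Set.Icc (1 / 2 : ℝ) 1, γ.extend t = K (δ' t)) {z₀ z₁ z₂ z₃ : Y}
    (h0 : δ 0 = z₀) (h1 : δ (1 / 2) = z₁) (h2 : δ' (1 / 2) = z₂) (h3 : δ' 1 = z₃)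
    (hx : x = K z₀) (hm : m = K z₁) (hm' : m = K z₂) (hy : y = K z₃) :
    Path.Homotopic.Quotient.mk γ =
      (through K z₀ z₁ hx hm).trans (through K z₂ z₃ hm' hy) := by
  subst h0 h1 h2 h3
  let L : C(ℝ, X) := ⟨γ.extend, γ.continuous_extend⟩
  have ex : x = L 0 := γ.extend_zero.symm
  have ey : y = L 1 := γ.extend_one.symm
  have em : m = L (1 / 2) := hm.trans (h _ ⟨by norm_num, le_rfl⟩).symm
  have e1 : through K (δ 0) (δ (1 / 2)) hx hm = through L 0 (1 / 2) ex em :=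
    through_congr K L _ _ _ _ ((StandardSurface.linePath 0 (1 / 2)).map δ.continuous)
      (StandardSurface.linePath 0 (1 / 2)) fun t =>
        (h _ (StandardSurface.linePath_mem (by norm_num) (by norm_num) t)).symm
  have e2 : through K (δ' (1 / 2)) (δ' 1) hm' hy = through L (1 / 2) 1 em ey :=
    through_congr K L _ _ _ _ ((StandardSurface.linePath (1 / 2) 1).map δ'.continuous)
      (StandardSurface.linePath (1 / 2) 1) fun t =>
        (h' _ (StandardSurface.linePath_mem (by norm_num) (by norm_num) t)).symm
  rw [e1, e2, through_trans]
  refine (through_eq_mk L ex ey (StandardSurface.linePath 0 1) γ fun t => ?_).symm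
  have : StandardSurface.linePath 0 1 t = t := by simp [StandardSurface.linePath]
  rw [this]
  exact (γ.extend_apply t.2).symm

namespace StandardSurface

variable {g : ℕ}

/-- The action of a homeomorphism that fixes the base point on the fundamental group. -/
noncomputable def inducedHom (φ : StandardSurface g ≃ₜ StandardSurface g)
    (h : φ (base g) = base g) : FundamentalGroup (StandardSurface g) (base g) →*
      FundamentalGroup (StandardSurface g) (base g) :=
  FundamentalGroup.mapOfEq (φ : C(StandardSurface g, StandardSurface g)) h

theorem inducedHom_fromPath (φ : StandardSurface g ≃ₜ StandardSurface g)
    (h : φ (base g) = base g) (γ δ : Path (base g) (base g)) (hδ : ∀ t, δ t = φ (γ t)) :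
    inducedHom φ h (FundamentalGroup.fromPath (Path.Homotopic.Quotient.mk γ)) =
      FundamentalGroup.fromPath (Path.Homotopic.Quotient.mk δ) :=
  FundamentalGroup.mapOfEq_fromPath _ h γ δ hδ

/-- The image of a loop under a homeomorphism that fixes the base point. -/
noncomputable def imageLoop (φ : StandardSurface g ≃ₜ StandardSurface g)
    (h : φ (base g) = base g) (γ : Path (base g) (base g)) : Path (base g) (base g) :=
  (γ.map φ.continuous).cast h.symm h.symm

theorem inducedHom_mk (φ : StandardSurface g ≃ₜ StandardSurface g)
    (h : φ (base g) = base g) (γ : Path (base g) (base g)) :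
    inducedHom φ h (FundamentalGroup.fromPath (Path.Homotopic.Quotient.mk γ)) =
      FundamentalGroup.fromPath (Path.Homotopic.Quotient.mk (imageLoop φ h γ)) :=
  inducedHom_fromPath _ _ _ _ fun _ => rfl

variable [NeZero g]

theorem vertex_notMem_band {p q : ℤ} : boundaryPoint g 0 ∉ band g p q := by
  intro h
  have := (side_of_mem_band (N := 0) (t := 0) (by simp) (by simpa using h)).1.1
  exact lt_irrefl _ this

theorem side_notMem_band {p q N : ℤ} (hp : ∀ m : ℤ, N + 4 * g * m ≠ p)
    (hq : ∀ m : ℤ, N + 4 * g * m ≠ q) (t : unitInterval) :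
    boundaryPoint g (N + t) ∉ band g p q := by
  intro h
  obtain ⟨-, m, hm | hm⟩ := side_of_mem_band t.2 h
  · exact hq m hm
  · exact hp m hm

/-! ### The handle twists on the sides. -/

section Handle

variable (i : Fin g) (e : Fin 2)

theorem handleTwist_base : (handleAnnulus i e).twist 1 (base g) = base g :=
  (handleAnnulus i e).twist_of_notMem 1 vertex_notMem_band

theorem handleAnnulus_J {a : ℝ} (ha : a ∈ Set.Icc (0 : ℝ) 1) (t : unitInterval) :
    (handleAnnulus i e).J (a, t) = proj g (bandPoint g (handleSide i e) (handleSide i e + 2)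
      (1 - t) (2 * a - 1)) := by
  have h : (handleAnnulus i e).J (a, t) = handleMap i e (a, t) :=
    periodize_of_mem (handleMap i e)
      (fun b => (handleMap_zero i e b).trans (handleMap_one i e b).symm) ha _
  rw [h, handleMap_apply, clamp_of_mem t.2]

/-- The side is the transversal u = 0, and its image runs once through the band, from the initial
vertex of the first side to that of the partner. As a path of the disk it has the class of the
boundary arc between them. -/
theorem handleTwist_crossing (γ : Path (base g) (base g))
    (hγ : ∀ t, γ t = edgePoint g (handleSide i e + t))
    (h : base g = edgePoint g (handleSide i e))
    (h' : base g = edgePoint g ((handleSide i e + 2 : ℤ) : ℝ)) :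
    inducedHom _ (handleTwist_base i e)
      (FundamentalGroup.fromPath (Path.Homotopic.Quotient.mk γ)) =
      arcLoop g (handleSide i e) ((handleSide i e + 2 : ℤ) : ℝ) h h' := by
  rw [inducedHom_mk]
  have hd : Continuous fun t : ℝ => bandPoint g (handleSide i e) (handleSide i e + 2)
      (1 - t) (2 * ramp t - 1) := by
    have h2 : Continuous fun t : ℝ => (1 - t, 2 * ramp t - 1) := by
      have := continuous_ramp
      fun_prop
    exact ((continuous_bandPoint g (handleSide i e) (handleSide i e + 2)).comp h2).congr
      fun x => rfl
  have h0 : bandPoint g (handleSide i e) (handleSide i e + 2) (1 - (0 : ℝ)) (2 * ramp 0 - 1) =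
      boundaryPoint g (handleSide i e) := by
    rw [ramp_of_le (by norm_num), mul_zero, zero_sub, bandPoint_neg_one]
    congr 1; ring
  have h1 : bandPoint g (handleSide i e) (handleSide i e + 2) (1 - (1 : ℝ)) (2 * ramp 1 - 1) =
      boundaryPoint g ((handleSide i e + 2 : ℤ) : ℝ) := by
    rw [ramp_of_ge (by norm_num), show (2 * 1 - 1 : ℝ) = 1 by norm_num, bandPoint_one]
    congr 1; ring
  refine congrArg FundamentalGroup.fromPath ?_
  refine Eq.trans ?_ (diskClass_boundary g _ _ (h.trans (edgePoint_eq g _))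
    (h'.trans (edgePoint_eq g _)))
  refine (through_eq_mk (proj g) _ _ (((linePath 0 1).map hd).cast h0.symm h1.symm) _ ?_).symm
  intro t
  have hl : linePath 0 1 t = t := by simp [linePath]
  have := (handleAnnulus i e).twist_crossing 1 (handleTwist_base i e) 0 γ (fun t => by
    rw [hγ, handleAnnulus_J i e (by simp), show (2 * 0 - 1 : ℝ) = -1 by norm_num,
      bandPoint_neg_one, edgePoint_eq]
    congr 2; ring) t
  rw [Int.cast_one, one_mul, zero_add, handleAnnulus_J i e (ramp_mem t)] at this
  refine this.trans ?_
  simp only [Path.cast_coe, Path.map_coe, Function.comp_apply, hl]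

theorem handleTwist_fixed {N : ℤ} (hp : ∀ m : ℤ, N + 4 * g * m ≠ handleSide i e)
    (hq : ∀ m : ℤ, N + 4 * g * m ≠ handleSide i e + 2) (γ : Path (base g) (base g))
    (hγ : ∀ t, γ t = edgePoint g (N + t)) :
    inducedHom _ (handleTwist_base i e)
      (FundamentalGroup.fromPath (Path.Homotopic.Quotient.mk γ)) =
      FundamentalGroup.fromPath (Path.Homotopic.Quotient.mk γ) := by
  refine inducedHom_fromPath _ _ _ _ fun t => ?_
  rw [hγ, edgePoint_eq]
  exact ((handleAnnulus i e).twist_of_notMem 1 (side_notMem_band hp hq t)).symm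

theorem handleTwist_genA : inducedHom _ (handleTwist_base i 0) (genA g i) =
    genB g i * genA g i := by
  have h := handleTwist_crossing i 0 (loopA g i) (fun t => by
    simp only [handleSide]
    push_cast
    simp [loopA]) (by simpa [handleSide] using base_eq_zero g i)
    (by simpa [handleSide] using base_eq_two g i)
  refine h.trans ?_
  rw [← arcLoop_one, ← arcLoop_two, arcLoop_mul]
  exact arcLoop_congr _ _ _ (by simp [handleSide]) (by simp [handleSide])

theorem handleTwist_genB : inducedHom _ (handleTwist_base i 1) (genB g i) =
    (genA g i)⁻¹ * genB g i := by
  have h := handleTwist_crossing i 1 (loopB g i) (fun t => by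
    simp only [handleSide]
    push_cast
    simp [loopB]) (by simpa [handleSide] using base_eq_one g i)
    (by
      have := base_eq_three g i
      convert! this using 2
      simp only [handleSide]
      push_cast
      simp
      ring)
  refine h.trans ?_
  rw [← arcLoop_two, ← arcLoop_three, arcLoop_mul]
  refine arcLoop_congr _ _ _ (by simp [handleSide]) ?_
  simp only [handleSide]
  push_cast
  simp
  ring

theorem handleTwist_genA_of_ne {k : Fin g} (hk : (k, (0 : Fin 2)) ≠ (i, e)) :
    inducedHom _ (handleTwist_base i e) (genA g k) = genA g k := by
  refine handleTwist_fixed i e (N := 4 * (k : ℕ)) ?_ ?_ (loopA g k) (fun t => by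
    push_cast
    rfl)
  · intro m hm
    obtain ⟨h1, h2, -⟩ := side_unique (i := k) (i' := i) (c := 0) (c' := (e : ℕ))
      (m := m) (by omega) (by omega) (by rw [handleSide] at hm; linarith)
    exact hk (Prod.ext h1 (Fin.ext (by simp; omega)))
  · intro m hm
    obtain ⟨h1, h2, -⟩ := side_unique (i := k) (i' := i) (c := 0) (c' := (e : ℕ) + 2)
      (m := m) (by omega) (by omega) (by rw [handleSide] at hm; linarith)
    omega

theorem handleTwist_genB_of_ne {k : Fin g} (hk : (k, (1 : Fin 2)) ≠ (i, e)) :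
    inducedHom _ (handleTwist_base i e) (genB g k) = genB g k := by
  refine handleTwist_fixed i e (N := 4 * (k : ℕ) + 1) ?_ ?_ (loopB g k) (fun t => by
    push_cast
    rfl)
  · intro m hm
    obtain ⟨h1, h2, -⟩ := side_unique (i := k) (i' := i) (c := 1) (c' := (e : ℕ))
      (m := m) (by omega) (by omega) (by rw [handleSide] at hm; linarith)
    exact hk (Prod.ext h1 (Fin.ext (by simp; omega)))
  · intro m hm
    obtain ⟨h1, h2, -⟩ := side_unique (i := k) (i' := i) (c := 1) (c' := (e : ℕ) + 2)
      (m := m) (by omega) (by omega) (by rw [handleSide] at hm; linarith)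
    omega

end Handle

/-! ### The link twists on the sides. -/

section Link

variable (j : Fin g) (hj : j ≠ 0)

theorem linkTwist_base : (linkAnnulus j hj).twist (-1) (base g) = base g :=
  (linkAnnulus j hj).twist_of_notMem (-1) fun h =>
    h.elim vertex_notMem_band vertex_notMem_band

theorem linkTwist_fixed {N : ℤ} (h1 : ∀ m : ℤ, N + 4 * g * m ≠ 3)
    (h2 : ∀ m : ℤ, N + 4 * g * m ≠ 4 * (j : ℕ)) (h3 : ∀ m : ℤ, N + 4 * g * m ≠ 1)
    (h4 : ∀ m : ℤ, N + 4 * g * m ≠ 4 * (j : ℕ) + 2) (γ : Path (base g) (base g))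
    (hγ : ∀ t, γ t = edgePoint g (N + t)) :
    inducedHom _ (linkTwist_base j hj)
      (FundamentalGroup.fromPath (Path.Homotopic.Quotient.mk γ)) =
      FundamentalGroup.fromPath (Path.Homotopic.Quotient.mk γ) := by
  refine inducedHom_fromPath _ _ _ _ fun t => ?_
  rw [hγ, edgePoint_eq]
  exact ((linkAnnulus j hj).twist_of_notMem (-1) fun h =>
    h.elim (side_notMem_band h1 h2 t) (side_notMem_band h3 h4 t)).symm

theorem linkTwist_genA_of_ne {k : Fin g} (hk : k ≠ j) :
    inducedHom _ (linkTwist_base j hj) (genA g k) = genA g k := by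
  have h0 : ((0 : Fin g) : ℕ) = 0 := rfl
  refine linkTwist_fixed j hj (N := 4 * (k : ℕ)) ?_ ?_ ?_ ?_ (loopA g k) (fun t => by
    push_cast
    rfl) <;> intro m hm
  · obtain ⟨h1, h2, -⟩ := side_unique (i := k) (i' := 0) (c := 0) (c' := 3)
      (m := m) (by omega) (by omega) (by rw [h0]; push_cast; linarith)
    omega
  · obtain ⟨h1, h2, -⟩ := side_unique (i := k) (i' := j) (c := 0) (c' := 0)
      (m := m) (by omega) (by omega) (by linarith)
    exact hk h1
  · obtain ⟨h1, h2, -⟩ := side_unique (i := k) (i' := 0) (c := 0) (c' := 1)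
      (m := m) (by omega) (by omega) (by rw [h0]; push_cast; linarith)
    omega
  · obtain ⟨h1, h2, -⟩ := side_unique (i := k) (i' := j) (c := 0) (c' := 2)
      (m := m) (by omega) (by omega) (by linarith)
    omega

theorem linkTwist_genB_of_ne {k : Fin g} (hk : k ≠ 0) :
    inducedHom _ (linkTwist_base j hj) (genB g k) = genB g k := by
  have h0 : ((0 : Fin g) : ℕ) = 0 := rfl
  refine linkTwist_fixed j hj (N := 4 * (k : ℕ) + 1) ?_ ?_ ?_ ?_ (loopB g k) (fun t => by
    push_cast
    rfl) <;> intro m hm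
  · obtain ⟨h1, h2, -⟩ := side_unique (i := k) (i' := 0) (c := 1) (c' := 3)
      (m := m) (by omega) (by omega) (by rw [h0]; push_cast; linarith)
    omega
  · obtain ⟨h1, h2, -⟩ := side_unique (i := k) (i' := j) (c := 1) (c' := 0)
      (m := m) (by omega) (by omega) (by linarith)
    omega
  · obtain ⟨h1, h2, -⟩ := side_unique (i := k) (i' := 0) (c := 1) (c' := 1)
      (m := m) (by omega) (by omega) (by rw [h0]; push_cast; linarith)
    exact hk h1
  · obtain ⟨h1, h2, -⟩ := side_unique (i := k) (i' := j) (c := 1) (c' := 2)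
      (m := m) (by omega) (by omega) (by linarith)
    omega

theorem linkAnnulus_J_of_le {a : ℝ} (h0 : 0 ≤ a) (ha : a ≤ 1 / 2) {t : ℝ}
    (ht : t ∈ Set.Icc (0 : ℝ) 1) : (linkAnnulus j hj).J (a, t) =
      proj g (bandPoint g 3 (4 * (j : ℕ)) t (4 * a - 1)) := by
  have h : (linkAnnulus j hj).J (a, t) = linkMap j (a, t) :=
    periodize_of_mem (linkMap j)
      (fun b => (linkMap_zero j b).trans (linkMap_one j b).symm) ⟨h0, by linarith⟩ _
  rw [h, linkMap_of_le j ha, clamp_of_mem ht]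

theorem linkAnnulus_J_of_ge {a : ℝ} (ha : 1 / 2 ≤ a) (h1 : a ≤ 1) {t : ℝ}
    (ht : t ∈ Set.Icc (0 : ℝ) 1) : (linkAnnulus j hj).J (a, t) =
      proj g (bandPoint g 1 (4 * (j : ℕ) + 2) (1 - t) (3 - 4 * a)) := by
  have h : (linkAnnulus j hj).J (a, t) = linkMap j (a, t) :=
    periodize_of_mem (linkMap j)
      (fun b => (linkMap_zero j b).trans (linkMap_one j b).symm) ⟨by linarith, h1⟩ _
  rw [h, linkMap_of_ge j ha, clamp_of_mem ht]

theorem linkTwist_crossing (a : ℝ) (γ : Path (base g) (base g))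
    (hγ : ∀ t, γ t = (linkAnnulus j hj).J (a, t)) {t : ℝ} (ht : t ∈ Set.Icc (0 : ℝ) 1) :
    (imageLoop _ (linkTwist_base j hj) γ).extend t = (linkAnnulus j hj).J (a - ramp t, t) := by
  rw [Path.extend_apply _ ht]
  have := (linkAnnulus j hj).twist_crossing (-1) (linkTwist_base j hj) a γ hγ ⟨t, ht⟩
  refine this.trans ?_
  congr 2
  push_cast
  ring

theorem base_eq_of_int (k : ℤ) {θ : ℝ} (h : θ = k) : base g = edgePoint g θ := h ▸ base_eq_int k

-- The crossing point can be slid along the glued sides from the midpoint to a vertex, because the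
-- two pieces of side added in between cancel.
omit [NeZero g] in
theorem arc_splice {a b₀ b b₀' b' c : ℝ} {x m₀ m y : StandardSurface g} (hx : x = edgePoint g a)
    (h₀ : m₀ = edgePoint g b₀) (h₀' : m₀ = edgePoint g b₀') (hm : m = edgePoint g b)
    (hm' : m = edgePoint g b') (hy : y = edgePoint g c)
    (h : arc g b₀ b h₀ hm = arc g b₀' b' h₀' hm') :
    (arc g a b hx hm).trans (arc g b' c hm' hy) =
      (arc g a b₀ hx h₀).trans (arc g b₀' c h₀' hy) := by
  rw [← arc_trans g hx h₀ hm, h, Path.Homotopic.Quotient.trans_assoc, arc_trans]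

omit [NeZero g] in
theorem continuous_bandPoint_ramp (p q : ℤ) {f h : ℝ × ℝ → ℝ} (hf : Continuous f)
    (hh : Continuous h) :
    Continuous fun t : ℝ => bandPoint g p q (f (t, ramp t)) (h (t, ramp t)) := by
  have h1 : Continuous fun t : ℝ => (t, ramp t) := continuous_id.prodMk continuous_ramp
  exact ((continuous_bandPoint g p q).comp ((hf.comp h1).prodMk (hh.comp h1))).congr fun x => rfl

/-- The side a_j is the transversal u = 1/2. Turned backwards, it first runs through the first band
to the midpoint of side 3, reappears at the midpoint of side 1, and returns through the second band.
Sliding the crossing to the vertices 4 and 1 gives the two arcs. -/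
theorem linkTwist_genA :
    inducedHom _ (linkTwist_base j hj) (genA g j) =
      arcLoop g 1 (4 * (j : ℕ) + 2) (base_eq_of_int 1 (by simp)) (base_eq_two g j) *
        arcLoop g (4 * (j : ℕ)) 4 (base_eq_zero g j) (base_eq_of_int 4 (by simp)) := by
  refine (inducedHom_mk _ _ (loopA g j)).trans ?_
  have hm : edgePoint g (7 / 2) = edgePoint g (3 / 2) := by
    have h := edgePoint_b g 0 (1 / 2) (by norm_num)
    norm_num at h
    exact h.symm
  have hγ (t : unitInterval) : loopA g j t = (linkAnnulus j hj).J (1 / 2, t) := by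
    rw [linkAnnulus_J_of_le j hj (by norm_num) le_rfl t.2,
      show (4 * (1 / 2) - 1 : ℝ) = 1 by norm_num, bandPoint_one]
    simp [loopA, edgePoint_eq]
  have h4 : base g = edgePoint g 4 := base_eq_of_int 4 (by simp)
  have h1 : base g = edgePoint g 1 := base_eq_of_int 1 (by simp)
  have key := Path.mk_eq_through_trans (proj g)
    (imageLoop _ (linkTwist_base j hj) (loopA g j))
    ⟨_, continuous_bandPoint_ramp (g := g) 3 (4 * (j : ℕ)) (f := fun x => x.1)
      (h := fun x => 1 - 4 * x.2) (by fun_prop) (by fun_prop)⟩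
    ⟨_, continuous_bandPoint_ramp (g := g) 1 (4 * (j : ℕ) + 2) (f := fun x => 1 - x.1)
      (h := fun x => 4 * x.2 - 3) (by fun_prop) (by fun_prop)⟩
    (fun t ht => by
      have h0 := (ramp_mem t).1
      have h2 := ramp_le_half ht.2
      rw [linkTwist_crossing j hj (1 / 2) _ hγ ⟨ht.1, by linarith [ht.2]⟩,
        linkAnnulus_J_of_le j hj (by linarith) (by linarith) ⟨ht.1, by linarith [ht.2]⟩]
      refine congrArg (fun v => proj g (bandPoint g 3 (4 * (j : ℕ)) t v)) ?_
      ring)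
    (fun t ht => by
      have h0 := (ramp_mem t).2
      have h2 := half_le_ramp ht.1
      rw [linkTwist_crossing j hj (1 / 2) _ hγ ⟨by linarith [ht.1], ht.2⟩,
        -- In the second half the coordinate 1/2 - ramp is at most 0; adding one turn brings it into
        -- the range of the second band.
        ← (linkAnnulus j hj).periodic _ _ 1, Int.cast_one,
        linkAnnulus_J_of_ge j hj (by linarith) (by linarith) ⟨by linarith [ht.1], ht.2⟩]
      refine congrArg (fun v => proj g (bandPoint g 1 (4 * (j : ℕ) + 2) (1 - t) v)) ?_
      ring)
    (z₀ := boundaryPoint g (4 * (j : ℕ))) (z₁ := boundaryPoint g (7 / 2))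
    (z₂ := boundaryPoint g (3 / 2)) (z₃ := boundaryPoint g (4 * (j : ℕ) + 2))
    (by
      dsimp only [ContinuousMap.coe_mk]
      rw [ramp_of_le (by norm_num), mul_zero, sub_zero, bandPoint_one]
      congr 1; push_cast; ring)
    (by
      dsimp only [ContinuousMap.coe_mk]
      rw [ramp_half, show (1 - 4 * (1 / 2) : ℝ) = -1 by norm_num, bandPoint_neg_one]
      congr 1; push_cast; ring)
    (by
      dsimp only [ContinuousMap.coe_mk]
      rw [ramp_half, show (4 * (1 / 2) - 3 : ℝ) = -1 by norm_num, bandPoint_neg_one]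
      congr 1; push_cast; ring)
    (by
      dsimp only [ContinuousMap.coe_mk]
      rw [ramp_of_ge (by norm_num), show (4 * 1 - 3 : ℝ) = 1 by norm_num, bandPoint_one]
      congr 1; push_cast; ring)
    (base_eq_zero g j) (edgePoint_eq g (7 / 2)) (hm.trans (edgePoint_eq g _)) (base_eq_two g j)
  refine key.trans ((congrArg₂ Path.Homotopic.Quotient.trans (diskClass_boundary g _ _ _ _)
    (diskClass_boundary g _ _ _ _)).trans (arc_splice _ h4 h1 _ _ _ ?_))
  have e := arc_b g 0 (s := 0) (t := 1 / 2) (by simp) (by norm_num)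
    (x := base g) (x' := edgePoint g (7 / 2)) (by simpa using h1)
    (by norm_num; exact hm)
  rw [arc_congr g (η := 1) (η' := 3 / 2) _ _ (by simp) (by norm_num),
    arc_congr g (θ := 4 * ((0 : Fin g) : ℕ) + 4 - 0) (η := 4) (η' := 7 / 2) _ _ (by simp)
      (by norm_num)] at e
  exact e.symm

/-- The side b_0 is the transversal u = 1. It runs backwards through the second band to the midpoint
of side 4j + 2, reappears on side 4j, and finishes in the first band; the crossing is slid to the
vertices 4j + 3 and 4j. -/
theorem linkTwist_genB :
    inducedHom _ (linkTwist_base j hj) (genB g 0) =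
      arcLoop g (4 * (j : ℕ)) 3 (base_eq_zero g j) (base_eq_of_int 3 (by simp)) *
        arcLoop g 1 (4 * (j : ℕ) + 3) (base_eq_of_int 1 (by simp)) (base_eq_three g j) := by
  refine (inducedHom_mk _ _ (loopB g 0)).trans ?_
  have hm : edgePoint g (4 * (j : ℕ) + 5 / 2) = edgePoint g (4 * (j : ℕ) + 1 / 2) := by
    rw [edgePoint_a g j (1 / 2) (by norm_num)]
    congr 1; ring
  have hγ (t : unitInterval) : loopB g 0 t = (linkAnnulus j hj).J (1, t) := by
    rw [linkAnnulus_J_of_ge j hj (by norm_num) le_rfl t.2,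
      show (3 - 4 * 1 : ℝ) = -1 by norm_num, bandPoint_neg_one, ← edgePoint_eq]
    simp only [loopB, Path.coe_mk']
    simp
  have h3 : base g = edgePoint g 3 := base_eq_of_int 3 (by simp)
  have h1 : base g = edgePoint g 1 := base_eq_of_int 1 (by simp)
  have key := Path.mk_eq_through_trans (proj g)
    (imageLoop _ (linkTwist_base j hj) (loopB g 0))
    ⟨_, continuous_bandPoint_ramp (g := g) 1 (4 * (j : ℕ) + 2) (f := fun x => 1 - x.1)
      (h := fun x => 4 * x.2 - 1) (by fun_prop) (by fun_prop)⟩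
    ⟨_, continuous_bandPoint_ramp (g := g) 3 (4 * (j : ℕ)) (f := fun x => x.1)
      (h := fun x => 3 - 4 * x.2) (by fun_prop) (by fun_prop)⟩
    (fun t ht => by
      have h0 := (ramp_mem t).1
      have h2 := ramp_le_half ht.2
      rw [linkTwist_crossing j hj 1 _ hγ ⟨ht.1, by linarith [ht.2]⟩,
        linkAnnulus_J_of_ge j hj (by linarith) (by linarith) ⟨ht.1, by linarith [ht.2]⟩]
      refine congrArg (fun v => proj g (bandPoint g 1 (4 * (j : ℕ) + 2) (1 - t) v)) ?_
      ring)
    (fun t ht => by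
      have h0 := (ramp_mem t).2
      have h2 := half_le_ramp ht.1
      rw [linkTwist_crossing j hj 1 _ hγ ⟨by linarith [ht.1], ht.2⟩,
        linkAnnulus_J_of_le j hj (by linarith) (by linarith) ⟨by linarith [ht.1], ht.2⟩]
      refine congrArg (fun v => proj g (bandPoint g 3 (4 * (j : ℕ)) t v)) ?_
      ring)
    (z₀ := boundaryPoint g 1) (z₁ := boundaryPoint g (4 * (j : ℕ) + 5 / 2))
    (z₂ := boundaryPoint g (4 * (j : ℕ) + 1 / 2)) (z₃ := boundaryPoint g 3)
    (by
      dsimp only [ContinuousMap.coe_mk]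
      rw [ramp_of_le (by norm_num), mul_zero, zero_sub, bandPoint_neg_one]
      congr 1; push_cast; ring)
    (by
      dsimp only [ContinuousMap.coe_mk]
      rw [ramp_half, show (4 * (1 / 2) - 1 : ℝ) = 1 by norm_num, bandPoint_one]
      congr 1; push_cast; ring)
    (by
      dsimp only [ContinuousMap.coe_mk]
      rw [ramp_half, show (3 - 4 * (1 / 2) : ℝ) = 1 by norm_num, bandPoint_one]
      congr 1; push_cast; ring)
    (by
      dsimp only [ContinuousMap.coe_mk]
      rw [ramp_of_ge (by norm_num), show (3 - 4 * 1 : ℝ) = -1 by norm_num, bandPoint_neg_one]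
      congr 1; push_cast; ring)
    h1 (edgePoint_eq g _) (hm.trans (edgePoint_eq g _)) h3
  refine key.trans ((congrArg₂ Path.Homotopic.Quotient.trans (diskClass_boundary g _ _ _ _)
    (diskClass_boundary g _ _ _ _)).trans
      (arc_splice _ (base_eq_three g j) (base_eq_zero g j) _ _ _ ?_))
  have e := arc_a g j (s := 0) (t := 1 / 2) (by simp) (by norm_num)
    (x := base g) (x' := edgePoint g (4 * (j : ℕ) + 5 / 2)) (by simpa using base_eq_zero g j) hm
  rw [arc_congr g (η := 4 * (j : ℕ)) (η' := 4 * (j : ℕ) + 1 / 2) _ _ (by simp) rfl,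
    arc_congr g (θ := 4 * (j : ℕ) + 3 - 0) (η := 4 * (j : ℕ) + 3) (η' := 4 * (j : ℕ) + 5 / 2) _ _
      (by simp) (by ring)] at e
  exact e.symm

end Link

end StandardSurface

/-! ### Reduction of the values of a homomorphism to a cyclic group -/

open Relation (ReflTransGen)

/-- The effect of the two handle twists on the values at the generators of one handle. -/
inductive PairMove {M : Type*} [AddCommGroup M] : M × M → M × M → Prop
  | add (a b : M) : PairMove (a, b) (a + b, b)
  | sub (a b : M) : PairMove (a, b) (a, b - a)

/-- The effect of the handle twists and the link twists on the values at the generators. -/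
inductive TwistMove {M : Type*} [AddCommGroup M] {g : ℕ} [NeZero g] :
    (Fin g → M) × (Fin g → M) → (Fin g → M) × (Fin g → M) → Prop
  | add (α β : Fin g → M) (i : Fin g) :
      TwistMove (α, β) (Function.update α i (α i + β i), β)
  | sub (α β : Fin g → M) (i : Fin g) :
      TwistMove (α, β) (α, Function.update β i (β i - α i))
  | link (α β : Fin g → M) (j : Fin g) (hj : j ≠ 0) :
      TwistMove (α, β) (Function.update α j (α j + (β j - α 0)),
        Function.update β 0 (β 0 + (β j - α 0)))

/-- The moves preserve the subgroup generated by a pair. Testing against a subgroup H extracts the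
divisibility needed later without naming a greatest common divisor. -/
theorem PairMove.mem_iff {M : Type*} [AddCommGroup M] (H : AddSubgroup M) {p q : M × M}
    (h : ReflTransGen PairMove p q) : (p.1 ∈ H ∧ p.2 ∈ H) ↔ (q.1 ∈ H ∧ q.2 ∈ H) := by
  induction h with
  | refl => rfl
  | tail _ h ih =>
    rw [ih]
    cases h with
    | add a b => exact and_congr_left fun hb => (H.add_mem_cancel_right hb).symm
    | sub a b =>
      refine and_congr_right fun ha => ?_
      rw [sub_eq_add_neg, H.add_mem_cancel_right (H.neg_mem ha)]

/-! ### The Euclidean algorithm on values in ℤ/n. -/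

section Euclid

variable {n : ℕ} [NeZero n]

/-- Only additions of b are available, but modulo n every multiple, negative ones included, is a
natural multiple. -/
theorem PairMove.reach_add (a b c : ZMod n) :
    ReflTransGen PairMove (a, b) (a + c * b, b) := by
  have key (k : ℕ) : ReflTransGen PairMove (a, b) (a + k * b, b) := by
    induction k with
    | zero => simpa using ReflTransGen.refl
    | succ k ih =>
      refine ih.tail ?_
      convert PairMove.add (a + k * b) b using 2
      push_cast; ring
  simpa using key c.val

theorem PairMove.reach_sub (a b c : ZMod n) :
    ReflTransGen PairMove (a, b) (a, b + c * a) := by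
  have key (k : ℕ) : ReflTransGen PairMove (a, b) (a, b - k * a) := by
    induction k with
    | zero => simpa using ReflTransGen.refl
    | succ k ih =>
      refine ih.tail ?_
      convert PairMove.sub a (b - k * a) using 2
      push_cast; ring
  simpa using key (-c).val

/-- This is Euclid's algorithm on representatives: the second entry is replaced by the remainder of
the first modulo it, until it vanishes. -/
theorem PairMove.exists_reach (a b : ZMod n) :
    ∃ f : ZMod n, ReflTransGen PairMove (a, b) (f, 0) := by
  induction h : b.val using Nat.strong_induction_on generalizing a b with
  | _ m ih =>
    by_cases hb : b = 0
    · exact ⟨a, hb ▸ .refl⟩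
    have hm : 0 < b.val := Nat.pos_of_ne_zero fun h0 => hb ((ZMod.val_eq_zero b).1 h0)
    set r : ZMod n := ((a.val % b.val : ℕ) : ZMod n) with hr
    have hlt : a.val % b.val < b.val := Nat.mod_lt _ hm
    have hv : r.val = a.val % b.val := ZMod.val_cast_of_lt (hlt.trans b.val_lt)
    obtain ⟨q, hq⟩ : ∃ q : ZMod n, a = r + q * b := by
      refine ⟨((a.val / b.val : ℕ) : ZMod n), ?_⟩
      conv_lhs => rw [← ZMod.natCast_zmod_val a, ← Nat.mod_add_div' a.val b.val]
      push_cast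
      rw [ZMod.natCast_zmod_val b]
    obtain ⟨f, hf⟩ := ih r.val (by rw [hv, ← h]; exact hlt) (r - b) r rfl
    -- Passing to r - b instead of r makes one further addition turn the second entry into r, so no
    -- exchange of entries is needed.
    have h1 := PairMove.reach_add a b (-q - 1)
    have h2 := PairMove.reach_sub (r - b) b 1
    refine ⟨f, h1.trans (ReflTransGen.trans ?_ hf)⟩
    convert h2 using 2
    · rw [hq]; ring
    · ring

variable {g : ℕ} [NeZero g]

theorem TwistMove.of_pair {M : Type*} [AddCommGroup M] (α β : Fin g → M) (i : Fin g) {q : M × M}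
    (h : ReflTransGen PairMove (α i, β i) q) :
    ReflTransGen TwistMove (α, β) (Function.update α i q.1, Function.update β i q.2) := by
  induction h with
  | refl => simpa using ReflTransGen.refl
  | tail _ h ih =>
    refine ih.tail ?_
    cases h with
    | add a b =>
      simpa using TwistMove.add (Function.update α i a) (Function.update β i b) i
    | sub a b =>
      simpa using TwistMove.sub (Function.update α i a) (Function.update β i b) i

theorem TwistMove.exists_reach_snd_eq_zero (τ : (Fin g → ZMod n) × (Fin g → ZMod n)) :
    ∃ α, ReflTransGen TwistMove τ (α, 0) := by
  have key (s : Finset (Fin g)) : ∃ τ', ReflTransGen TwistMove τ τ' ∧ ∀ i ∈ s, τ'.2 i = 0 := by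
    induction s using Finset.induction_on with
    | empty => exact ⟨τ, .refl, by simp⟩
    | insert i s _ ih =>
      obtain ⟨⟨α, β⟩, h, h0⟩ := ih
      obtain ⟨f, hf⟩ := PairMove.exists_reach (α i) (β i)
      refine ⟨_, h.trans (TwistMove.of_pair α β i hf), fun k hk => ?_⟩
      by_cases hki : k = i
      · simp [hki]
      · simpa [Function.update_of_ne hki] using h0 k (Finset.mem_of_mem_insert_of_ne hk hki)
  obtain ⟨⟨α, β⟩, h, h0⟩ := key Finset.univ
  obtain rfl : β = 0 := funext fun i => h0 i (Finset.mem_univ i)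
  exact ⟨α, h⟩

/-- With all β zero, a link move subtracts α_0 from α_j and leaves -α_0 in β_0. A move in handle 0
removes this again, and the combination is iterated. -/
theorem TwistMove.reach_sub_mul (α : Fin g → ZMod n) (j : Fin g) (hj : j ≠ 0) (c : ZMod n) :
    ReflTransGen TwistMove (α, 0) (Function.update α j (α j - c * α 0), 0) := by
  have key (k : ℕ) :
      ReflTransGen TwistMove (α, 0) (Function.update α j (α j - k * α 0), 0) := by
    induction k with
    | zero => simpa using ReflTransGen.refl
    | succ k ih =>
      refine (ih.tail (TwistMove.link _ _ j hj)).trans ?_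
      refine (TwistMove.of_pair _ _ 0 (PairMove.reach_sub _ _ 1)).trans ?_
      simp only [Function.update_self, Function.update_idem, Function.update_of_ne hj.symm,
        Pi.zero_apply]
      convert ReflTransGen.refl using 2
      · funext i
        by_cases hi : i = j
        · simp [hi, hj]; ring
        · by_cases hi0 : i = 0 <;> simp [hi, hi0, hj.symm]
      · simp
  simpa using key c.val

/-- Handle 0 must first receive a generator of the subgroup spanned by α_0 and α_j. The link move
puts e - d next to d in handle 0, so Euclid there produces f with d and e in ⟨f⟩; what remains in
handle j is a multiple m f and can be subtracted. -/
theorem TwistMove.exists_reach_clear (α : Fin g → ZMod n) (j : Fin g) (hj : j ≠ 0) :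
    ∃ α', ReflTransGen TwistMove (α, 0) (α', 0) ∧ α' j = 0 ∧ ∀ k, k ≠ 0 → k ≠ j → α' k = α k := by
  set d := α 0
  set e := α j
  obtain ⟨f, hf⟩ := PairMove.exists_reach d (e - d)
  obtain ⟨f', hf'⟩ := PairMove.exists_reach (e - d) e
  have hmem := (PairMove.mem_iff (AddSubgroup.zmultiples f) hf).2
    ⟨AddSubgroup.mem_zmultiples f, zero_mem _⟩
  have he : e ∈ AddSubgroup.zmultiples f := by simpa using add_mem hmem.2 hmem.1
  obtain ⟨m, hm⟩ := AddSubgroup.mem_zmultiples_iff.1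
    ((PairMove.mem_iff (AddSubgroup.zmultiples f) hf').1 ⟨hmem.2, he⟩).1
  -- The value e is moved from α_j to β_j, where the link move reads it.
  have h1 : ReflTransGen TwistMove (α, 0)
      (Function.update α j 0, Function.update (0 : Fin g → ZMod n) j e) := by
    refine TwistMove.of_pair α 0 j (q := (0, e)) ?_
    have := (PairMove.reach_sub e 0 1).trans (PairMove.reach_add e (0 + 1 * e) (-1))
    simpa using this
  have h2 := h1.tail (TwistMove.link _ _ j hj)
  simp only [Function.update_self, Function.update_idem, Function.update_of_ne hj.symm,
    Pi.zero_apply, zero_add] at h2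
  have h3 := h2.trans (TwistMove.of_pair _ _ 0 (q := (f, 0))
    (by simpa [Function.update_of_ne hj.symm] using hf))
  have h4 := h3.trans (TwistMove.of_pair _ _ j (q := (f', 0))
    (by simpa [Function.update_of_ne hj] using hf'))
  simp only [Function.update_idem] at h4
  set α₁ := Function.update (Function.update (Function.update α j (e - d)) 0 f) j f' with hα₁
  have hβ : Function.update (Function.update (Function.update (0 : Fin g → ZMod n) j e) 0 0) j 0
      = 0 := by
    funext k
    by_cases hk : k = j
    · simp [hk]
    · by_cases hk0 : k = 0 <;> simp [Function.update_apply, hk, hk0]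
  rw [hβ] at h4
  refine ⟨_, h4.trans (TwistMove.reach_sub_mul α₁ j hj m), ?_, fun k hk0 hkj => ?_⟩
  · have hm' : m * f = f' := by simpa using hm
    simp [hα₁, Function.update_of_ne hj.symm, hm']
  · simp [hα₁, hk0, hkj]

theorem TwistMove.exists_reach_standard (τ : (Fin g → ZMod n) × (Fin g → ZMod n)) :
    ∃ α, ReflTransGen TwistMove τ (α, 0) ∧ ∀ j, j ≠ 0 → α j = 0 := by
  obtain ⟨α, h⟩ := TwistMove.exists_reach_snd_eq_zero τ
  have key (s : Finset (Fin g)) :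
      ∃ α', ReflTransGen TwistMove τ (α', 0) ∧ ∀ j ∈ s, j ≠ 0 → α' j = 0 := by
    induction s using Finset.induction_on with
    | empty => exact ⟨α, h, by simp⟩
    | insert i s _ ih =>
      obtain ⟨α', h', h0⟩ := ih
      by_cases hi : i = 0
      · refine ⟨α', h', fun j hj hj0 => h0 j (Finset.mem_of_mem_insert_of_ne hj ?_) hj0⟩
        rintro rfl
        exact hj0 hi
      · obtain ⟨α'', h'', hi0, hk⟩ := TwistMove.exists_reach_clear α' i hi
        refine ⟨α'', h'.trans h'', fun j hj hj0 => ?_⟩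
        by_cases hji : j = i
        · rw [hji, hi0]
        · rw [hk j hj0 hji, h0 j (Finset.mem_of_mem_insert_of_ne hj hji) hj0]
  obtain ⟨α', h', h0⟩ := key Finset.univ
  exact ⟨α', h', fun j hj => h0 j (Finset.mem_univ j) hj⟩

end Euclid

/-! ### Realizing the moves by homeomorphisms. -/

namespace StandardSurface

variable {g : ℕ}

theorem inducedHom_refl (h : Homeomorph.refl _ (base g) = base g) :
    inducedHom (Homeomorph.refl _) h = MonoidHom.id _ := by
  ext x
  obtain ⟨γ, rfl⟩ := Quotient.exists_rep x
  exact inducedHom_fromPath _ h γ γ fun _ => rfl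

theorem inducedHom_comp (φ ψ : StandardSurface g ≃ₜ StandardSurface g) (h : φ (base g) = base g)
    (h' : ψ (base g) = base g) (h'' : ψ.trans φ (base g) = base g) :
    (inducedHom φ h).comp (inducedHom ψ h') = inducedHom (ψ.trans φ) h'' := by
  ext x
  obtain ⟨γ, rfl⟩ := Quotient.exists_rep x
  refine (congrArg (inducedHom φ h) (inducedHom_mk ψ h' γ)).trans ?_
  refine (inducedHom_mk φ h _).trans (inducedHom_fromPath _ h'' γ _ fun _ => rfl).symm

theorem inducedHom_surjective (φ : StandardSurface g ≃ₜ StandardSurface g)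
    (h : φ (base g) = base g) : Function.Surjective (inducedHom φ h) := by
  have h' : φ.symm (base g) = base g := (φ.symm_apply_eq).2 h.symm
  have h'' : φ.symm.trans φ (base g) = base g := φ.apply_symm_apply _
  have key := inducedHom_comp φ φ.symm h h' h''
  have e : inducedHom (φ.symm.trans φ) h'' = MonoidHom.id _ := by
    have : φ.symm.trans φ = Homeomorph.refl _ := φ.symm_trans_self
    revert h''
    rw [this]
    exact fun h'' _ => inducedHom_refl h''
  rw [e] at key
  exact fun x => ⟨inducedHom φ.symm h' x, DFunLike.congr_fun key x⟩

/-- The values of a homomorphism at the standard generators. -/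
noncomputable def genValues {M : Type*} [AddCommGroup M]
    (p : FundamentalGroup (StandardSurface g) (base g) →* Multiplicative M) :
    (Fin g → M) × (Fin g → M) :=
  (fun i => (p (genA g i)).toAdd, fun i => (p (genB g i)).toAdd)

variable {M : Type*} [AddCommGroup M]
    (p : FundamentalGroup (StandardSurface g) (base g) →* Multiplicative M)

/-- Values on arcs are differences of values on arcs from vertex 0, and in an abelian group the
complete handles in between contribute nothing. -/
theorem map_arcLoop {θ θ' : ℝ} (h : base g = edgePoint g θ) (h' : base g = edgePoint g θ') :
    (p (arcLoop g θ θ' h h')).toAdd =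
      (p (arcLoop g 0 θ' (base_eq g) h')).toAdd - (p (arcLoop g 0 θ (base_eq g) h)).toAdd := by
  rw [← arcLoop_mul g (base_eq g) h h', map_mul, toAdd_mul, add_sub_cancel_right]

variable [NeZero g]

theorem map_vertexLoop (k : ℕ) (hk : k ≤ g) : p (vertexLoop g k hk) = 1 := by
  induction k with
  | zero => rw [vertexLoop_zero, map_one]
  | succ k ih =>
    rw [vertexLoop_succ g ⟨k, hk⟩]
    simp only [map_mul, map_inv, ih (by omega)]
    rw [mul_one, mul_comm (p _)⁻¹ (p (genB g _)), inv_mul_cancel_right, inv_mul_cancel]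

theorem map_arcLoop_zero_four_mul (k : ℕ) (hk : k ≤ g) {θ : ℝ} (hθ : θ = 4 * k)
    (h : base g = edgePoint g θ) : p (arcLoop g 0 θ (base_eq g) h) = 1 := by
  subst hθ
  exact map_vertexLoop p k hk

theorem map_arcLoop_zero_one (i : Fin g) {θ : ℝ} (hθ : θ = 4 * (i : ℕ) + 1)
    (h : base g = edgePoint g θ) :
    (p (arcLoop g 0 θ (base_eq g) h)).toAdd = (genValues p).1 i := by
  subst hθ
  rw [arcLoop_zero_one, map_mul, map_vertexLoop, mul_one, genValues]

theorem map_arcLoop_zero_two (i : Fin g) {θ : ℝ} (hθ : θ = 4 * (i : ℕ) + 2)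
    (h : base g = edgePoint g θ) :
    (p (arcLoop g 0 θ (base_eq g) h)).toAdd = (genValues p).2 i + (genValues p).1 i := by
  subst hθ
  rw [arcLoop_zero_two, map_mul p, map_mul p, map_vertexLoop, mul_one, genValues, toAdd_mul]

theorem map_arcLoop_zero_three (i : Fin g) {θ : ℝ} (hθ : θ = 4 * (i : ℕ) + 3)
    (h : base g = edgePoint g θ) :
    (p (arcLoop g 0 θ (base_eq g) h)).toAdd = (genValues p).2 i := by
  subst hθ
  rw [arcLoop_zero_three, map_mul p, map_mul p, map_mul p, map_vertexLoop, mul_one, genValues,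
    mul_comm, map_inv, mul_inv_cancel_left]

/-- The three moves are the effects of the handle twists for a_i and b_i and of the link twist;
commutators disappear in the abelian target. -/
theorem exists_genValues_of_move {τ : (Fin g → M) × (Fin g → M)}
    (h : TwistMove (genValues p) τ) :
    ∃ (φ : StandardSurface g ≃ₜ StandardSurface g) (hφ : φ (base g) = base g),
      genValues (p.comp (inducedHom φ hφ)) = τ := by
  generalize hv : genValues p = v at h
  cases h with
  | add α β i =>
    obtain ⟨rfl, rfl⟩ := Prod.ext_iff.1 hv
    refine ⟨_, handleTwist_base i 0, Prod.ext (funext fun k => ?_) (funext fun k => ?_)⟩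
    · by_cases hk : k = i
      · subst hk
        dsimp only
        rw [Function.update_self]
        change (p (inducedHom _ _ (genA g k))).toAdd = _
        rw [handleTwist_genA, map_mul, toAdd_mul, add_comm]
        rfl
      · simp [genValues, handleTwist_genA_of_ne i 0 (k := k) (by simp [hk]), hk]
    · simp [genValues, handleTwist_genB_of_ne i 0 (k := k) (by simp)]
  | sub α β i =>
    obtain ⟨rfl, rfl⟩ := Prod.ext_iff.1 hv
    refine ⟨_, handleTwist_base i 1, Prod.ext (funext fun k => ?_) (funext fun k => ?_)⟩
    · simp [genValues, handleTwist_genA_of_ne i 1 (k := k) (by simp)]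
    · by_cases hk : k = i
      · subst hk
        dsimp only
        rw [Function.update_self]
        change (p (inducedHom _ _ (genB g k))).toAdd = _
        rw [handleTwist_genB, map_mul, toAdd_mul, map_inv, toAdd_inv, ← sub_eq_neg_add]
        rfl
      · simp [genValues, handleTwist_genB_of_ne i 1 (k := k) (by simp [hk]), hk]
  | link α β j hj =>
    obtain ⟨rfl, rfl⟩ := Prod.ext_iff.1 hv
    refine ⟨_, linkTwist_base j hj, Prod.ext (funext fun k => ?_) (funext fun k => ?_)⟩
    · by_cases hk : k = j
      · subst hk
        dsimp only
        rw [Function.update_self]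
        change (p (inducedHom _ _ (genA g k))).toAdd = _
        rw [linkTwist_genA, map_mul, toAdd_mul, map_arcLoop p (θ := 1), map_arcLoop p (θ' := 4),
          map_arcLoop_zero_two p k rfl, map_arcLoop_zero_one p 0 (θ := 1) (by simp),
          map_arcLoop_zero_four_mul p 1 (θ := 4) (Nat.one_le_iff_ne_zero.2 (NeZero.ne g))
            (by simp),
          map_arcLoop_zero_four_mul p k k.2.le rfl, toAdd_one]
        abel
      · simp [genValues, linkTwist_genA_of_ne j hj hk, hk]
    · by_cases hk : k = 0
      · subst hk
        dsimp only
        rw [Function.update_self]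
        change (p (inducedHom _ _ (genB g 0))).toAdd = _
        rw [linkTwist_genB, map_mul, toAdd_mul, map_arcLoop p (θ := 1), map_arcLoop p (θ' := 3),
          map_arcLoop_zero_three p j rfl, map_arcLoop_zero_one p 0 (θ := 1) (by simp),
          map_arcLoop_zero_three p 0 (θ := 3) (by simp),
          map_arcLoop_zero_four_mul p j j.2.le rfl, toAdd_one]
        abel
      · simp [genValues, linkTwist_genB_of_ne j hj hk, hk]

theorem exists_genValues_of_reach {τ : (Fin g → M) × (Fin g → M)}
    (h : ReflTransGen TwistMove (genValues p) τ) :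
    ∃ (φ : StandardSurface g ≃ₜ StandardSurface g) (hφ : φ (base g) = base g),
      genValues (p.comp (inducedHom φ hφ)) = τ := by
  induction h with
  | refl =>
    have h : Homeomorph.refl _ (base g) = base g := rfl
    refine ⟨Homeomorph.refl _, h, ?_⟩
    rw [inducedHom_refl, MonoidHom.comp_id]
  | tail _ h ih =>
    obtain ⟨φ, hφ, rfl⟩ := ih
    obtain ⟨ψ, hψ, rfl⟩ := exists_genValues_of_move _ h
    have hψφ : ψ.trans φ (base g) = base g := (congrArg φ hψ).trans hφ
    exact ⟨ψ.trans φ, hψφ, by rw [MonoidHom.comp_assoc, inducedHom_comp φ ψ hφ hψ hψφ]⟩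

/-- Every epimorphism onto `ℤ/n` becomes standard after a homeomorphism of the surface. -/
theorem exists_isStandardOn {n : ℕ} [NeZero n]
    (p : FundamentalGroup (StandardSurface g) (base g) →* Multiplicative (ZMod n))
    (hp : Function.Surjective p) :
    ∃ (φ : StandardSurface g ≃ₜ StandardSurface g) (hφ : φ (base g) = base g),
      IsStandardOn (p.comp (inducedHom φ hφ)) (genA g) (genB g) := by
  obtain ⟨α, hα, h0⟩ := TwistMove.exists_reach_standard (genValues p)
  obtain ⟨φ, hφ, h⟩ := exists_genValues_of_reach p hα
  obtain ⟨hA, hB⟩ := Prod.ext_iff.1 h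
  have htA (i : Fin g) (hi : i ≠ 0) : (p.comp (inducedHom φ hφ)) (genA g i) = 1 :=
    Multiplicative.toAdd.injective ((congrFun hA i).trans (h0 i hi))
  have htB (i : Fin g) : (p.comp (inducedHom φ hφ)) (genB g i) = 1 :=
    Multiplicative.toAdd.injective (congrFun hB i)
  refine ⟨φ, hφ, ?_, htA, htB⟩
  have hs : Function.Surjective (p.comp (inducedHom φ hφ)) :=
    hp.comp (inducedHom_surjective φ hφ)
  generalize p.comp (inducedHom φ hφ) = p' at *
  -- Surjectivity makes the values at the sides generate ℤ/n, and all of them except the one at a_0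
  -- are trivial.
  rw [eq_top_iff, ← MonoidHom.range_eq_top.2 hs, MonoidHom.range_eq_map, ← sideSubgroup_eq_top,
    sideSubgroup, MonoidHom.map_closure, Subgroup.closure_le]
  rintro _ ⟨_, ⟨i, rfl⟩ | ⟨i, rfl⟩, rfl⟩
  · by_cases hi : i = 0
    · rw [hi]; exact Subgroup.mem_zpowers _
    · rw [htA i hi]; exact one_mem _
  · rw [htB i]; exact one_mem _

end StandardSurface

/-! ### Functoriality of the fundamental group -/

namespace FundamentalGroup

variable {X Y Z : Type*} [TopologicalSpace X] [TopologicalSpace Y] [TopologicalSpace Z]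

theorem mapOfEq_mapOfEq (f : C(X, Y)) (k : C(Y, Z)) {x : X} {y : Y} {z : Z} (h : f x = y)
    (h' : k y = z) (h'' : k.comp f x = z) (p : FundamentalGroup X x) :
    mapOfEq k h' (mapOfEq f h p) = mapOfEq (k.comp f) h'' p := by
  subst h h'
  obtain ⟨γ, rfl⟩ := Quotient.exists_rep p
  refine (congrArg _ (mapOfEq_fromPath f rfl γ (γ.map f.continuous) fun _ => rfl)).trans ?_
  refine (mapOfEq_fromPath k rfl _ ((γ.map f.continuous).map k.continuous) fun _ => rfl).trans ?_
  exact (mapOfEq_fromPath (k.comp f) rfl γ _ fun _ => rfl).symm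

theorem mapOfEq_of_eq_id (f : C(X, X)) (hf : ∀ x, f x = x) {x : X} (h : f x = x)
    (p : FundamentalGroup X x) : mapOfEq f h p = p := by
  obtain ⟨γ, rfl⟩ := Quotient.exists_rep p
  exact mapOfEq_fromPath f h γ γ fun _ => (hf _).symm

/-- The isomorphism of fundamental groups induced by a homeomorphism. -/
noncomputable def mulEquivOfHomeomorph (e : X ≃ₜ Y) {x : X} {y : Y} (h : e x = y) :
    FundamentalGroup X x ≃* FundamentalGroup Y y where
  __ := mapOfEq (e : C(X, Y)) h
  invFun := mapOfEq (e.symm : C(Y, X)) (e.symm_apply_eq.2 h.symm)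
  left_inv p := by
    have h' : ((e.symm : C(Y, X)).comp (e : C(X, Y))) x = x := e.symm_apply_apply x
    exact (mapOfEq_mapOfEq _ _ h _ h' p).trans (mapOfEq_of_eq_id _ e.symm_apply_apply h' p)
  right_inv p := by
    have h' : ((e : C(X, Y)).comp (e.symm : C(Y, X))) y = y := e.apply_symm_apply y
    exact (mapOfEq_mapOfEq _ _ _ h h' p).trans (mapOfEq_of_eq_id _ e.apply_symm_apply h' p)

theorem mapOfEq_rfl (f : C(X, Y)) (x : X) : mapOfEq f (rfl : f x = f x) = map f x := by
  ext p
  obtain ⟨γ, rfl⟩ := Quotient.exists_rep p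
  exact mapOfEq_fromPath f rfl γ (γ.map f.continuous) fun _ => rfl

end FundamentalGroup

/-! ### Transport of standard generating systems -/

theorem IsStandardGeneratingSystem.map {G : Type u} {H : Type v} [Group G] [Group H] {g : ℕ}
    {x y : Fin g → G} (h : IsStandardGeneratingSystem x y) (f : G ≃* H) :
    IsStandardGeneratingSystem (fun i => f (x i)) (fun i => f (y i)) where
  generates := by
    have := congrArg (Subgroup.map f.toMonoidHom) h.generates
    rw [MonoidHom.map_closure, Set.image_union, ← Set.range_comp, ← Set.range_comp,
      Subgroup.map_top_of_surjective f.toMonoidHom f.surjective] at this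
    exact this
  relation := by
    refine (map_commutatorProduct f.toMonoidHom x y).symm.trans ?_
    rw [h.relation, map_one]
  defining := by
    rw [← h.defining]
    have : FreeGroup.lift (Sum.elim (fun i => f (x i)) fun i => f (y i)) =
        f.toMonoidHom.comp (FreeGroup.lift (Sum.elim x y)) := by
      apply FreeGroup.ext_hom
      rintro (i | i) <;> simp
    rw [this]
    ext w
    exact f.map_eq_one_iff

theorem IsStandardOn.inv {G : Type u} [Group G] {g n : ℕ} [NeZero g]
    {p : G →* Multiplicative (ZMod n)} {x y : Fin g → G} (h : IsStandardOn p x y) :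
    IsStandardOn p (fun i => (x i)⁻¹) (fun i => (y i)⁻¹) where
  generator := by rw [map_inv, Subgroup.zpowers_inv, h.generator]
  trivial_x i hi := by rw [map_inv, h.trivial_x i hi, inv_one]
  trivial_y i := by rw [map_inv, h.trivial_y i, inv_one]

instance (g : ℕ) : PathConnectedSpace (StandardSurface g) :=
  Function.Surjective.pathConnectedSpace Quot.mk_surjective continuous_quot_mk

/-- Every epimorphism of the fundamental group of a closed surface onto `ℤ/n` is standard on a
suitable standard generating system. -/
theorem exists_isStandardGeneratingSystem_isStandardOn {g n : ℕ} [NeZero g] [NeZero n]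
    {S : Type u} [TopologicalSpace S] (hS : IsClosedSurface g S) (s : S)
    (p : FundamentalGroup S s →* Multiplicative (ZMod n)) (hp : Function.Surjective p) :
    ∃ x y : Fin g → FundamentalGroup S s,
      IsStandardGeneratingSystem x y ∧ IsStandardOn p x y := by
  obtain ⟨e⟩ := hS
  let ψ : FundamentalGroup (StandardSurface g) (StandardSurface.base g) ≃* FundamentalGroup S s :=
    (FundamentalGroup.fundamentalGroupMulEquivOfPathConnected _ (e s)).trans
      (FundamentalGroup.mulEquivOfHomeomorph e.symm (e.symm_apply_apply s))
  obtain ⟨φ, hφ, h⟩ := StandardSurface.exists_isStandardOn (p.comp ψ.toMonoidHom)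
    (hp.comp ψ.surjective)
  -- The basis is the image of the inverse sides under φ_*, moved to S by ψ. The values of p on it
  -- are those of the standardized homomorphism at the inverse sides.
  refine ⟨_, _, (StandardSurface.isStandardGeneratingSystem_gen g).map
    ((FundamentalGroup.mulEquivOfHomeomorph φ hφ).trans ψ), ?_⟩
  exact ⟨h.inv.generator, h.inv.trivial_x, h.inv.trivial_y⟩

/-! ### Deck transformations and quotient coverings -/

section Deck

variable {E : Type u} {X : Type v} [TopologicalSpace E] [TopologicalSpace X]

/-- Deck transformations act on the total space. -/
instance deckGroup.instMulAction (q : E → X) : MulAction (deckGroup q) E where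
  smul f e := f.1 e
  one_smul _ := rfl
  mul_smul _ _ _ := rfl

theorem deckGroup.eq_of_apply_eq [PreconnectedSpace E] {q : E → X} (hq : IsCoveringMap q)
    {f f' : E ≃ₜ E} (hf : f ∈ deckGroup q) (hf' : f' ∈ deckGroup q) {e : E} (h : f e = f' e) :
    f = f' :=
  Homeomorph.ext fun z => congrFun (hq.eq_of_comp_eq f.continuous f'.continuous
    (funext fun z => (hf z).trans (hf' z).symm) e h) z

/-- G is transitive on fibers, and a deck transformation is determined by its value at one point.
Hence G is the whole deck group. -/
theorem IsQuotientCoveringMap.isCyclicNormalCovering [ConnectedSpace E] {n : ℕ} {q : E → X}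
    {G : Type w} [Group G] [MulAction G E] (hq : IsQuotientCoveringMap q G)
    (hG : Nonempty (G ≃* Multiplicative (ZMod n))) : IsCyclicNormalCovering n q := by
  have := hq.toContinuousConstSMul
  have hc := hq.isCoveringMap
  have hsmul (k : G) : Homeomorph.smul k ∈ deckGroup q := fun e => hq.map_smul k
  have hex (e e' : E) (h : q e = q e') : ∃ k : G, k • e = e' :=
    hq.apply_eq_iff_mem_orbit.1 h.symm
  obtain ⟨e₀⟩ := (inferInstance : Nonempty E)
  let F : G →* deckGroup q :=
    { toFun := fun k => ⟨Homeomorph.smul k, hsmul k⟩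
      map_one' := Subtype.ext (Homeomorph.ext fun e => one_smul G e)
      map_mul' := fun k k' => Subtype.ext (Homeomorph.ext fun e => mul_smul k k' e) }
  have hF : Function.Bijective F := by
    constructor
    · intro k k' h
      exact hq.isCancelSMul.right_cancel _ _ e₀
        (DFunLike.congr_fun (congrArg Subtype.val h) e₀)
    · rintro ⟨f, hf⟩
      obtain ⟨k, hk⟩ := hex e₀ (f e₀) (hf e₀).symm
      exact ⟨k, Subtype.ext (deckGroup.eq_of_apply_eq hc (hsmul k) hf hk)⟩
  refine ⟨hc, inferInstance, fun e e' h => ?_, ?_⟩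
  · obtain ⟨k, hk⟩ := hex e e' h
    exact ⟨_, hsmul k, hk⟩
  · exact hG.map fun i => (MulEquiv.ofBijective F hF).symm.trans i

theorem IsCoveringMap.surjective_of_pathConnected [Nonempty E] [PathConnectedSpace X] {q : E → X}
    (hq : IsCoveringMap q) : Function.Surjective q := by
  intro x
  obtain ⟨e⟩ := ‹Nonempty E›
  let γ := PathConnectedSpace.somePath (q e) x
  obtain ⟨Γ, hΓ, -⟩ := hq.exists_path_lifts γ e γ.source
  exact ⟨Γ 1, (congrFun hΓ 1).trans γ.target⟩

theorem IsCyclicNormalCovering.isQuotientCoveringMap [PathConnectedSpace X] {n : ℕ} {q : E → X}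
    (hq : IsCyclicNormalCovering n q) : IsQuotientCoveringMap q (deckGroup q) := by
  have := hq.connected
  refine (isQuotientCoveringMap_iff_isCoveringMap_and _ _).2 ⟨hq.isCoveringMap,
    hq.isCoveringMap.surjective_of_pathConnected, ⟨fun f => f.1.continuous⟩,
    ⟨fun f f' e h => Subtype.ext (deckGroup.eq_of_apply_eq hq.isCoveringMap f.2 f'.2 h)⟩,
    fun {e₁ e₂} => ⟨fun h => ?_, ?_⟩⟩
  · obtain ⟨f, hf, h'⟩ := hq.normal e₂ e₁ h.symm
    exact ⟨⟨f, hf⟩, h'⟩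
  · rintro ⟨f, rfl⟩
    exact f.2 e₂

theorem IsCoveringMap.locallyPathConnectedSpace [LocallyPathConnectedSpace X] {q : E → X}
    (hq : IsCoveringMap q) : LocallyPathConnectedSpace E := by
  choose c hc _ using hq.isLocalHomeomorph
  let _ : ChartedSpace X E :=
    { atlas := Set.range c, chartAt := c, mem_chart_source := hc,
      chart_mem_atlas := fun x => ⟨x, rfl⟩ }
  exact ChartedSpace.locallyPathConnectedSpace X E

/-- The epimorphism of the fundamental group of the base of a cyclic normal covering. -/
theorem IsCyclicNormalCovering.exists_surjective [PathConnectedSpace X]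
    [LocallyPathConnectedSpace X] {n : ℕ} {q : C(E, X)} (hq : IsCyclicNormalCovering n q) {e : E}
    {x : X} (he : q e = x) :
    ∃ p : FundamentalGroup X x →* Multiplicative (ZMod n), Function.Surjective p ∧
      p.ker = (FundamentalGroup.mapOfEq q he).range := by
  have hQ := hq.isQuotientCoveringMap
  have := hq.connected
  have := hq.isCoveringMap.locallyPathConnectedSpace
  have : PathConnectedSpace E := pathConnectedSpace_iff_connectedSpace.2 inferInstance
  obtain ⟨i⟩ := hq.deck
  let j : (deckGroup q)ᵐᵒᵖ ≃* Multiplicative (ZMod n) :=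
    (MulEquiv.inv' (deckGroup q)).symm.trans i
  refine ⟨j.toMonoidHom.comp (hQ.fundamentalGroupToMulOpposite ⟨e, he⟩),
    j.surjective.comp (hQ.fundamentalGroupToMulOpposite_surjective ⟨e, he⟩), ?_⟩
  refine Eq.trans ?_ (hQ.ker_monodromyPerm ⟨e, he⟩)
  rw [← hQ.ker_fundamentalGroupToMulOpposite ⟨e, he⟩]
  ext c
  exact j.map_eq_one_iff

end Deck

/-! ### Connected coverings are determined by their subgroups. -/

section Classification

variable {E : Type u} {E' : Type v} {X : Type w} [TopologicalSpace E] [TopologicalSpace E']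
  [TopologicalSpace X] [LocallyPathConnectedSpace X]

theorem IsCoveringMap.exists_lift_of_range_le [ConnectedSpace E] {c : C(E, X)} {c' : C(E', X)}
    (hc : IsCoveringMap c) (hc' : IsCoveringMap c') {x : X} {e : E} {e' : E'} (he : c e = x)
    (he' : c' e' = x)
    (hr : (FundamentalGroup.mapOfEq c he).range ≤ (FundamentalGroup.mapOfEq c' he').range) :
    ∃ F : C(E, E'), F e = e' ∧ ∀ z, c' (F z) = c z := by
  have := hc.locallyPathConnectedSpace
  have : PathConnectedSpace E := pathConnectedSpace_iff_connectedSpace.2 inferInstance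
  subst he
  rw [FundamentalGroup.mapOfEq_rfl] at hr
  obtain ⟨F, ⟨h, h'⟩, -⟩ := hc'.existsUnique_continuousMap_lifts_of_range_le he' hr
  exact ⟨F, h, congrFun h'⟩

/-- Connected coverings with the same image of the fundamental group are isomorphic. -/
theorem IsCoveringMap.exists_homeomorph_of_range_eq [ConnectedSpace E] [ConnectedSpace E']
    {c : C(E, X)} {c' : C(E', X)} (hc : IsCoveringMap c) (hc' : IsCoveringMap c') {x : X} {e : E}
    {e' : E'} (he : c e = x) (he' : c' e' = x)
    (hr : (FundamentalGroup.mapOfEq c he).range = (FundamentalGroup.mapOfEq c' he').range) :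
    ∃ Φ : E ≃ₜ E', ∀ z, c' (Φ z) = c z := by
  obtain ⟨F, hF, h⟩ := hc.exists_lift_of_range_le hc' he he' hr.le
  obtain ⟨F', hF', h'⟩ := hc'.exists_lift_of_range_le hc he' he hr.ge
  have h1 : F' ∘ F = id := hc.eq_of_comp_eq (F'.continuous.comp F.continuous) continuous_id
    (funext fun z => (h' _).trans (h z)) e (by simp [hF, hF'])
  have h2 : F ∘ F' = id := hc'.eq_of_comp_eq (F.continuous.comp F'.continuous) continuous_id
    (funext fun z => (h _).trans (h' z)) e' (by simp [hF, hF'])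
  exact ⟨⟨⟨F, F', congrFun h1, congrFun h2⟩, F.continuous, F'.continuous⟩, h⟩

end Classification

/-! ### Standard cyclic coverings -/

namespace StandardSurface

variable (g n : ℕ) [NeZero g]

/-- The polygon covering is taken for the group ℤ/n, with x_0 a generator and all other elements
trivial. The relation is automatic because every y_i is trivial. -/
theorem exists_isStandardCyclicCovering :
    ∃ (E₀ : Type) (_ : TopologicalSpace E₀) (q₀ : C(E₀, StandardSurface g)),
      IsStandardCyclicCovering g n q₀ ∧ IsCyclicNormalCovering n q₀ := by
  let c : Multiplicative (ZMod n) := Multiplicative.ofAdd 1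
  let x : Fin g → Multiplicative (ZMod n) := fun i => if i = 0 then c else 1
  let y : Fin g → Multiplicative (ZMod n) := fun _ => 1
  have hc : Subgroup.zpowers c = ⊤ := by
    refine Subgroup.eq_top_iff' _ |>.2 fun k => Subgroup.mem_zpowers_iff.2 ?_
    obtain ⟨m, hm⟩ := ZMod.intCast_surjective k.toAdd
    exact ⟨m, Multiplicative.toAdd.injective (by simp [c, hm])⟩
  have hxy : commutatorProduct x y = 1 := by
    simp [commutatorProduct, y]
  have hgen : Subgroup.closure (Set.range x ∪ Set.range y) = ⊤ := by
    rw [eq_top_iff, ← hc, Subgroup.zpowers_le]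
    exact Subgroup.subset_closure (.inl ⟨0, if_pos rfl⟩)
  have hp := SurfaceCover.pathConnectedSpace hgen
  have hq := SurfaceCover.isQuotientCoveringMap_toSurface hxy
  refine ⟨SurfaceCover x y, inferInstance, SurfaceCover.toSurface x y,
    ⟨hq.isCoveringMap, inferInstance, SurfaceCover.origin x y,
      SurfaceCover.toSurface_origin x y,
      SurfaceCover.holonomy hxy, ⟨?_, fun i hi => ?_, fun i => ?_⟩,
      SurfaceCover.ker_holonomy hxy |>.symm⟩,
    hq.isCyclicNormalCovering ⟨MulEquiv.refl _⟩⟩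
  · rw [SurfaceCover.holonomy_genA, Subgroup.zpowers_inv]
    exact hc
  · rw [SurfaceCover.holonomy_genA, inv_eq_one]
    exact if_neg hi
  · rw [SurfaceCover.holonomy_genB, inv_eq_one]

variable {g n}

/-- The kernel of a homomorphism that is standard on the standard generators is determined. -/
theorem ker_eq_of_isStandardOn
    {p p' : FundamentalGroup (StandardSurface g) (base g) →* Multiplicative (ZMod n)}
    (hp : IsStandardOn p (genA g) (genB g)) (hp' : IsStandardOn p' (genA g) (genB g)) :
    p.ker = p'.ker := by
  revert p p'
  suffices h : ∀ p p' : FundamentalGroup (StandardSurface g) (base g) →* Multiplicative (ZMod n),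
      IsStandardOn p (genA g) (genB g) → IsStandardOn p' (genA g) (genB g) → p.ker ≤ p'.ker from
    fun p p' hp hp' => (h p p' hp hp').antisymm (h p' p hp' hp)
  intro p p' hp hp'
  -- The value of p' at a_0 is the m-th power of that of p, and at the other sides both are trivial;
  -- so p' is p followed by the m-th power map.
  obtain ⟨m, hm⟩ : p' (genA g 0) ∈ Subgroup.zpowers (p (genA g 0)) := hp.generator ▸ trivial
  have : p' = (zpowGroupHom m).comp p := by
    refine MonoidHom.eq_of_eqOn_dense (sideSubgroup_eq_top (g := g)) ?_
    rintro _ (⟨i, rfl⟩ | ⟨i, rfl⟩)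
    · by_cases hi : i = 0
      · rw [hi]
        exact hm.symm
      · rw [MonoidHom.comp_apply, hp.trivial_x i hi, hp'.trivial_x i hi, map_one]
    · rw [MonoidHom.comp_apply, hp.trivial_y i, hp'.trivial_y i, map_one]
  intro k hk
  rw [MonoidHom.mem_ker, this, MonoidHom.comp_apply, MonoidHom.mem_ker.1 hk, map_one]

end StandardSurface

theorem IsCyclicNormalCovering.coveringsEquivalent {g n : ℕ} [NeZero g] [NeZero n] {S : Type u}
    [TopologicalSpace S] (hS : IsClosedSurface g S) {E : Type v} [TopologicalSpace E] {q : E → S}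
    (hq : IsCyclicNormalCovering n q) {E₀ : Type w} [TopologicalSpace E₀]
    {q₀ : C(E₀, StandardSurface g)} (hq₀ : IsStandardCyclicCovering g n q₀) :
    CoveringsEquivalent q q₀ := by
  obtain ⟨ε⟩ := hS
  have := hq.connected
  have := hq₀.connected
  have hPS : PathConnectedSpace S := ε.symm.surjective.pathConnectedSpace ε.symm.continuous
  have hQ := hq.isQuotientCoveringMap.homeomorph_comp ε
  let c : C(E, StandardSurface g) := ⟨ε ∘ q, hQ.isCoveringMap.continuous⟩
  have hc : IsCyclicNormalCovering n c := hQ.isCyclicNormalCovering hq.deck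
  obtain ⟨e, he⟩ := hQ.surjective (StandardSurface.base g)
  obtain ⟨p, hp, hker⟩ := hc.exists_surjective (q := c) he
  obtain ⟨φ, hφ, hstd⟩ := StandardSurface.exists_isStandardOn p hp
  obtain ⟨e₀, he₀, ρ, hρ, hρker⟩ := hq₀.corresponds
  have hφ' : φ.symm (StandardSurface.base g) = StandardSurface.base g :=
    φ.symm_apply_eq.2 hφ.symm
  let c₁ : C(E, StandardSurface g) := (φ.symm : C(StandardSurface g, StandardSurface g)).comp c
  have hc₁ : IsCoveringMap c₁ := (hQ.homeomorph_comp φ.symm).isCoveringMap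
  have he₁ : c₁ e = StandardSurface.base g := (congrArg φ.symm he).trans hφ'
  let M := FundamentalGroup.mulEquivOfHomeomorph φ hφ
  -- Composing the covering with φ⁻¹ replaces its subgroup ker p by the preimage of ker p under φ_*,
  -- that is, by the kernel of the standardized homomorphism.
  have hr : (FundamentalGroup.mapOfEq c₁ he₁).range = ρ.ker := by
    rw [← StandardSurface.ker_eq_of_isStandardOn hstd hρ]
    ext k
    have h1 (y : FundamentalGroup E e) : FundamentalGroup.mapOfEq c₁ he₁ y = k ↔
        FundamentalGroup.mapOfEq c he y = M k := by
      rw [← FundamentalGroup.mapOfEq_mapOfEq c _ he hφ' he₁]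
      exact M.symm_apply_eq
    refine (exists_congr h1).trans ?_
    exact SetLike.ext_iff.1 hker.symm (M k)
  obtain ⟨Φ, hΦ⟩ := hc₁.exists_homeomorph_of_range_eq hq₀.isCoveringMap he₁ he₀
    (hr.trans hρker.symm)
  exact ⟨Φ, ε.trans φ.symm, hΦ⟩

theorem lemma4p7 (g n : ℕ) [NeZero g] [NeZero n] :
    -- every epimorphism of the surface group onto `ℤ/n` is standard on a suitable basis
    (∀ (S : Type u) [TopologicalSpace S], IsClosedSurface g S →
      ∀ (s : S) (p : FundamentalGroup S s →* Multiplicative (ZMod n)), Function.Surjective p →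
        ∃ x y : Fin g → FundamentalGroup S s,
          IsStandardGeneratingSystem x y ∧ IsStandardOn p x y) ∧
    -- the standard cyclic covering exists, and it is a cyclic normal covering
    (∃ (E₀ : Type) (_ : TopologicalSpace E₀) (q₀ : C(E₀, StandardSurface g)),
      IsStandardCyclicCovering g n q₀ ∧ IsCyclicNormalCovering n q₀) ∧
    -- every cyclic normal covering is equivalent to the standard one
    (∀ (S : Type u) [TopologicalSpace S], IsClosedSurface g S →
      ∀ (E : Type v) [TopologicalSpace E] (q : E → S), IsCyclicNormalCovering n q →
        ∀ (E₀ : Type w) [TopologicalSpace E₀] (q₀ : C(E₀, StandardSurface g)),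
          IsStandardCyclicCovering g n q₀ → CoveringsEquivalent q q₀) := by
  exact ⟨fun S _ hS s p hp => exists_isStandardGeneratingSystem_isStandardOn hS s p hp,
    StandardSurface.exists_isStandardCyclicCovering g n,
    fun S _ hS E _ q hq E₀ _ q₀ hq₀ => hq.coveringsEquivalent hS hq₀⟩
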